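/- Let $X=\mathbb{R}\times\mathbb{S}^1$ with $\mathbb{S}^1=\mathbb{R}/2\pi\mathbb{Z}$ and coordinates $(x,\theta)$, let $\Delta=\partial_x^2+\partial_\theta^2$, and let $V(x,\theta)=2\chi_{[-1,1]}(x)\cos\theta$, where $\chi_{[-1,1]}$ is the characteristic function of $[-1,1]$. Let $\hat Z$ be the minimal Riemann surface on which the functions $\tau_j(\zeta)=(\zeta^2-j^2)^{1/2}$, $j\in\mathbb{N}_0$ (with $\tau_0(\zeta)=\zeta$ and $\operatorname{Im}\tau_j>0$ for all $j$ when $\zeta$ is in the upper half plane), are all single-valued and analytic, and call $\{\zeta\in\hat Z:\operatorname{Im}\tau_j(\zeta)>0\text{ for all }j\}$, which is identified with the upper half plane, the physical space. For $\zeta$ in the physical space let $R_V(\zeta)=(-\Delta+V-\zeta^2)^{-1}$ on $L^2(X)$, wherever this inverse exists, and denote by $R_V$ also its meromorphic continuation to $\hat Z$ as an operator from $L^2_c(X)$ to $L^2_{\mathrm{loc}}(X)$ (that is, the continuation of $\chi R_V\chi$ as a family of bounded operators on $L^2(X)$, for every $\chi\in L^\infty_c(X)$; a pole of $R_V$ is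 a pole of $\chi R_V\chi$ for some such $\chi$). For $l\in\mathbb{N}_0$ let $B_l(1)$ be the connected component of $\{\zeta\in\hat Z:|\tau_l(\zeta)|<1\}$ that meets both the physical space and $\{\operatorname{Re}\tau_0>0\}$. Then there are $C>0$ and $L\in\mathbb{N}$ such that, for every integer $l\ge L$, every pole $\zeta$ of $R_V$ in $B_l(1)$ satisfies $$\left|\tau_l(\zeta)-\frac{1}{4l\sqrt{2l}}\left(-1-i+e^{2i\sqrt{2l}}\right)\right|\le \frac{C}{l^{2}}.$$ -/

import Mathlib

open MeasureTheory Filter Topology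
open scoped ENNReal ContDiff

noncomputable section

namespace CylinderResonance

/-! ### The cylinder `X = ℝ × 𝕊¹`, its Laplacian, and resolvents of Schrödinger operators -/

instance factTwoPiPos : Fact (0 < 2 * Real.pi) := ⟨Real.two_pi_pos⟩

/-- The cylinder `ℝ × 𝕊¹`, with `𝕊¹ = ℝ / 2πℤ`; its `volume` is `dx dθ`, of mass `2π` on `𝕊¹`. -/
abbrev X : Type := ℝ × AddCircle (2 * Real.pi)

/-- `L²(X)`. -/
abbrev L2 : Type := Lp ℂ 2 (volume : Measure X)

/-- `C_c^∞(X)`: smoothness is tested on the lift to `ℝ × ℝ`. -/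
structure IsTestFunction (φ : X → ℂ) : Prop where
  smooth : ContDiff ℝ ∞ (fun q : ℝ × ℝ => φ (q.1, (q.2 : AddCircle (2 * Real.pi))))
  compactSupport : HasCompactSupport φ

/-- `Δφ = ∂²φ/∂x² + ∂²φ/∂θ²`. -/
def laplacian (φ : X → ℂ) (p : X) : ℂ :=
  iteratedDeriv 2 (fun s : ℝ => φ (s, p.2)) p.1 +
    iteratedDeriv 2 (fun s : ℝ => φ (p.1, p.2 + (s : AddCircle (2 * Real.pi)))) 0

/-- `(-Δ + V - w) u = f` in the sense of distributions on `X`. -/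
def SolvesWeakly (V : X → ℂ) (w : ℂ) (u f : L2) : Prop :=
  ∀ φ : X → ℂ, IsTestFunction φ →
    ∫ p : X, u p * (-laplacian φ p + (V p - w) * φ p) = ∫ p : X, f p * φ p

/-- `R` is the bounded inverse `(-Δ + V - w)⁻¹` on `L²(X)`. The operator `-Δ + V` has the domain of
all `u ∈ L²(X)` with `Δu ∈ L²(X)` in the sense of distributions (for bounded `V`, this is `H²(X)`),
so that `R` inverts `-Δ + V - w` iff, for `u, f ∈ L²(X)`, the equation `(-Δ + V - w) u = f` holds
exactly when `u = R f`. -/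
def IsResolvent (V : X → ℂ) (w : ℂ) (R : L2 →L[ℂ] L2) : Prop :=
  ∀ u f : L2, SolvesWeakly V w u f ↔ u = R f

/-- `χ ∈ L^∞_c(X)`. -/
def IsCompactlySupported (χ : Lp ℂ ∞ (volume : Measure X)) : Prop :=
  ∃ K : Set X, IsCompact K ∧ ∀ᵐ p : X, p ∉ K → χ p = 0

/-! ### The Riemann surface `Ẑ` -/

/-- The minimal Riemann surface on which all `τ_j = (ζ² - j²)^{1/2}`, `j ∈ ℕ₀`, are single-valued.
A point is given by its values `τ_j`, where `τ_0 = ζ`. Continuation from the upper half plane, where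
`Im τ_j > 0` for all `j`, reaches exactly the choices of square roots with `Im τ_j > 0` for all but
finitely many `j`. -/
structure ZHat : Type where
  /-- the functions `τ_j` -/
  τ : ℕ → ℂ
  sq_eq : ∀ j : ℕ, τ j ^ 2 = τ 0 ^ 2 - (j : ℂ) ^ 2
  im_pos : ∀ᶠ j in atTop, 0 < (τ j).im

/-- The topology of `Ẑ` is that of the distance `sup_j |τ_j(ζ) - τ_j(ζ')|`. -/
instance : TopologicalSpace ZHat :=
  TopologicalSpace.induced (fun ζ : ZHat => UniformFun.ofFun ζ.τ)
    (inferInstance : TopologicalSpace (UniformFun ℕ ℂ))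

/-- The physical space. -/
def physicalSpace : Set ZHat := {ζ | ∀ j, 0 < (ζ.τ j).im}

/-- `B_l(ρ)`: the connected component of `{|τ_l| < ρ}` that meets both the physical space and
`{Re τ_0 > 0}`. -/
def B (l : ℕ) (ρ : ℝ) : Set ZHat :=
  {ζ | ‖ζ.τ l‖ < ρ ∧
    (connectedComponentIn {ξ : ZHat | ‖ξ.τ l‖ < ρ} ζ ∩ physicalSpace).Nonempty ∧
    (connectedComponentIn {ξ : ZHat | ‖ξ.τ l‖ < ρ} ζ ∩ {ξ : ZHat | 0 < (ξ.τ 0).re}).Nonempty}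

/-- `τ_k` is a local coordinate of `Ẑ` at `ζ`, i.e. `dτ_k ≠ 0` there. As
`τ_k dτ_k = τ_j dτ_j` and at most one `τ_j` vanishes at `ζ`, this says that no `τ_j` with `j ≠ k`
vanishes at `ζ`. -/
def IsCoordinateAt (k : ℕ) (ζ : ZHat) : Prop := ∀ j, ζ.τ j = 0 → j = k

/-- `F` is holomorphic at `ζ` (read in a local coordinate `τ_k`). -/
def HolomorphicAtZ {E : Type*} [NormedAddCommGroup E] [NormedSpace ℂ E] (F : ZHat → E)
    (ζ : ZHat) : Prop :=
  ∃ k, IsCoordinateAt k ζ ∧ ∃ g : ℂ → E, AnalyticAt ℂ g (ζ.τ k) ∧ ∀ᶠ ξ in 𝓝 ζ, F ξ = g (ξ.τ k)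

/-- `F` is meromorphic at `ζ` (read in a local coordinate `τ_k`). -/
def MeromorphicAtZ {E : Type*} [NormedAddCommGroup E] [NormedSpace ℂ E] (F : ZHat → E)
    (ζ : ZHat) : Prop :=
  ∃ k, IsCoordinateAt k ζ ∧
    ∃ g : ℂ → E, MeromorphicAt g (ζ.τ k) ∧ ∀ᶠ ξ in 𝓝[≠] ζ, F ξ = g (ξ.τ k)

/-! ### The continued resolvent and its poles -/

/-- `M` is the meromorphic continuation to the connected open set `U ⊆ Ẑ` of the cut-off resolvent
`χ R_V(ζ) χ`, where `R_V(ζ) = (-Δ + V - ζ²)⁻¹` on the physical space (`ζ = τ_0`). -/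
structure IsContinuation (V : X → ℂ) (χ : Lp ℂ ∞ (volume : Measure X)) (U : Set ZHat)
    (M : ZHat → L2 →L[ℂ] L2) : Prop where
  isOpen : IsOpen U
  isPreconnected : IsPreconnected U
  meets_physical : ∃ ζ ∈ U ∩ physicalSpace, ∃ R, IsResolvent V (ζ.τ 0 ^ 2) R
  meromorphic : ∀ ζ ∈ U, MeromorphicAtZ M ζ
  eq_resolvent : ∀ ζ ∈ U ∩ physicalSpace, ∀ R, IsResolvent V (ζ.τ 0 ^ 2) R →
    ∀ f : L2, M ζ f = (χ • (R (χ • f : L2)) : L2)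

/-- `ζ` is a pole of the (continued) resolvent `R_V : L²_c(X) → L²_loc(X)`: for some
`χ ∈ L^∞_c(X)`, no meromorphic continuation of `χ R_V χ` is holomorphic at `ζ`. -/
def IsPole (V : X → ℂ) (ζ : ZHat) : Prop :=
  ∃ χ : Lp ℂ ∞ (volume : Measure X), IsCompactlySupported χ ∧
    ∀ (U : Set ZHat) (M : ZHat → L2 →L[ℂ] L2), IsContinuation V χ U M → ζ ∈ U →
      ¬ HolomorphicAtZ M ζ

/-- The potential `V(x, θ) = 2 χ_{[-1,1]}(x) cos θ`. -/
def potential (p : X) : ℂ :=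
  ((2 * (Set.Icc (-1 : ℝ) 1).indicator 1 p.1 * Real.cos_periodic.lift p.2 : ℝ) : ℂ)

end CylinderResonance

end

open MeasureTheory Filter Topology
open scoped ENNReal ContDiff

noncomputable section

namespace CylinderResonance

/-! Separation of variables writes the free resolvent as a sum over angular modes `e^{ijθ}` of
convolutions with the outgoing kernel `(i/2τ_j) e^{iτ_j|x|}`. Near the threshold, in the coordinate
`z = τ_l`, only the modes `±l` are singular. After cutting off in `x` the free resolvent is
`(i/2z)(w_l ⊗ w_l + w_{-l} ⊗ w_{-l}) + R₁(z)`, where `w_j` is the cut-off normalized exponential and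
`R₁` is holomorphic for `|z| < 10` (`cutoffL_freeResolvent`, `differentiableOn_regRes`).

The regular part can be inverted. Outside the modes `±l` the norm of `R₁` is `O(l^{-1/2})`, because
`|τ_j|² ≥ l/2` there. Inside these modes `R₁` is merely bounded, but `V` moves every mode by `±1`
and so never connects two of the modes `±l`. Hence the square of `R₁V` is small, and `1 + R₁V` has a
uniformly bounded inverse (`exists_isUnit_one_add_regRes`).

Solving `u = R₀(h - Vu)` for the regular part first leaves a 2×2 system whose matrix is the
effective Hamiltonian `z + (i/2) A V (1 + R₁V)⁻¹ S`, with `S` and `A` the synthesis and analysis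
maps of `w_{±l}`. Where this matrix is invertible, `contOp` continues the cut-off resolvent
holomorphically (`cutoff_eq_contOp`). Expanding `(1 + R₁V)⁻¹ = 1 - X + X(1 + R₁V)⁻¹X` with `X =
R₁V`, the first term contributes nothing. The second contributes a multiple of the identity, minus
`i/2` times the self-energies at `τ_{l+1}` and `τ_{l-1}`. The remainder is `O(l^{-2})`: `R₁` applied
to a constant profile in a mode `±l±1` gains `1/|τ|² = O(1/l)`, and this gain is available at both
ends (`norm_effective_sub_le`).

Since `τ_{l-1}² ≈ 2l` and `τ_{l+1}² ≈ -2l`, the `τ^{-2}` terms of the two self-energies cancel up to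
`O(l^{-2})`. The `τ^{-3}` terms give the stated position, with `e^{2i√(2l)}` coming from the
propagating mode `l-1`; the exponential of the evanescent mode `l+1` is negligible
(`norm_selfEnergy_add_sub_le`). So the matrix is invertible outside a disc of radius `C/l²` about
this position. The annulus around that disc is connected and reaches the physical space, so the
continuation to it is holomorphic and all poles in `B_l(1)` lie in the disc. -/

/-! ### Multiplication operators, translations and convolutions on `L²(X)` -/

/-- The operator of multiplication by a bounded function. -/
def mulOp : Lp ℂ ∞ (volume : Measure X) →L[ℂ] L2 →L[ℂ] L2 :=
  (ContinuousLinearMap.mul ℂ ℂ).holderL volume ∞ 2 2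

lemma coeFn_mulOp (χ : Lp ℂ ∞ (volume : Measure X)) (f : L2) :
    mulOp χ f =ᵐ[volume] fun p => χ p * f p :=
  (ContinuousLinearMap.mul ℂ ℂ).coeFn_holder χ f

lemma mulOp_eq_smul (χ : Lp ℂ ∞ (volume : Measure X)) (f : L2) : mulOp χ f = (χ • f : L2) := by
  apply Lp.ext
  filter_upwards [coeFn_mulOp χ f, Lp.coeFn_lpSMul (r := 2) χ f] with p h1 h2
  rw [h1, h2]; rfl

lemma norm_mulOp_le (χ : Lp ℂ ∞ (volume : Measure X)) : ‖mulOp χ‖ ≤ ‖χ‖ := by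
  refine (mulOp.le_opNorm χ).trans ?_
  have : ‖mulOp‖ ≤ 1 :=
    ((ContinuousLinearMap.mul ℂ ℂ).norm_holderL_le).trans (ContinuousLinearMap.opNorm_mul_le ℂ ℂ)
  nlinarith [norm_nonneg χ]

instance : (volume : Measure X).IsAddHaarMeasure :=
  inferInstanceAs (((volume : Measure ℝ).prod
    (volume : Measure (AddCircle (2 * Real.pi)))).IsAddHaarMeasure)

lemma integral_norm_mul_norm_le (f h : L2) : ∫ p, ‖f p‖ * ‖h p‖ ≤ ‖f‖ * ‖h‖ := by
  have h1 := (ContinuousLinearMap.mul ℂ ℂ).norm_holder_apply_apply_le (r := 1) f h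
  rw [L1.norm_eq_integral_norm] at h1
  have h2 : ∫ p, ‖f p‖ * ‖h p‖ = ∫ p, ‖(ContinuousLinearMap.mul ℂ ℂ).holder 1 f h p‖ := by
    refine integral_congr_ae ?_
    filter_upwards [(ContinuousLinearMap.mul ℂ ℂ).coeFn_holder (r := 1) f h] with p hp
    rw [hp, ContinuousLinearMap.mul_apply', norm_mul]
  rw [h2]
  refine h1.trans ?_
  have := ContinuousLinearMap.opNorm_mul_le ℂ ℂ
  rw [mul_assoc]
  exact mul_le_of_le_one_left (by positivity) this

/-- Translation by `q`, `f ↦ f(· - q)`. -/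
def trans (q : X) : L2 →ₗᵢ[ℂ] L2 :=
  Lp.compMeasurePreservingₗᵢ ℂ (fun p => p - q) (measurePreserving_sub_right volume q)

lemma coeFn_trans (q : X) (f : L2) : trans q f =ᵐ[volume] fun p => f (p - q) :=
  Lp.coeFn_compMeasurePreserving f (measurePreserving_sub_right volume q)

lemma continuous_trans (f : L2) : Continuous fun q => trans q f := by
  let g : C(X, C(X, X)) := ContinuousMap.curry ⟨fun a : X × X => a.2 - a.1, by fun_prop⟩
  exact (continuous_const (y := f)).compMeasurePreservingLp g.continuous
    (fun q => measurePreserving_sub_right volume q) (by simp)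

lemma ae_sub_right {P : X → Prop} (h : ∀ᵐ p : X, P p) (q : X) : ∀ᵐ p : X, P (p - q) :=
  (measurePreserving_sub_right volume q).quasiMeasurePreserving.ae h

lemma trans_trans (q r : X) (f : L2) : trans q (trans r f) = trans (q + r) f := by
  apply Lp.ext
  filter_upwards [coeFn_trans q (trans r f), coeFn_trans (q + r) f,
    ae_sub_right (coeFn_trans r f) q] with p h1 h2 h3
  rw [h1, h2, h3, sub_sub]

lemma trans_zero (f : L2) : trans 0 f = f := by
  apply Lp.ext
  filter_upwards [coeFn_trans 0 f] with p h1
  rw [h1, sub_zero]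

lemma inner_trans_right (q : X) (f h : L2) :
    inner ℂ h (trans q f) = inner ℂ (trans (-q) h) f := by
  rw [← (trans (-q)).inner_map_map h (trans q f), trans_trans, neg_add_cancel, trans_zero]

lemma integrable_smul_trans (K : Lp ℂ 1 (volume : Measure X)) (f : L2) :
    Integrable fun q => K q • trans q f :=
  (L1.integrable_coeFn K).smul_of_top_left
    (memLp_top_of_bound (continuous_trans f).aestronglyMeasurable ‖f‖ (by simp))

/-- Convolution with an integrable kernel. -/
def conv : Lp ℂ 1 (volume : Measure X) →L[ℂ] L2 →L[ℂ] L2 :=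
  LinearMap.mkContinuous₂
    (LinearMap.mk₂ ℂ (fun K f => ∫ q, K q • trans q f)
      (fun K K' f => by
        rw [← integral_add (integrable_smul_trans K f) (integrable_smul_trans K' f)]
        refine integral_congr_ae ?_
        filter_upwards [Lp.coeFn_add K K'] with q hq
        rw [hq, Pi.add_apply, add_smul])
      (fun c K f => by
        rw [← integral_smul]
        refine integral_congr_ae ?_
        filter_upwards [Lp.coeFn_smul c K] with q hq
        rw [hq, Pi.smul_apply, smul_assoc])
      (fun K f f' => by
        rw [← integral_add (integrable_smul_trans K f) (integrable_smul_trans K f')]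
        simp)
      (fun c K f => by
        rw [← integral_smul]
        simp [smul_comm c])) 1 (fun K f => by
    rw [LinearMap.mk₂_apply, one_mul]
    refine (norm_integral_le_integral_norm _).trans ?_
    simp only [norm_smul, LinearIsometry.norm_map]
    rw [integral_mul_const, L1.norm_eq_integral_norm])

lemma conv_apply (K : Lp ℂ 1 (volume : Measure X)) (f : L2) :
    conv K f = ∫ q, K q • trans q f := rfl

lemma norm_conv_le (K : Lp ℂ 1 (volume : Measure X)) : ‖conv K‖ ≤ ‖K‖ := by
  refine ContinuousLinearMap.opNorm_le_bound _ (norm_nonneg _) fun f => ?_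
  rw [conv_apply, L1.norm_eq_integral_norm, ← integral_mul_const]
  refine (norm_integral_le_integral_norm _).trans (le_of_eq ?_)
  simp [norm_smul]

lemma inner_conv (K : Lp ℂ 1 (volume : Measure X)) (f h : L2) :
    inner ℂ h (conv K f) = ∫ q, K q * inner ℂ h (trans q f) := by
  rw [conv_apply, ← integral_inner (integrable_smul_trans K f)]
  simp [inner_smul_right]

/-- Fubini for the matrix elements of a weighted average of translations. -/
lemma integral_mul_inner_trans {ν : Measure X} [SFinite ν] {K : X → ℂ} (hK : Integrable K ν)
    {f : X → ℂ} (hf : MemLp f 2) (h : L2) :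
    ∫ q, K q * inner ℂ h (trans q hf.toLp) ∂ν =
      ∫ p, (starRingEnd ℂ) (h p) * ∫ q, K q * f (p - q) ∂ν := by
  have htr : ∀ q : X, trans q hf.toLp =ᵐ[volume] fun p => f (p - q) := by
    intro q
    filter_upwards [coeFn_trans q hf.toLp, ae_sub_right hf.coeFn_toLp q] with p h1 h2
    rw [h1, h2]
  have hh : ∀ q : X, inner ℂ h (trans q hf.toLp) = ∫ p, f (p - q) * (starRingEnd ℂ) (h p) := by
    intro q
    rw [L2.inner_def]
    refine integral_congr_ae ?_
    filter_upwards [htr q] with p hp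
    rw [hp]; rfl
  have hint : ∀ q : X, Integrable fun p => f (p - q) * (starRingEnd ℂ) (h p) := by
    intro q
    refine (L2.integrable_inner (𝕜 := ℂ) h (trans q hf.toLp)).congr ?_
    filter_upwards [htr q] with p hp
    rw [hp]; rfl
  have hmeas : AEStronglyMeasurable (fun x : X × X => K x.1 * (f (x.2 - x.1) *
      (starRingEnd ℂ) (h x.2))) (ν.prod volume) := by
    refine AEStronglyMeasurable.mul ?_ (AEStronglyMeasurable.mul ?_ ?_)
    · exact hK.aestronglyMeasurable.comp_fst
    · have hq : Measure.QuasiMeasurePreserving (fun x : X × X => x.2 - x.1)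
          (ν.prod volume) volume :=
        Measure.quasiMeasurePreserving_snd.comp
          (measurePreserving_prod_sub ν volume).quasiMeasurePreserving
      exact hf.aestronglyMeasurable.comp_quasiMeasurePreserving hq
    · exact (RCLike.continuous_conj (K := ℂ)).comp_aestronglyMeasurable
        (Lp.aestronglyMeasurable h).comp_snd
  have hI : Integrable (fun x : X × X => K x.1 * (f (x.2 - x.1) *
      (starRingEnd ℂ) (h x.2))) (ν.prod volume) := by
    rw [integrable_prod_iff hmeas]
    refine ⟨ae_of_all _ fun q => (hint q).const_mul (K q), ?_⟩
    refine (hK.norm.mul_const (‖hf.toLp‖ * ‖h‖)).mono'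
      hmeas.norm.integral_prod_right' (ae_of_all _ fun q => ?_)
    rw [Real.norm_of_nonneg (by positivity)]
    simp only [norm_mul, integral_const_mul]
    refine mul_le_mul_of_nonneg_left ?_ (norm_nonneg _)
    refine le_trans (le_of_eq ?_) ((integral_norm_mul_norm_le (trans q hf.toLp) h).trans_eq
      (by rw [LinearIsometry.norm_map]))
    refine integral_congr_ae ?_
    filter_upwards [htr q] with p hp
    rw [hp, RCLike.norm_conj]
  calc _ = ∫ q, ∫ p, K q * (f (p - q) * (starRingEnd ℂ) (h p)) ∂volume ∂ν := by
        simp_rw [hh, integral_const_mul]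
    _ = ∫ p, ∫ q, K q * (f (p - q) * (starRingEnd ℂ) (h p)) ∂ν := integral_integral_swap hI
    _ = _ := by
        refine integral_congr_ae (ae_of_all _ fun p => ?_)
        simp only
        rw [← integral_const_mul]
        refine integral_congr_ae (ae_of_all _ fun q => ?_)
        simp only
        ring

/-- The complex conjugate of a square integrable function, so that `⟪conjLp hg, u⟫ = ∫ u g`. -/
def conjLp {g : X → ℂ} (hg : MemLp g 2) : L2 := hg.star.toLp

lemma inner_conjLp {g : X → ℂ} (hg : MemLp g 2) (u : L2) :
    inner ℂ (conjLp hg) u = ∫ p, u p * g p := by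
  rw [L2.inner_def]
  refine integral_congr_ae ?_
  filter_upwards [hg.star.coeFn_toLp] with p hp
  rw [conjLp, hp, RCLike.inner_apply]
  simp

/-- Conjugation and the reflection `q ↦ -q` move the translations from the function onto the test
function. The measure `ν` stays general because two cases occur: the volume, for convolutions, and
the measure carried by the circle `{0} × 𝕊¹`, for averages over rotations. -/
lemma integral_mul_inner_conjLp_trans {ν : Measure X} [SFinite ν] {K : X → ℂ}
    (hK : Integrable K ν) {g : X → ℂ} (hg : MemLp g 2) (u : L2) :
    ∫ q, K q * inner ℂ (conjLp hg) (trans q u) ∂ν = ∫ p, u p * ∫ q, K q * g (p + q) ∂ν := by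
  have hneg : MeasurableEmbedding (fun q : X => -q) := (MeasurableEquiv.neg X).measurableEmbedding
  have hK' : Integrable (fun q => (starRingEnd ℂ) (K (-q))) (ν.map fun q => -q) := by
    rw [hneg.integrable_map_iff]
    simpa [Function.comp_def] using (RCLike.conjCLE (K := ℂ)).integrable_comp_iff.2 hK
  have h := congrArg (starRingEnd ℂ) (integral_mul_inner_trans hK' hg.star u)
  rw [← integral_conj, ← integral_conj, hneg.integral_map] at h
  simp only [map_mul, RCLike.conj_conj, neg_neg, hneg.integral_map, ← integral_conj,
    inner_conj_symm, sub_neg_eq_add, Pi.star_apply] at h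
  calc _ = ∫ q, K q * inner ℂ (trans (-q) hg.star.toLp) u ∂ν := by
        simp_rw [inner_trans_right]; rfl
    _ = _ := h
    _ = _ := by simp

/-! ### Angular modes -/

/-- The functions `g(x) e^{ijθ}` in `L²(X)`. -/
def mode (j : ℤ) : Submodule ℂ L2 where
  carrier := {f | ∀ s : AddCircle (2 * Real.pi), trans (0, s) f = fourier (-j) s • f}
  add_mem' hf hg s := by rw [map_add, hf s, hg s, smul_add]
  zero_mem' s := by simp
  smul_mem' c f hf s := by rw [map_smul, hf s, smul_comm]

/-- Rotation by `π/(j-k)` is unitary and multiplies the inner product by `e^{iπ} = -1`. -/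
lemma inner_eq_zero_of_mem_mode {j k : ℤ} (hjk : j ≠ k) {f g : L2} (hf : f ∈ mode j)
    (hg : g ∈ mode k) : inner ℂ f g = 0 := by
  have hn : j - k ≠ 0 := sub_ne_zero.2 hjk
  have h1 := fourier_add_half_inv_index hn Real.two_pi_pos (0 : AddCircle (2 * Real.pi))
  rw [zero_add, fourier_eval_zero] at h1
  set s : AddCircle (2 * Real.pi) := ((2 * Real.pi / 2 / ((j - k : ℤ) : ℝ) : ℝ) :
    AddCircle (2 * Real.pi))
  have h2 := (trans (0, s)).inner_map_map f g
  rw [hf s, hg s, inner_smul_left, inner_smul_right, ← mul_assoc, ← fourier_neg, neg_neg,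
    ← fourier_add, ← sub_eq_add_neg, h1] at h2
  linear_combination (-1 / 2 : ℂ) * h2

/-- Operators that act within the mode `j` and vanish on its orthogonal complement. -/
structure IsModeOp (j : ℤ) (B : L2 →L[ℂ] L2) : Prop where
  mem : ∀ f, B f ∈ mode j
  adjoint_mem : ∀ f, ContinuousLinearMap.adjoint B f ∈ mode j

lemma IsModeOp.apply_eq_zero {j k : ℤ} {B : L2 →L[ℂ] L2} (hB : IsModeOp j B) {f : L2}
    (hf : f ∈ mode k) (hjk : j ≠ k) : B f = 0 := by
  rw [← inner_self_eq_zero (𝕜 := ℂ), ← ContinuousLinearMap.adjoint_inner_left]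
  exact inner_eq_zero_of_mem_mode hjk (hB.adjoint_mem _) hf

lemma IsModeOp.smul {j : ℤ} {B : L2 →L[ℂ] L2} (hB : IsModeOp j B) (c : ℂ) :
    IsModeOp j (c • B) where
  mem f := (mode j).smul_mem c (hB.mem f)
  adjoint_mem f := by
    rw [map_smulₛₗ]
    exact (mode j).smul_mem _ (hB.adjoint_mem f)

lemma norm_sq_sum_of_mem_mode (F : Finset ℤ) (v : ℤ → L2) (hv : ∀ j, v j ∈ mode j) :
    ‖∑ j ∈ F, v j‖ ^ 2 = ∑ j ∈ F, ‖v j‖ ^ 2 := by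
  have h : (((‖∑ j ∈ F, v j‖ ^ 2 : ℝ)) : ℂ) = ((∑ j ∈ F, ‖v j‖ ^ 2 : ℝ) : ℂ) := by
    push_cast
    have hn : ∀ w : L2, (‖w‖ : ℂ) ^ 2 = inner ℂ w w := fun w =>
      (inner_self_eq_norm_sq_to_K (𝕜 := ℂ) w).symm
    simp only [hn]
    rw [sum_inner]
    refine Finset.sum_congr rfl fun j hj => ?_
    rw [inner_sum, Finset.sum_eq_single j]
    · intro k _ hk
      exact inner_eq_zero_of_mem_mode hk.symm (hv j) (hv k)
    · exact fun h => (h hj).elim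
  exact_mod_cast h

/-- A block-diagonal operator has the supremum of the norms of its blocks as norm. No projections
onto the modes are needed: with `S = ‖∑ B_j f‖`, orthogonality gives `S² = ⟪∑ B_j* B_j f, f⟫ ≤ ‖∑
B_j* B_j f‖ ‖f‖ ≤ c S ‖f‖`. -/
lemma norm_sum_modeOp_le {B : ℤ → L2 →L[ℂ] L2} (hB : ∀ j, IsModeOp j (B j)) {c : ℝ}
    (hc : 0 ≤ c) (hBc : ∀ j, ‖B j‖ ≤ c) (F : Finset ℤ) : ‖∑ j ∈ F, B j‖ ≤ c := by
  refine ContinuousLinearMap.opNorm_le_bound _ hc fun f => ?_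
  rw [sum_apply]
  set S := ‖∑ j ∈ F, B j f‖ with hS
  have h1 : S ^ 2 = ∑ j ∈ F, ‖B j f‖ ^ 2 :=
    norm_sq_sum_of_mem_mode F (fun j => B j f) fun j => (hB j).mem f
  set g : ℤ → L2 := fun j => ContinuousLinearMap.adjoint (B j) (B j f)
  have h2 : ‖∑ j ∈ F, g j‖ ^ 2 ≤ (c * S) ^ 2 := by
    rw [norm_sq_sum_of_mem_mode F g fun j => (hB j).adjoint_mem _, mul_pow, h1, Finset.mul_sum]
    refine Finset.sum_le_sum fun j _ => ?_
    rw [← mul_pow]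
    refine pow_le_pow_left₀ (norm_nonneg _) ((ContinuousLinearMap.le_opNorm _ _).trans ?_) 2
    rw [LinearIsometryEquiv.norm_map]
    exact mul_le_mul_of_nonneg_right (hBc j) (norm_nonneg _)
  have h3 : ‖∑ j ∈ F, g j‖ ≤ c * S := (sq_le_sq₀ (norm_nonneg _) (by positivity)).1 h2
  have h4 : S ^ 2 ≤ c * S * ‖f‖ := by
    have : ((S ^ 2 : ℝ) : ℂ) = inner ℂ (∑ j ∈ F, g j) f := by
      rw [h1, sum_inner]
      push_cast
      refine Finset.sum_congr rfl fun j _ => ?_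
      rw [ContinuousLinearMap.adjoint_inner_left, inner_self_eq_norm_sq_to_K]
      rfl
    calc S ^ 2 = ‖((S ^ 2 : ℝ) : ℂ)‖ := by rw [Complex.norm_real, Real.norm_of_nonneg (by positivity)]
      _ ≤ ‖∑ j ∈ F, g j‖ * ‖f‖ := by rw [this]; exact norm_inner_le_norm _ _
      _ ≤ _ := mul_le_mul_of_nonneg_right h3 (norm_nonneg _)
  rcases (norm_nonneg _ : 0 ≤ S).eq_or_lt with h0 | h0
  · rw [hS, ← h0]; positivity
  · nlinarith

lemma norm_tsum_modeOp_le {B : ℤ → L2 →L[ℂ] L2} (hB : ∀ j, IsModeOp j (B j)) {c : ℝ}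
    (hc : 0 ≤ c) (hBc : ∀ j, ‖B j‖ ≤ c) (hs : Summable B) : ‖∑' j, B j‖ ≤ c :=
  le_of_tendsto hs.hasSum.norm (Eventually.of_forall fun F => norm_sum_modeOp_le hB hc hBc F)

lemma tsum_modeOp_apply {B : ℤ → L2 →L[ℂ] L2} (hB : ∀ j, IsModeOp j (B j)) (hs : Summable B)
    {k : ℤ} {f : L2} (hf : f ∈ mode k) : (∑' j, B j) f = B k f := by
  have h := (ContinuousLinearMap.apply ℂ L2 f).map_tsum hs
  simp only [ContinuousLinearMap.apply_apply] at h
  rw [h, tsum_eq_single k fun j hj => (hB j).apply_eq_zero hf hj]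

lemma inner_tsum_modeOp {B : ℤ → L2 →L[ℂ] L2} (hB : ∀ j, IsModeOp j (B j)) (hs : Summable B)
    {k : ℤ} {h : L2} (hh : h ∈ mode k) (f : L2) :
    inner ℂ h ((∑' j, B j) f) = inner ℂ h (B k f) := by
  have h1 := ((innerSL ℂ h).comp (ContinuousLinearMap.apply ℂ L2 f)).map_tsum hs
  simp only [ContinuousLinearMap.comp_apply, ContinuousLinearMap.apply_apply, innerSL_apply_apply]
    at h1
  rw [h1, tsum_eq_single k fun j hj => inner_eq_zero_of_mem_mode hj.symm hh ((hB j).mem f)]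

/-! ### Convolutions within a mode -/

/-- The function `e^{ijs} / 2π`. -/
def circleKernel (j : ℤ) (s : AddCircle (2 * Real.pi)) : ℂ := fourier j s / (2 * Real.pi)

lemma continuous_circleKernel (j : ℤ) : Continuous (circleKernel j) :=
  (map_continuous (fourier j)).div_const _

lemma norm_circleKernel (j : ℤ) (s : AddCircle (2 * Real.pi)) :
    ‖circleKernel j s‖ = (2 * Real.pi)⁻¹ := by
  rw [circleKernel, norm_div, fourier_apply, Circle.norm_coe, one_div, norm_mul, Complex.norm_real,
    Real.norm_of_nonneg Real.pi_pos.le]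
  simp

lemma integrable_circleKernel (j : ℤ) : Integrable (circleKernel j) :=
  (continuous_circleKernel j).integrable_of_hasCompactSupport (HasCompactSupport.of_compactSpace _)

lemma integral_norm_circleKernel (j : ℤ) : ∫ s, ‖circleKernel j s‖ = 1 := by
  simp only [norm_circleKernel, integral_const, smul_eq_mul, measureReal_def]
  rw [AddCircle.measure_univ, ENNReal.toReal_ofReal Real.two_pi_pos.le,
    mul_inv_cancel₀ Real.two_pi_pos.ne']

lemma circleKernel_sub (j : ℤ) (s r : AddCircle (2 * Real.pi)) :
    circleKernel j (s - r) = fourier (-j) r * circleKernel j s := by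
  rw [circleKernel, circleKernel, fourier_apply, fourier_apply, fourier_apply, zsmul_sub, neg_smul,
    sub_eq_add_neg, AddCircle.toCircle_add]
  push_cast
  ring

lemma conj_circleKernel_neg (j : ℤ) (s : AddCircle (2 * Real.pi)) :
    (starRingEnd ℂ) (circleKernel j (-s)) = circleKernel j s := by
  have h : (starRingEnd ℂ) (fourier j (-s)) = fourier j s := by
    rw [← fourier_neg, fourier_apply, fourier_apply, neg_smul, smul_neg, neg_neg]
  rw [circleKernel, circleKernel, map_div₀, h, map_mul, Complex.conj_ofReal, Complex.conj_ofNat]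

lemma norm_toL1_eq_integral {α : Type*} [MeasurableSpace α] {μ : Measure α} {f : α → ℂ}
    (hf : Integrable f μ) : ‖hf.toL1‖ = ∫ a, ‖f a‖ ∂μ := by
  rw [L1.norm_eq_integral_norm]
  refine integral_congr_ae ?_
  filter_upwards [hf.coeFn_toL1] with a ha
  rw [ha]

lemma norm_toL1_mul_circleKernel {k : ℝ → ℂ} (j : ℤ)
    (h : Integrable fun q : X => k q.1 * circleKernel j q.2) : ‖h.toL1‖ = ∫ t, ‖k t‖ := by
  rw [norm_toL1_eq_integral]
  simp only [norm_mul]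
  rw [Measure.volume_eq_prod, integral_prod_mul (fun t => ‖k t‖) fun s => ‖circleKernel j s‖,
    integral_norm_circleKernel, mul_one]

lemma integrable_mul_circleKernel {k : ℝ → ℂ} (hk : Integrable k) (j : ℤ) :
    Integrable fun q : X => k q.1 * circleKernel j q.2 :=
  hk.mul_prod (integrable_circleKernel j)

lemma ae_comp_fst {P : ℝ → Prop} (h : ∀ᵐ t, P t) : ∀ᵐ q : X, P q.1 :=
  Measure.quasiMeasurePreserving_fst.ae h

/-- Convolution with `k(x) e^{ijθ} / 2π`. -/
def modeConv (j : ℤ) : Lp ℂ 1 (volume : Measure ℝ) →L[ℂ] L2 →L[ℂ] L2 :=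
  conv ∘L LinearMap.mkContinuous
    { toFun := fun k => (integrable_mul_circleKernel (L1.integrable_coeFn k) j).toL1
      map_add' := fun k k' => by
        rw [← Integrable.toL1_add]
        refine (Integrable.toL1_eq_toL1_iff _ _ _ _).2 ?_
        filter_upwards [ae_comp_fst (Lp.coeFn_add k k')] with q hq
        simp only [hq, Pi.add_apply, add_mul]
      map_smul' := fun c k => by
        rw [RingHom.id_apply, ← Integrable.toL1_smul']
        refine (Integrable.toL1_eq_toL1_iff _ _ _ _).2 ?_
        filter_upwards [ae_comp_fst (Lp.coeFn_smul c k)] with q hq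
        simp only [hq, Pi.smul_apply, smul_eq_mul, mul_assoc] } 1 (fun k => by
      rw [one_mul]
      refine le_of_eq ?_
      simp only [LinearMap.coe_mk, AddHom.coe_mk]
      rw [norm_toL1_mul_circleKernel, L1.norm_eq_integral_norm])

lemma modeConv_toL1 (j : ℤ) {k : ℝ → ℂ} (hk : Integrable k) :
    modeConv j hk.toL1 = conv (integrable_mul_circleKernel hk j).toL1 := by
  change conv _ = conv _
  congr 1
  refine (Integrable.toL1_eq_toL1_iff _ _
    (integrable_mul_circleKernel (L1.integrable_coeFn _) j) _).2 ?_
  filter_upwards [ae_comp_fst hk.coeFn_toL1] with q hq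
  rw [hq]

lemma norm_modeConv_le (j : ℤ) {k : ℝ → ℂ} (hk : Integrable k) :
    ‖modeConv j hk.toL1‖ ≤ ∫ t, ‖k t‖ := by
  rw [modeConv_toL1]
  exact (norm_conv_le _).trans_eq (norm_toL1_mul_circleKernel j _)

lemma inner_modeConv (j : ℤ) {k : ℝ → ℂ} (hk : Integrable k) (f h : L2) :
    inner ℂ h (modeConv j hk.toL1 f) =
      ∫ q : X, k q.1 * circleKernel j q.2 * inner ℂ h (trans q f) := by
  rw [modeConv_toL1, inner_conv]
  refine integral_congr_ae ?_
  filter_upwards [(integrable_mul_circleKernel hk j).coeFn_toL1] with q hq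
  rw [hq]

lemma inner_modeConv_toLp (j : ℤ) {k : ℝ → ℂ} (hk : Integrable k) {f : X → ℂ} (hf : MemLp f 2)
    (h : L2) : inner ℂ h (modeConv j hk.toL1 hf.toLp) =
      ∫ p : X, (starRingEnd ℂ) (h p) * ∫ q : X, k q.1 * circleKernel j q.2 * f (p - q) := by
  rw [inner_modeConv, integral_mul_inner_trans (integrable_mul_circleKernel hk j)]

lemma inner_conjLp_modeConv (j : ℤ) {k : ℝ → ℂ} (hk : Integrable k) {g : X → ℂ}
    (hg : MemLp g 2) (u : L2) : inner ℂ (conjLp hg) (modeConv j hk.toL1 u) =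
      ∫ p : X, u p * ∫ q : X, k q.1 * circleKernel j q.2 * g (p + q) := by
  rw [inner_modeConv, integral_mul_inner_conjLp_trans (integrable_mul_circleKernel hk j)]

/-- The angular factor of the kernel is a character, so a rotation of the output is absorbed by
translating the integration variable. -/
lemma modeConv_mem_mode (j : ℤ) {k : ℝ → ℂ} (hk : Integrable k) (f : L2) :
    modeConv j hk.toL1 f ∈ mode j := by
  intro s
  refine ext_inner_left ℂ fun h => ?_
  rw [inner_trans_right, inner_modeConv, inner_smul_right, inner_modeConv,
    ← integral_const_mul]
  rw [← integral_sub_right_eq_self _ ((0, s) : X)]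
  refine integral_congr_ae (ae_of_all _ fun q => ?_)
  simp only [Prod.fst_sub, Prod.snd_sub, sub_zero, circleKernel_sub]
  rw [← inner_trans_right, trans_trans, add_sub_cancel]
  ring

lemma adjoint_modeConv (j : ℤ) {k : ℝ → ℂ} (hk : Integrable k)
    (hk' : Integrable fun t => (starRingEnd ℂ) (k (-t))) :
    ContinuousLinearMap.adjoint (modeConv j hk.toL1) = modeConv j hk'.toL1 := by
  ext1 f
  refine ext_inner_right ℂ fun h => ?_
  rw [ContinuousLinearMap.adjoint_inner_left, ← inner_conj_symm (modeConv j hk'.toL1 f) h,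
    inner_modeConv, inner_modeConv, ← integral_conj, ← integral_neg_eq_self]
  refine integral_congr_ae (ae_of_all _ fun q => ?_)
  simp only [Prod.fst_neg, Prod.snd_neg, map_mul, inner_conj_symm, RCLike.conj_conj]
  rw [← conj_circleKernel_neg j q.2, inner_trans_right, neg_neg]
  simp

lemma integrable_conj_neg {k : ℝ → ℂ} (hk : Integrable k) :
    Integrable fun t => (starRingEnd ℂ) (k (-t)) :=
  (RCLike.conjCLE (K := ℂ)).integrable_comp_iff.2 hk.comp_neg

lemma isModeOp_modeConv (j : ℤ) (k : Lp ℂ 1 (volume : Measure ℝ)) : IsModeOp j (modeConv j k) := by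
  have hk : Integrable k := L1.integrable_coeFn k
  rw [← Integrable.toL1_coeFn k hk]
  refine ⟨modeConv_mem_mode j hk, fun f => ?_⟩
  rw [adjoint_modeConv j hk (integrable_conj_neg hk)]
  exact modeConv_mem_mode j _ f

/-! ### The outgoing kernel on the line -/

/-- The outgoing fundamental solution of `-d²/dt² - τ²`. -/
def outKernel (τ : ℂ) (t : ℝ) : ℂ := Complex.I / (2 * τ) * Complex.exp (Complex.I * τ * |t|)

lemma continuous_outKernel (τ : ℂ) : Continuous (outKernel τ) := by
  unfold outKernel; fun_prop

lemma norm_outKernel (τ : ℂ) (t : ℝ) :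
    ‖outKernel τ t‖ = 1 / (2 * ‖τ‖) * Real.exp (-τ.im * |t|) := by
  rw [outKernel, norm_mul, norm_div, Complex.norm_I, norm_mul, Complex.norm_ofNat,
    Complex.norm_exp]
  congr 2
  simp

lemma integral_exp_neg_mul_abs {b : ℝ} (hb : 0 < b) : ∫ t : ℝ, Real.exp (-b * |t|) = 2 / b := by
  rw [integral_comp_abs (f := fun t => Real.exp (-b * t)), integral_exp_mul_Ioi (by linarith)]
  simp
  ring

lemma integrable_exp_neg_mul_abs {b : ℝ} (hb : 0 < b) :
    Integrable fun t : ℝ => Real.exp (-b * |t|) := by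
  -- The integral of a non-integrable function is `0` by convention, whereas this one equals `2/b`.
  by_contra h
  have := integral_exp_neg_mul_abs hb
  rw [integral_undef h] at this
  exact absurd this (by positivity)

lemma integrable_outKernel {τ : ℂ} (hτ : 0 < τ.im) : Integrable (outKernel τ) := by
  refine ((integrable_exp_neg_mul_abs hτ).const_mul (1 / (2 * ‖τ‖))).mono'
    (continuous_outKernel τ).aestronglyMeasurable (ae_of_all _ fun t => ?_)
  rw [norm_outKernel]

lemma integral_norm_outKernel {τ : ℂ} (hτ : 0 < τ.im) :
    ∫ t, ‖outKernel τ t‖ = 1 / (‖τ‖ * τ.im) := by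
  simp only [norm_outKernel]
  rw [integral_const_mul, integral_exp_neg_mul_abs hτ]
  field_simp

/-- Integration by parts on the two half lines, with boundary terms only at `0`: the derivatives
`g'(0)` cancel and the values `g(0)` add up. Compact support of `g` makes any `τ ≠ 0` admissible,
whatever the sign of `Im τ`. -/
lemma integral_outKernel_mul {τ : ℂ} (hτ : τ ≠ 0) {g : ℝ → ℂ} (hg : ContDiff ℝ ∞ g)
    (hgc : HasCompactSupport g) :
    ∫ t, outKernel τ t * (-iteratedDeriv 2 g t - τ ^ 2 * g t) = g 0 := by
  have hg1 : ∀ t, HasDerivAt g (deriv g t) t := fun t =>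
    (hg.differentiable (by simp) t).hasDerivAt
  have hg' : ContDiff ℝ ∞ (deriv g) := by
    have := (contDiff_infty_iff_deriv.1 hg).2
    exact this
  have hg2 : ∀ t, HasDerivAt (deriv g) (iteratedDeriv 2 g t) t := fun t => by
    rw [iteratedDeriv_succ, iteratedDeriv_one]
    exact (hg'.differentiable (by simp) t).hasDerivAt
  have hexp : ∀ (c : ℂ), ContDiff ℝ 1 fun t : ℝ => Complex.exp (c * t) := fun c =>
    ((contDiff_const (c := c)).mul Complex.ofRealCLM.contDiff).cexp
  have hexp' : ∀ (c : ℂ) (t : ℝ), HasDerivAt (fun t : ℝ => Complex.exp (c * t))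
      (Complex.exp (c * t) * c) t := fun c t => by
    simpa using ((hasDerivAt_id t).ofReal_comp.const_mul c).cexp
  -- `F c` is a primitive of the integrand on the half line where `c = ± iτ` is the exponent
  set F : ℂ → ℝ → ℂ := fun c t => Complex.exp (c * t) * (-deriv g t + c * g t) with hF
  have hFd : ∀ (c : ℂ) (t : ℝ), HasDerivAt (F c)
      (Complex.exp (c * t) * (-iteratedDeriv 2 g t + c ^ 2 * g t)) t := fun c t => by
    refine ((hexp' c t).mul ((hg2 t).neg.add ((hg1 t).const_mul c))).congr_deriv ?_
    simp only [Pi.neg_apply, Pi.add_apply]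
    ring
  have hF1 : ∀ c, ContDiff ℝ 1 (F c) := fun c =>
    (hexp c).mul (((hg'.of_le (by simp)).neg).add (contDiff_const.mul (hg.of_le (by simp))))
  have hFc : ∀ c, HasCompactSupport (F c) := fun c =>
    HasCompactSupport.mul_left (f := fun t : ℝ => Complex.exp (c * t))
      (hgc.deriv.neg.add (hgc.mul_left (f := fun _ => c)))
  have hsq : (Complex.I * τ) ^ 2 = -τ ^ 2 := by rw [mul_pow, Complex.I_sq]; ring
  have hpos : ∫ t in Set.Ioi (0 : ℝ), outKernel τ t * (-iteratedDeriv 2 g t - τ ^ 2 * g t) =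
      Complex.I / (2 * τ) * -F (Complex.I * τ) 0 := by
    rw [← (hFc _).integral_Ioi_deriv_eq (hF1 _) 0, ← integral_const_mul]
    refine setIntegral_congr_fun measurableSet_Ioi fun t ht => ?_
    rw [(hFd _ t).deriv, outKernel, abs_of_pos ht, hsq]
    ring
  have hneg : ∫ t in Set.Iic (0 : ℝ), outKernel τ t * (-iteratedDeriv 2 g t - τ ^ 2 * g t) =
      Complex.I / (2 * τ) * F (-(Complex.I * τ)) 0 := by
    rw [← (hFc _).integral_Iic_deriv_eq (hF1 _) 0, ← integral_const_mul]
    refine setIntegral_congr_fun measurableSet_Iic fun t ht => ?_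
    rw [(hFd _ t).deriv, outKernel, abs_of_nonpos ht, neg_sq, hsq]
    push_cast
    ring_nf
  have hint : Integrable fun t => outKernel τ t * (-iteratedDeriv 2 g t - τ ^ 2 * g t) := by
    refine Continuous.integrable_of_hasCompactSupport ?_ ?_
    · exact (continuous_outKernel τ).mul
        (((contDiff_infty.1 hg 2).continuous_iteratedDeriv 2 le_rfl).neg.sub (continuous_const.mul hg.continuous))
    · refine HasCompactSupport.mul_left ?_
      rw [iteratedDeriv_succ, iteratedDeriv_one]
      exact hgc.deriv.deriv.neg.sub (hgc.mul_left (f := fun _ => τ ^ 2))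
  rw [← intervalIntegral.integral_Iic_add_Ioi (b := 0) hint.integrableOn hint.integrableOn,
    hpos, hneg]
  simp only [hF, Complex.ofReal_zero, mul_zero, Complex.exp_zero, one_mul]
  field_simp
  ring_nf
  rw [Complex.I_sq]
  ring

/-- The integrand has the periodic primitive `e^{ijs}(-g' + ij g)`. -/
lemma integral_fourier_mul {g : AddCircle (2 * Real.pi) → ℂ}
    (hg : ContDiff ℝ ∞ fun s : ℝ => g s) (j : ℤ) {g₂ : AddCircle (2 * Real.pi) → ℂ}
    (hg₂ : ∀ s : ℝ, g₂ s = iteratedDeriv 2 (fun s : ℝ => g s) s) :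
    ∫ s, fourier j s * (-g₂ s - (j : ℂ) ^ 2 * g s) = 0 := by
  set G : ℝ → ℂ := fun s => g s with hG
  have hG1 : ∀ t, HasDerivAt G (deriv G t) t := fun t =>
    (hg.differentiable (by simp) t).hasDerivAt
  have hG' : ContDiff ℝ ∞ (deriv G) := (contDiff_infty_iff_deriv.1 hg).2
  have hG2 : ∀ t, HasDerivAt (deriv G) (iteratedDeriv 2 G t) t := fun t => by
    rw [iteratedDeriv_succ, iteratedDeriv_one]
    exact (hG'.differentiable (by simp) t).hasDerivAt
  have hper : Function.Periodic G (2 * Real.pi) := fun s => by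
    simp [hG]
  have hper' : Function.Periodic (deriv G) (2 * Real.pi) := fun s => by
    rw [← deriv_comp_add_const, hper.funext]
  have hfour : ∀ s : ℝ, fourier j (s : AddCircle (2 * Real.pi)) = Complex.exp (Complex.I * j * s) := by
    intro s
    rw [fourier_coe_apply]
    congr 1
    push_cast
    field_simp
  have hexp' : ∀ (t : ℝ), HasDerivAt (fun t : ℝ => Complex.exp (Complex.I * j * t))
      (Complex.exp (Complex.I * j * t) * (Complex.I * j)) t := fun t => by
    simpa using ((hasDerivAt_id t).ofReal_comp.const_mul (Complex.I * j)).cexp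
  rw [← AddCircle.intervalIntegral_preimage (2 * Real.pi) 0]
  simp only [hfour, hg₂]
  rw [intervalIntegral.integral_eq_sub_of_hasDerivAt
    (f := fun t => Complex.exp (Complex.I * j * t) * (-deriv G t + Complex.I * j * G t))]
  · have h1 := hper 0
    have h2 := hper' 0
    have h3 : Complex.exp (Complex.I * j * ((0 + 2 * Real.pi : ℝ) : ℂ)) =
        Complex.exp (Complex.I * j * ((0 : ℝ) : ℂ)) := by
      rw [← hfour, ← hfour, zero_add, AddCircle.coe_period]
      rfl
    rw [h1, h2, h3, sub_self]
  · intro t _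
    refine ((hexp' t).mul ((hG2 t).neg.add ((hG1 t).const_mul (Complex.I * j)))).congr_deriv ?_
    simp only [Pi.neg_apply, Pi.add_apply]
    ring_nf
    rw [Complex.I_sq]
    ring
  · refine Continuous.intervalIntegrable ?_ _ _
    refine (by fun_prop : Continuous fun t : ℝ => Complex.exp (Complex.I * j * t)).mul ?_
    exact ((contDiff_infty.1 hg 2).continuous_iteratedDeriv 2 le_rfl).neg.sub (continuous_const.mul hg.continuous)

/-! ### Test functions -/

/-- `∂²φ/∂x²`. -/
def derivXX (φ : X → ℂ) (p : X) : ℂ := iteratedDeriv 2 (fun s : ℝ => φ (s, p.2)) p.1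

/-- `∂²φ/∂θ²`. -/
def derivθθ (φ : X → ℂ) (p : X) : ℂ :=
  iteratedDeriv 2 (fun s : ℝ => φ (p.1, p.2 + (s : AddCircle (2 * Real.pi)))) 0

lemma laplacian_eq (φ : X → ℂ) (p : X) : laplacian φ p = derivXX φ p + derivθθ φ p := rfl

lemma contDiff_deriv_fst {Φ : ℝ × ℝ → ℂ} (h : ContDiff ℝ ∞ Φ) :
    ContDiff ℝ ∞ fun z : ℝ × ℝ => deriv (fun s => Φ (s, z.2)) z.1 := by
  have : (fun z : ℝ × ℝ => deriv (fun s => Φ (s, z.2)) z.1) = fun z => fderiv ℝ Φ z (1, 0) := by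
    ext z
    have h1 : HasFDerivAt Φ (fderiv ℝ Φ z) z := (h.differentiable (by simp) z).hasFDerivAt
    have h2 : HasDerivAt (fun s : ℝ => (s, z.2)) (1, 0) z.1 :=
      (hasDerivAt_id _).prodMk (hasDerivAt_const _ _)
    exact (h1.comp_hasDerivAt z.1 h2).deriv
  rw [this]
  exact (h.fderiv_right (m := ∞) (by simp)).clm_apply contDiff_const

lemma contDiff_iteratedDeriv_two_fst {Φ : ℝ × ℝ → ℂ} (h : ContDiff ℝ ∞ Φ) :
    ContDiff ℝ ∞ fun z : ℝ × ℝ => iteratedDeriv 2 (fun s => Φ (s, z.2)) z.1 := by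
  simp only [iteratedDeriv_succ, iteratedDeriv_zero]
  exact contDiff_deriv_fst (contDiff_deriv_fst h)

lemma contDiff_deriv_snd {Φ : ℝ × ℝ → ℂ} (h : ContDiff ℝ ∞ Φ) :
    ContDiff ℝ ∞ fun z : ℝ × ℝ => deriv (fun s => Φ (z.1, s)) z.2 := by
  have : (fun z : ℝ × ℝ => deriv (fun s => Φ (z.1, s)) z.2) = fun z => fderiv ℝ Φ z (0, 1) := by
    ext z
    have h1 : HasFDerivAt Φ (fderiv ℝ Φ z) z := (h.differentiable (by simp) z).hasFDerivAt
    have h2 : HasDerivAt (fun s : ℝ => (z.1, s)) (0, 1) z.2 :=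
      (hasDerivAt_const _ _).prodMk (hasDerivAt_id _)
    exact (h1.comp_hasDerivAt z.2 h2).deriv
  rw [this]
  exact (h.fderiv_right (m := ∞) (by simp)).clm_apply contDiff_const

lemma contDiff_iteratedDeriv_two_snd {Φ : ℝ × ℝ → ℂ} (h : ContDiff ℝ ∞ Φ) :
    ContDiff ℝ ∞ fun z : ℝ × ℝ => iteratedDeriv 2 (fun s => Φ (z.1, s)) z.2 := by
  simp only [iteratedDeriv_succ, iteratedDeriv_zero]
  exact contDiff_deriv_snd (contDiff_deriv_snd h)

lemma isOpenQuotientMap_coe :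
    IsOpenQuotientMap (fun q : ℝ × ℝ => ((q.1, (q.2 : AddCircle (2 * Real.pi))) : X)) :=
  IsOpenQuotientMap.id.prodMap QuotientAddGroup.isOpenQuotientMap_mk

lemma continuous_of_lift {φ : X → ℂ}
    (h : Continuous fun q : ℝ × ℝ => φ (q.1, (q.2 : AddCircle (2 * Real.pi)))) : Continuous φ :=
  isOpenQuotientMap_coe.isQuotientMap.continuous_iff.2 h

lemma derivθθ_coe (φ : X → ℂ) (x y : ℝ) : derivθθ φ (x, (y : AddCircle (2 * Real.pi))) =
    iteratedDeriv 2 (fun s : ℝ => φ (x, (s : AddCircle (2 * Real.pi)))) y := by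
  have := congrFun (iteratedDeriv_comp_const_add 2
    (fun s : ℝ => φ (x, (s : AddCircle (2 * Real.pi)))) y) 0
  rw [add_zero] at this
  rw [← this]
  simp [derivθθ]

namespace IsTestFunction

lemma continuous {φ : X → ℂ} (hφ : IsTestFunction φ) : Continuous φ := continuous_of_lift hφ.smooth.continuous

lemma continuous_derivXX {φ : X → ℂ} (hφ : IsTestFunction φ) : Continuous (derivXX φ) :=
  continuous_of_lift (contDiff_iteratedDeriv_two_fst hφ.smooth).continuous

lemma continuous_derivθθ {φ : X → ℂ} (hφ : IsTestFunction φ) : Continuous (derivθθ φ) := by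
  refine continuous_of_lift ?_
  simp only [derivθθ_coe]
  exact (contDiff_iteratedDeriv_two_snd hφ.smooth).continuous

lemma hasCompactSupport_derivXX {φ : X → ℂ} (hφ : IsTestFunction φ) : HasCompactSupport (derivXX φ) := by
  refine hφ.compactSupport.mono' fun p hp => ?_
  by_contra hn
  refine hp ?_
  have h0 : φ =ᶠ[𝓝 p] 0 := notMem_tsupport_iff_eventuallyEq.1 hn
  have h1 : (fun s : ℝ => φ (s, p.2)) =ᶠ[𝓝 p.1] fun _ => 0 :=
    (by fun_prop : Continuous fun s : ℝ => ((s, p.2) : X)).continuousAt.eventually h0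
  rw [derivXX, h1.iteratedDeriv_eq]
  simp

lemma hasCompactSupport_derivθθ {φ : X → ℂ} (hφ : IsTestFunction φ) : HasCompactSupport (derivθθ φ) := by
  refine hφ.compactSupport.mono' fun p hp => ?_
  by_contra hn
  refine hp ?_
  have h0 : φ =ᶠ[𝓝 p] 0 := notMem_tsupport_iff_eventuallyEq.1 hn
  have hc : Continuous fun s : ℝ => ((p.1, p.2 + (s : AddCircle (2 * Real.pi))) : X) := by
    have := AddCircle.continuous_mk' (2 * Real.pi)
    fun_prop
  have h1 : (fun s : ℝ => φ (p.1, p.2 + (s : AddCircle (2 * Real.pi)))) =ᶠ[𝓝 0] fun _ => 0 := by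
    have h2 := hc.continuousAt (x := 0)
    rw [ContinuousAt, AddCircle.coe_zero, add_zero] at h2
    exact h2.eventually h0
  rw [derivθθ, h1.iteratedDeriv_eq]
  simp

lemma continuous_symbol {φ : X → ℂ} (hφ : IsTestFunction φ)
    (w : ℂ) : Continuous fun p => -laplacian φ p - w * φ p :=
  (hφ.continuous_derivXX.add hφ.continuous_derivθθ).neg.sub (continuous_const.mul hφ.continuous)

lemma memLp {φ : X → ℂ} (hφ : IsTestFunction φ) : MemLp φ 2 := hφ.continuous.memLp_of_hasCompactSupport hφ.compactSupport

lemma memLp_symbol {φ : X → ℂ} (hφ : IsTestFunction φ)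
    (w : ℂ) : MemLp (fun p => -laplacian φ p - w * φ p) 2 := by
  refine (hφ.continuous_symbol w).memLp_of_hasCompactSupport ?_
  exact (hφ.hasCompactSupport_derivXX.add hφ.hasCompactSupport_derivθθ).neg.sub
    (hφ.compactSupport.mul_left (f := fun _ => w))

lemma translate {φ : X → ℂ} (hφ : IsTestFunction φ)
    (q : X) : IsTestFunction fun p => φ (p + q) where
  smooth := by
    obtain ⟨q₁, q₂⟩ := q
    obtain ⟨y, rfl⟩ := QuotientAddGroup.mk_surjective q₂
    exact hφ.smooth.comp (g := fun q : ℝ × ℝ => φ (q.1, (q.2 : AddCircle (2 * Real.pi))))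
      (f := fun z : ℝ × ℝ => z + (q₁, y)) (contDiff_id.add contDiff_const)
  compactSupport := hφ.compactSupport.comp_homeomorph (Homeomorph.addRight q)

lemma laplacian_translate (φ : X → ℂ) (q p : X) : laplacian (fun p => φ (p + q)) p = laplacian φ (p + q) := by
  rw [laplacian, laplacian]
  congr 1
  · exact congrFun (iteratedDeriv_comp_add_const 2 (fun s : ℝ => φ (s, p.2 + q.2)) q.1) p.1
  · congr 1
    ext s
    congr 1
    ext1
    · rfl
    · exact add_right_comm _ _ _

/-- Convolution with the outgoing kernel in the mode `j` inverts `-Δ - w` there. -/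
lemma integral_outKernel_symbol {φ : X → ℂ} (hφ : IsTestFunction φ)
    {w τ : ℂ} {j : ℤ} (hτ : 0 < τ.im)
    (hw : τ ^ 2 = w - (j : ℂ) ^ 2) (p : X) :
    ∫ q : X, outKernel τ q.1 * circleKernel j q.2 * (-laplacian φ (p + q) - w * φ (p + q)) =
      ∫ s, circleKernel j s * φ (p + (0, s)) := by
  have hK := integrable_mul_circleKernel (integrable_outKernel hτ) j
  have hint : ∀ g : X → ℂ, Continuous g → HasCompactSupport g →
      Integrable fun q : X => outKernel τ q.1 * circleKernel j q.2 * g (p + q) := by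
    intro g hg hgc
    obtain ⟨C, hC⟩ := hg.bounded_above_of_compact_support hgc
    refine hK.mul_bdd (c := C) ?_ (ae_of_all _ fun q => hC _)
    exact (hg.comp (continuous_const_add p)).aestronglyMeasurable
  have hφi := hint φ hφ.continuous hφ.compactSupport
  have hXi := hint _ hφ.continuous_derivXX hφ.hasCompactSupport_derivXX
  have hθi := hint _ hφ.continuous_derivθθ hφ.hasCompactSupport_derivθθ
  have hτ0 : τ ≠ 0 := fun h => by simp [h] at hτ
  have hX : ∫ q : X, outKernel τ q.1 * circleKernel j q.2 *
      (-derivXX φ (p + q) - τ ^ 2 * φ (p + q)) = ∫ s, circleKernel j s * φ (p + (0, s)) := by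
    have hi : Integrable fun q : X => outKernel τ q.1 * circleKernel j q.2 *
        (-derivXX φ (p + q) - τ ^ 2 * φ (p + q)) := by
      refine (hXi.neg.sub (hφi.const_mul (τ ^ 2))).congr (ae_of_all _ fun q => ?_)
      simp only [Pi.sub_apply, Pi.neg_apply]
      ring
    rw [Measure.volume_eq_prod, integral_prod_symm _ hi]
    refine integral_congr_ae (ae_of_all _ fun s => ?_)
    simp only
    obtain ⟨x, θ⟩ := p
    obtain ⟨y, hy⟩ := QuotientAddGroup.mk_surjective (θ + s)
    have hg : ContDiff ℝ ∞ fun t : ℝ => φ (x + t, θ + s) := by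
      rw [← hy]
      exact hφ.smooth.comp (g := fun q : ℝ × ℝ => φ (q.1, (q.2 : AddCircle (2 * Real.pi))))
        (f := fun t : ℝ => (x + t, y)) ((contDiff_const.add contDiff_id).prodMk contDiff_const)
    have hgc : HasCompactSupport fun t : ℝ => φ (x + t, θ + s) := by
      refine HasCompactSupport.of_support_subset_isCompact
        ((hφ.compactSupport.image continuous_fst).image (continuous_sub_right x)) fun t ht => ?_
      exact ⟨x + t, ⟨_, subset_tsupport _ ht, rfl⟩, by simp⟩
    have h := integral_outKernel_mul hτ0 hg hgc
    rw [add_zero] at h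
    simp only [Prod.mk_add_mk, add_zero]
    rw [← h, ← integral_const_mul]
    refine integral_congr_ae (ae_of_all _ fun t => ?_)
    have h2 := congrFun (iteratedDeriv_comp_const_add 2 (fun t : ℝ => φ (t, θ + s)) x) t
    simp only [derivXX]
    rw [← h2]
    ring
  have hθ : ∫ q : X, outKernel τ q.1 * circleKernel j q.2 *
      (-derivθθ φ (p + q) - (j : ℂ) ^ 2 * φ (p + q)) = 0 := by
    have hi : Integrable fun q : X => outKernel τ q.1 * circleKernel j q.2 *
        (-derivθθ φ (p + q) - (j : ℂ) ^ 2 * φ (p + q)) := by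
      refine (hθi.neg.sub (hφi.const_mul ((j : ℂ) ^ 2))).congr (ae_of_all _ fun q => ?_)
      simp only [Pi.sub_apply, Pi.neg_apply]
      ring
    rw [Measure.volume_eq_prod, integral_prod _ hi]
    refine integral_eq_zero_of_ae (ae_of_all _ fun t => ?_)
    simp only [Pi.zero_apply]
    obtain ⟨x, θ⟩ := p
    obtain ⟨y, rfl⟩ := QuotientAddGroup.mk_surjective θ
    have hg : ContDiff ℝ ∞ fun s : ℝ => φ (x + t, (y : AddCircle (2 * Real.pi)) + s) :=
      hφ.smooth.comp (g := fun q : ℝ × ℝ => φ (q.1, (q.2 : AddCircle (2 * Real.pi))))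
        (f := fun s : ℝ => (x + t, y + s)) (contDiff_const.prodMk (contDiff_const.add contDiff_id))
    have h := integral_fourier_mul
      (g := fun s => φ (x + t, (y : AddCircle (2 * Real.pi)) + s)) hg j
      (g₂ := fun s => derivθθ φ (x + t, (y : AddCircle (2 * Real.pi)) + s)) fun s => by
        rw [← AddCircle.coe_add, derivθθ_coe]
        exact (congrFun (iteratedDeriv_comp_const_add 2
          (fun s : ℝ => φ (x + t, (s : AddCircle (2 * Real.pi)))) y) s).symm
    calc _ = ∫ s, outKernel τ t / (2 * Real.pi) * (fourier j s *
          (-derivθθ φ (x + t, (y : AddCircle (2 * Real.pi)) + s) - (j : ℂ) ^ 2 *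
            φ (x + t, (y : AddCircle (2 * Real.pi)) + s))) := by
          refine integral_congr_ae (ae_of_all _ fun s => ?_)
          simp only [circleKernel, Prod.mk_add_mk]
          change _ * _ * (-derivθθ φ (x + t, (y : AddCircle (2 * Real.pi)) + s) - (j : ℂ) ^ 2 *
            φ (x + t, (y : AddCircle (2 * Real.pi)) + s)) = _
          ring
      _ = 0 := by rw [integral_const_mul, h, mul_zero]
  -- Since `w = τ² + j²`, the symbol splits into a longitudinal part, inverted by the outgoing
  -- kernel, and an angular part, annihilated by `e^{ijθ}`.
  have hsum : ∀ q : X, outKernel τ q.1 * circleKernel j q.2 *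
      (-laplacian φ (p + q) - w * φ (p + q)) =
      outKernel τ q.1 * circleKernel j q.2 * (-derivXX φ (p + q) - τ ^ 2 * φ (p + q)) +
      outKernel τ q.1 * circleKernel j q.2 * (-derivθθ φ (p + q) - (j : ℂ) ^ 2 * φ (p + q)) := by
    intro q
    rw [hw, laplacian_eq]
    ring
  simp only [hsum]
  rw [integral_add, hX, hθ, add_zero]
  · refine (hXi.neg.sub (hφi.const_mul (τ ^ 2))).congr (ae_of_all _ fun q => ?_)
    simp only [Pi.sub_apply, Pi.neg_apply]
    ring
  · refine (hθi.neg.sub (hφi.const_mul ((j : ℂ) ^ 2))).congr (ae_of_all _ fun q => ?_)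
    simp only [Pi.sub_apply, Pi.neg_apply]
    ring

end IsTestFunction

/-! ### The free resolvent and perturbations of it -/

/-- `∑_j` of the convolutions with `(i / 2τ_j) e^{iτ_j|x|} e^{ijθ} / 2π`. -/
def freeResolvent (t : ℤ → ℂ) (ht : ∀ j, 0 < (t j).im) : L2 →L[ℂ] L2 :=
  ∑' j, modeConv j (integrable_outKernel (ht j)).toL1

/-- The matrix element of rotations, as a continuous function on the circle. -/
def rotationCoeff (h u : L2) : C(AddCircle (2 * Real.pi), ℂ) where
  toFun s := inner ℂ h (trans (0, s) u)
  continuous_toFun := continuous_const.inner ((continuous_trans u).comp (by fun_prop))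

lemma fourierCoeff_rotationCoeff (h u : L2) (j : ℤ) :
    fourierCoeff (rotationCoeff h u) (-j) =
      ∫ s, circleKernel j s * inner ℂ h (trans (0, s) u) := by
  rw [fourierCoeff, AddCircle.integral_haarAddCircle, neg_neg, ← integral_smul]
  refine integral_congr_ae (ae_of_all _ fun s => ?_)
  simp only [circleKernel, rotationCoeff, ContinuousMap.coe_mk, smul_eq_mul, Complex.real_smul]
  push_cast
  ring

/-- Turns the equation in the mode `j` into one Fourier coefficient of the continuous function `s ↦
⟪φ̄, u(· - (0, s))⟫`. Fourier inversion at `s = 0` then plays the role of completeness of the modes.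
-/
lemma inner_conjLp_symbol_modeConv {φ : X → ℂ} (hφ : IsTestFunction φ) {w τ : ℂ} {j : ℤ}
    (hτ : 0 < τ.im) (hw : τ ^ 2 = w - (j : ℂ) ^ 2) (u : L2) :
    inner ℂ (conjLp (hφ.memLp_symbol w)) (modeConv j (integrable_outKernel hτ).toL1 u) =
      fourierCoeff (rotationCoeff (conjLp hφ.memLp) u) (-j) := by
  rw [inner_conjLp_modeConv, fourierCoeff_rotationCoeff]
  simp only [hφ.integral_outKernel_symbol hτ hw]
  have he : MeasurableEmbedding fun s : AddCircle (2 * Real.pi) => ((0, s) : X) :=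
    MeasurableEmbedding.prodMk_left 0 MeasurableEmbedding.id
  -- The average over rotations is treated as a convolution with a measure carried by `{0} × 𝕊¹`.
  have hi : Integrable (fun q : X => circleKernel j q.2)
      (volume.map fun s : AddCircle (2 * Real.pi) => ((0, s) : X)) := by
    rw [he.integrable_map_iff]
    exact integrable_circleKernel j
  have h := integral_mul_inner_conjLp_trans hi hφ.memLp u
  simp only [he.integral_map] at h
  exact h.symm

lemma solvesWeakly_zero_iff {w : ℂ} {u f : L2} : SolvesWeakly 0 w u f ↔
    ∀ (φ : X → ℂ) (hφ : IsTestFunction φ), inner ℂ (conjLp (hφ.memLp_symbol w)) u =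
      inner ℂ (conjLp hφ.memLp) f := by
  refine forall_congr' fun φ => forall_congr' fun hφ => ?_
  rw [inner_conjLp, inner_conjLp]
  simp only [Pi.zero_apply, zero_sub, neg_mul, ← sub_eq_add_neg]

/-! ### Density of test functions and uniqueness for the free equation -/

lemma isTestFunction_mul_fourier {ψ : ℝ → ℂ} (hψ : ContDiff ℝ ∞ ψ) (hψc : HasCompactSupport ψ)
    (j : ℤ) : IsTestFunction fun p => ψ p.1 * fourier j p.2 where
  smooth := by
    simp only [fourier_coe_apply]
    refine (hψ.comp contDiff_fst).mul (ContDiff.cexp ?_)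
    exact (contDiff_const.mul (Complex.ofRealCLM.contDiff.comp contDiff_snd)).div_const _
  compactSupport := by
    refine HasCompactSupport.of_support_subset_isCompact
      ((hψc : IsCompact (tsupport ψ)).prod (isCompact_univ (X := AddCircle (2 * Real.pi))))
      fun p hp => ⟨subset_tsupport _ fun h => hp ?_, trivial⟩
    simp [h]

lemma ae_eq_zero_of_fourierCoeff_eq_zero {v : AddCircle (2 * Real.pi) → ℂ} (hv : MemLp v 2)
    (h : ∀ j, ∫ s, v s * fourier j s = 0) : v =ᵐ[volume] 0 := by
  have hv' : MemLp v 2 AddCircle.haarAddCircle := memLp_haarAddCircle_iff.2 hv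
  have h1 : hv'.toLp = 0 := by
    refine (fourierBasis (T := 2 * Real.pi)).repr.injective ?_
    ext j
    rw [fourierBasis_repr, fourierCoeff_congr_ae hv'.coeFn_toLp, fourierCoeff,
      AddCircle.integral_haarAddCircle]
    have h2 := h (-j)
    simp only [smul_eq_mul, mul_comm (fourier (-j) _), h2]
    simp
  have h2 : v =ᵐ[AddCircle.haarAddCircle] 0 := by
    rw [← MemLp.toLp_zero (MemLp.zero (ε := ℂ))] at h1
    exact (MemLp.toLp_eq_toLp_iff _ _).1 h1
  rw [AddCircle.volume_eq_smul_haarAddCircle]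
  exact Measure.ae_smul_measure h2 _

/-- Each angular Fourier coefficient of `v` is a locally integrable function of `x` that vanishes as
a distribution, hence almost everywhere. For almost every `x` all coefficients of the slice then
vanish together, and so does the slice. -/
lemma ae_eq_zero_of_integral_mul_fourier_eq_zero {v : X → ℂ} (hv : MemLp v 2)
    (h : ∀ (g : ℝ → ℂ), ContDiff ℝ ∞ g → HasCompactSupport g → ∀ j : ℤ,
      ∫ p, v p * (g p.1 * fourier j p.2) = 0) : v =ᵐ[volume] 0 := by
  have hfin : ∀ K : Set ℝ, IsCompact K → ∀ j : ℤ,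
      Integrable (fun p : X => v p * (K ×ˢ Set.univ).indicator (fun p : X => fourier j p.2) p) := by
    intro K hK j
    have hKm : MeasurableSet (K ×ˢ (Set.univ : Set (AddCircle (2 * Real.pi)))) :=
      hK.measurableSet.prod .univ
    refine hv.integrable_mul (q := 2) ((memLp_indicator_iff_restrict hKm).2 ?_)
    have : IsFiniteMeasure ((volume : Measure X).restrict (K ×ˢ Set.univ)) :=
      ⟨by simpa using (hK.prod isCompact_univ).measure_lt_top⟩
    refine MemLp.of_bound ?_ 1 (ae_of_all _ fun p => ?_)
    · exact ((map_continuous (fourier j)).comp continuous_snd).aestronglyMeasurable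
    · rw [fourier_apply, Circle.norm_coe]
  set U : ℤ → ℝ → ℂ := fun j x => ∫ s, v (x, s) * fourier j s with hU
  have hUloc : ∀ j, LocallyIntegrable (U j) := by
    intro j
    rw [locallyIntegrable_iff]
    intro K hK
    have h1 := (hfin K hK j)
    rw [Measure.volume_eq_prod] at h1
    have h2 := h1.integral_prod_left
    rw [← integrable_indicator_iff hK.measurableSet]
    refine h2.congr (ae_of_all _ fun x => ?_)
    by_cases hx : x ∈ K <;> simp [hx, hU]
  have hU0 : ∀ j, ∀ᵐ x, U j x = 0 := by
    intro j
    refine ae_eq_zero_of_integral_contDiff_smul_eq_zero (hUloc j) fun g hg hgc => ?_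
    have hgC : ContDiff ℝ ∞ fun x => (g x : ℂ) := Complex.ofRealCLM.contDiff.comp hg
    have hgCc : HasCompactSupport fun x => (g x : ℂ) := hgc.comp_left (g := ((↑) : ℝ → ℂ)) (by simp)
    have ht := isTestFunction_mul_fourier hgC hgCc j
    have h1 := h _ hgC hgCc j
    have hint : Integrable (fun p : X => v p * ((g p.1 : ℂ) * fourier j p.2)) :=
      hv.integrable_mul ht.memLp
    rw [Measure.volume_eq_prod, integral_prod _ hint] at h1
    rw [← h1]
    refine integral_congr_ae (ae_of_all _ fun x => ?_)
    simp only [hU]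
    rw [← integral_smul]
    refine integral_congr_ae (ae_of_all _ fun s => ?_)
    simp only [Complex.real_smul]
    ring
  have hsq : Integrable fun p : X => ‖v p‖ ^ 2 :=
    (memLp_two_iff_integrable_sq_norm hv.aestronglyMeasurable).1 hv
  have hm := hv.aestronglyMeasurable
  rw [Measure.volume_eq_prod] at hm
  have hslice : ∀ᵐ x : ℝ, ∫ s : AddCircle (2 * Real.pi), ‖v (x, s)‖ ^ 2 = 0 := by
    have hsq' := hsq
    rw [Measure.volume_eq_prod] at hsq'
    filter_upwards [ae_all_iff.2 hU0, hsq'.prod_right_ae, hm.prodMk_left] with x h1 h2 h3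
    refine integral_eq_zero_of_ae ?_
    filter_upwards [ae_eq_zero_of_fourierCoeff_eq_zero
      ((memLp_two_iff_integrable_sq_norm h3).2 h2) h1] with s hs
    simp [hs]
  have h0 : ∫ p : X, ‖v p‖ ^ 2 = 0 := by
    rw [Measure.volume_eq_prod, integral_prod _ hsq]
    exact integral_eq_zero_of_ae hslice
  filter_upwards [(integral_eq_zero_iff_of_nonneg (fun p => by positivity) hsq).1 h0] with p hp
  simpa using hp

/-- Test functions are dense in `L²(X)`. -/
lemma eq_zero_of_forall_inner_test {u : L2}
    (h : ∀ (φ : X → ℂ) (hφ : IsTestFunction φ), inner ℂ (conjLp hφ.memLp) u = 0) : u = 0 := by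
  refine (Lp.eq_zero_iff_ae_eq_zero).2
    (ae_eq_zero_of_integral_mul_fourier_eq_zero (Lp.memLp u) fun g hg hgc j => ?_)
  rw [← inner_conjLp (isTestFunction_mul_fourier hg hgc j).memLp]
  exact h _ (isTestFunction_mul_fourier hg hgc j)

lemma inner_conjLp_trans {g : X → ℂ} (hg : MemLp g 2) (q : X)
    (hg' : MemLp (fun p => g (p + q)) 2) (u : L2) :
    inner ℂ (conjLp hg) (trans q u) = inner ℂ (conjLp hg') u := by
  rw [inner_conjLp, inner_conjLp, ← integral_sub_right_eq_self (fun p => u p * g (p + q)) q]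
  refine integral_congr_ae ?_
  filter_upwards [coeFn_trans q u] with p hp
  rw [hp, sub_add_cancel]

lemma eq_zero_of_fourierCoeff_eq_zero {n : C(AddCircle (2 * Real.pi), ℂ)}
    (h : ∀ j, fourierCoeff n j = 0) (s : AddCircle (2 * Real.pi)) : n s = 0 := by
  have h0 : fourierCoeff n = fun _ => 0 := funext h
  have h1 := has_pointwise_sum_fourier_series_of_summable (f := n)
    (by rw [h0]; exact summable_zero) s
  simp only [h, zero_smul] at h1
  exact h1.unique hasSum_zero

/-- Existence: summability in operator norm makes the Fourier series of the rotation coefficient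
summable, so it converges at `0` to the pairing with `f`. Uniqueness: for a homogeneous solution in
`L²` the same identities make all these Fourier coefficients vanish. -/
theorem isResolvent_freeResolvent {w : ℂ} {t : ℤ → ℂ} (ht : ∀ j, 0 < (t j).im)
    (hw : ∀ j, t j ^ 2 = w - (j : ℂ) ^ 2)
    (hs : Summable fun j => modeConv j (integrable_outKernel (ht j)).toL1) :
    IsResolvent 0 w (freeResolvent t ht) := by
  have hsolves : ∀ f, SolvesWeakly 0 w (freeResolvent t ht f) f := by
    intro f
    refine solvesWeakly_zero_iff.2 fun φ hφ => ?_
    set h := conjLp (hφ.memLp_symbol w)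
    set n := rotationCoeff (conjLp hφ.memLp) f with hn
    have h1 : HasSum (fun j => fourierCoeff n (-j)) (inner ℂ h (freeResolvent t ht f)) := by
      have h2 := ((innerSL ℂ h).comp (ContinuousLinearMap.apply ℂ L2 f)).hasSum hs.hasSum
      refine HasSum.congr_fun h2 fun j => ?_
      exact (inner_conjLp_symbol_modeConv hφ (ht j) (hw j) f).symm
    have h3 : HasSum (fourierCoeff n) (inner ℂ h (freeResolvent t ht f)) :=
      (Equiv.neg ℤ).hasSum_iff.1 h1
    have h4 := has_pointwise_sum_fourier_series_of_summable h3.summable 0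
    simp only [fourier_eval_zero, smul_eq_mul, mul_one] at h4
    rw [h3.unique h4]
    change inner ℂ _ (trans 0 f) = _
    rw [trans_zero]
  intro u f
  refine ⟨fun hu => ?_, fun hu => hu ▸ hsolves f⟩
  rw [← sub_eq_zero]
  set v := u - freeResolvent t ht f
  have hv : ∀ (φ : X → ℂ) (hφ : IsTestFunction φ), inner ℂ (conjLp (hφ.memLp_symbol w)) v = 0 := by
    intro φ hφ
    rw [inner_sub_right, solvesWeakly_zero_iff.1 hu φ hφ,
      solvesWeakly_zero_iff.1 (hsolves f) φ hφ, sub_self]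
  refine eq_zero_of_forall_inner_test fun φ hφ => ?_
  -- The Laplacian commutes with translations, so every translate of a homogeneous solution is again
  -- one.
  have h1 : ∀ q, inner ℂ (conjLp (hφ.memLp_symbol w)) (trans q v) = 0 := by
    intro q
    have h2 := hv _ (hφ.translate q)
    have h3 : (fun p => -laplacian (fun p => φ (p + q)) p - w * φ (p + q)) =
        fun p => -laplacian φ (p + q) - w * φ (p + q) := by
      ext p
      rw [IsTestFunction.laplacian_translate]
    have h4 : MemLp (fun p => -laplacian φ (p + q) - w * φ (p + q)) 2 :=
      h3 ▸ (hφ.translate q).memLp_symbol w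
    rw [inner_conjLp_trans (hφ.memLp_symbol w) q h4, ← h2]
    congr 2
    exact h3.symm
  have h2 : ∀ j, fourierCoeff (rotationCoeff (conjLp hφ.memLp) v) j = 0 := by
    intro j
    rw [← neg_neg j, ← inner_conjLp_symbol_modeConv hφ (ht (-j)) (hw (-j)), inner_modeConv]
    simp [h1]
  have h3 := eq_zero_of_fourierCoeff_eq_zero h2 0
  change inner ℂ _ (trans 0 v) = 0 at h3
  rwa [trans_zero] at h3

/-! ### Cutoffs and the potential -/

lemma coeFn_mulOp_toLp {g : X → ℂ} (hg : MemLp g ∞) (f : L2) :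
    mulOp hg.toLp f =ᵐ[volume] fun p => g p * f p := by
  filter_upwards [coeFn_mulOp hg.toLp f, hg.coeFn_toLp] with p h1 h2
  rw [h1, h2]

lemma norm_mulOp_toLp_le {g : X → ℂ} (hg : MemLp g ∞) {c : ℝ} (hc : 0 ≤ c) (h : ∀ p, ‖g p‖ ≤ c) :
    ‖mulOp hg.toLp‖ ≤ c :=
  (norm_mulOp_le _).trans (by
    rw [Lp.norm_toLp, eLpNorm_exponent_top]
    refine ENNReal.toReal_le_of_le_ofReal hc ?_
    exact eLpNormEssSup_le_of_ae_bound (ae_of_all _ h))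

lemma inner_mulOp_left {g : X → ℂ} (hg : MemLp g ∞) (hr : ∀ p, (starRingEnd ℂ) (g p) = g p)
    (f h : L2) : inner ℂ (mulOp hg.toLp f) h = inner ℂ f (mulOp hg.toLp h) := by
  rw [L2.inner_def, L2.inner_def]
  refine integral_congr_ae ?_
  filter_upwards [coeFn_mulOp_toLp hg f, coeFn_mulOp_toLp hg h] with p h1 h2
  rw [h1, h2, RCLike.inner_apply, RCLike.inner_apply, map_mul, hr]
  ring

lemma mulOp_mem_mode {g : X → ℂ} (hg : MemLp g ∞) {k j : ℤ}
    (h : ∀ p s, g (p - (0, s)) = fourier (-k) s * g p) {f : L2} (hf : f ∈ mode j) :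
    mulOp hg.toLp f ∈ mode (j + k) := by
  intro s
  apply Lp.ext
  filter_upwards [coeFn_trans (0, s) (mulOp hg.toLp f), ae_sub_right (coeFn_mulOp_toLp hg f) (0, s),
    coeFn_trans (0, s) f, Lp.coeFn_smul (fourier (-j) s) f, coeFn_mulOp_toLp hg f,
    Lp.coeFn_smul (fourier (-(j + k)) s) (mulOp hg.toLp f)] with p h1 h2 h3 h4 h5 h6
  rw [h1, h2, h, h6, Pi.smul_apply, h5, ← h3, hf s, h4, Pi.smul_apply, smul_eq_mul, smul_eq_mul,
    neg_add, fourier_add]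
  ring

/-- The indicator function of `{|x| ≤ M}`. -/
def band (M : ℝ) (p : X) : ℂ := (Set.Icc (-M) M).indicator 1 p.1

lemma measurable_band (M : ℝ) : Measurable (band M) :=
  (measurable_one.indicator measurableSet_Icc).comp measurable_fst

lemma band_of_abs_le {M : ℝ} {p : X} (h : |p.1| ≤ M) : band M p = 1 := by
  simp [band, abs_le.1 h]

lemma band_of_lt_abs {M : ℝ} {p : X} (h : M < |p.1|) : band M p = 0 := by
  have : p.1 ∉ Set.Icc (-M) M := fun hm => h.not_ge (abs_le.2 hm)
  simp only [band, Set.indicator_of_notMem this]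

lemma norm_band_le (M : ℝ) (p : X) : ‖band M p‖ ≤ 1 := by
  rcases le_or_gt |p.1| M with h | h
  · simp [band_of_abs_le h]
  · simp [band_of_lt_abs h]

lemma conj_band (M : ℝ) (p : X) : (starRingEnd ℂ) (band M p) = band M p := by
  rcases le_or_gt |p.1| M with h | h
  · simp [band_of_abs_le h]
  · simp [band_of_lt_abs h]

lemma memLp_band (M : ℝ) : MemLp (band M) ∞ :=
  memLp_top_of_bound (measurable_band M).aestronglyMeasurable 1 (ae_of_all _ (norm_band_le M))

/-- The cutoff to `{|x| ≤ M}`. -/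
def cutoff (M : ℝ) : L2 →L[ℂ] L2 := mulOp (memLp_band M).toLp

lemma coeFn_cutoff (M : ℝ) (f : L2) : cutoff M f =ᵐ[volume] fun p => band M p * f p :=
  coeFn_mulOp_toLp _ f

lemma norm_cutoff_le (M : ℝ) : ‖cutoff M‖ ≤ 1 :=
  norm_mulOp_toLp_le _ zero_le_one (norm_band_le M)

lemma inner_cutoff_left (M : ℝ) (f h : L2) : inner ℂ (cutoff M f) h = inner ℂ f (cutoff M h) :=
  inner_mulOp_left _ (conj_band M) f h

lemma adjoint_cutoff (M : ℝ) : ContinuousLinearMap.adjoint (cutoff M) = cutoff M := by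
  refine (ContinuousLinearMap.eq_adjoint_iff _ _).2 (fun f h => ?_) |>.symm
  exact inner_cutoff_left M f h

lemma cutoff_mem_mode (M : ℝ) {j : ℤ} {f : L2} (hf : f ∈ mode j) : cutoff M f ∈ mode j := by
  have := mulOp_mem_mode (memLp_band M) (k := 0) (fun p s => by simp [band]) hf
  rwa [add_zero] at this

lemma IsModeOp.cutoff {j : ℤ} {B : L2 →L[ℂ] L2} (hB : IsModeOp j B) (M : ℝ) :
    IsModeOp j (cutoff M ∘L B ∘L cutoff M) where
  mem f := cutoff_mem_mode M (hB.mem _)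
  adjoint_mem f := by
    rw [ContinuousLinearMap.adjoint_comp, ContinuousLinearMap.adjoint_comp, adjoint_cutoff]
    exact cutoff_mem_mode M (hB.adjoint_mem _)

lemma norm_cutoff_comp_le (M : ℝ) (B : L2 →L[ℂ] L2) : ‖cutoff M ∘L B ∘L cutoff M‖ ≤ ‖B‖ := by
  have h1 := ContinuousLinearMap.opNorm_comp_le (cutoff M) (B ∘L cutoff M)
  have h2 := ContinuousLinearMap.opNorm_comp_le B (cutoff M)
  have h3 := norm_cutoff_le M
  nlinarith [norm_nonneg B, norm_nonneg (cutoff M), norm_nonneg (B ∘L cutoff M)]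

lemma band_mul_band {M N : ℝ} (h : M ≤ N) (p : X) : band M p * band N p = band M p := by
  rcases le_or_gt |p.1| M with hp | hp
  · rw [band_of_abs_le (hp.trans h), mul_one]
  · rw [band_of_lt_abs hp, zero_mul]

lemma cutoff_cutoff_of_le {M N : ℝ} (h : M ≤ N) (f : L2) : cutoff M (cutoff N f) = cutoff M f := by
  apply Lp.ext
  filter_upwards [coeFn_cutoff M (cutoff N f), coeFn_cutoff N f, coeFn_cutoff M f] with p h1 h2 h3
  rw [h1, h2, h3, ← mul_assoc, band_mul_band h]

lemma cutoff_cutoff_of_ge {M N : ℝ} (h : M ≤ N) (f : L2) : cutoff N (cutoff M f) = cutoff M f := by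
  apply Lp.ext
  filter_upwards [coeFn_cutoff N (cutoff M f), coeFn_cutoff M f] with p h1 h2
  rw [h1, h2, ← mul_assoc, mul_comm (band N p), band_mul_band h]

lemma cutoff_trans_cutoff {M : ℝ} {q : X} (hq : 2 * M < |q.1|) (f : L2) :
    cutoff M (trans q (cutoff M f)) = 0 := by
  apply Lp.ext
  filter_upwards [coeFn_cutoff M (trans q (cutoff M f)), coeFn_trans q (cutoff M f),
    ae_sub_right (coeFn_cutoff M f) q, Lp.coeFn_zero ℂ 2 (volume : Measure X)] with p h1 h2 h3 h4
  rw [h1, h2, h3, h4]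
  rcases le_or_gt |p.1| M with hp | hp
  · have : M < |(p - q).1| := by
      have h5 := abs_sub_abs_le_abs_sub q.1 p.1
      rw [abs_sub_comm] at h5
      rw [Prod.fst_sub]
      linarith
    simp [band_of_lt_abs this]
  · simp [band_of_lt_abs hp]

/-- Cut-off convolutions depend on the kernel in `{|t| ≤ 2M}` only. -/
lemma cutoff_modeConv_congr {M : ℝ} (j : ℤ) {k k' : ℝ → ℂ} (hk : Integrable k)
    (hk' : Integrable k') (h : ∀ t, |t| ≤ 2 * M → k t = k' t) :
    cutoff M ∘L modeConv j hk.toL1 ∘L cutoff M = cutoff M ∘L modeConv j hk'.toL1 ∘L cutoff M := by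
  ext1 f
  refine ext_inner_left ℂ fun g => ?_
  simp only [ContinuousLinearMap.comp_apply]
  rw [← inner_cutoff_left, ← inner_cutoff_left, inner_modeConv, inner_modeConv]
  refine integral_congr_ae (ae_of_all _ fun q => ?_)
  simp only
  rcases le_or_gt |q.1| (2 * M) with hq | hq
  · rw [h _ hq]
  · rw [inner_cutoff_left, cutoff_trans_cutoff hq, inner_zero_right, mul_zero, mul_zero]

/-! ### The potential as a pair of unit shifts of the angular mode -/

/-- The function `e^{ikθ}`. -/
def expθ (k : ℤ) (p : X) : ℂ := fourier k p.2

lemma continuous_expθ (k : ℤ) : Continuous (expθ k) :=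
  (map_continuous (fourier k)).comp continuous_snd

lemma norm_expθ (k : ℤ) (p : X) : ‖expθ k p‖ = 1 := by
  rw [expθ, fourier_apply, Circle.norm_coe]

lemma memLp_expθ (k : ℤ) : MemLp (expθ k) ∞ :=
  memLp_top_of_bound (continuous_expθ k).aestronglyMeasurable 1
    (ae_of_all _ fun p => (norm_expθ k p).le)

lemma expθ_sub (k : ℤ) (p q : X) : expθ k (p - q) = fourier (-k) q.2 * expθ k p := by
  rw [expθ, expθ, fourier_apply, fourier_apply, fourier_apply, Prod.snd_sub, zsmul_sub, neg_smul,
    sub_eq_add_neg, AddCircle.toCircle_add]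
  push_cast
  ring

/-- Multiplication by `e^{ikθ}`. -/
def shiftMode (k : ℤ) : L2 →L[ℂ] L2 := mulOp (memLp_expθ k).toLp

lemma shiftMode_mem_mode {k j : ℤ} {f : L2} (hf : f ∈ mode j) : shiftMode k f ∈ mode (j + k) :=
  mulOp_mem_mode _ (fun p s => expθ_sub k p (0, s)) hf

lemma potential_eq (p : X) : potential p = band 1 p * (expθ 1 p + expθ (-1) p) := by
  obtain ⟨x, θ⟩ := p
  obtain ⟨y, rfl⟩ := QuotientAddGroup.mk_surjective θ
  have h1 : Real.cos_periodic.lift (QuotientAddGroup.mk y : AddCircle (2 * Real.pi)) =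
    Real.cos y := rfl
  have h2 : ∀ k : ℤ, expθ k (x, (QuotientAddGroup.mk y : AddCircle (2 * Real.pi))) =
      Complex.exp (k * y * Complex.I) := by
    intro k
    change fourier k (y : AddCircle (2 * Real.pi)) = _
    rw [fourier_coe_apply]
    congr 1
    push_cast
    field_simp
  rw [potential, h1, h2, h2]
  simp only [band]
  push_cast
  rw [Complex.cos]
  by_cases hx : x ∈ Set.Icc (-1 : ℝ) 1
  · simp only [Set.indicator_of_mem hx, Pi.one_apply]
    push_cast
    ring_nf
  · simp only [Set.indicator_of_notMem hx]
    simp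

lemma norm_potential_le (p : X) : ‖potential p‖ ≤ 2 := by
  rw [potential_eq, norm_mul]
  have h1 := norm_band_le 1 p
  have h2 := norm_add_le (expθ 1 p) (expθ (-1) p)
  rw [norm_expθ, norm_expθ] at h2
  nlinarith [norm_nonneg (band 1 p), norm_nonneg (expθ 1 p + expθ (-1) p)]

lemma conj_potential (p : X) : (starRingEnd ℂ) (potential p) = potential p :=
  Complex.conj_ofReal _

lemma measurable_potential : Measurable potential := by
  have : potential = fun p => band 1 p * (expθ 1 p + expθ (-1) p) := funext potential_eq
  rw [this]
  exact (measurable_band 1).mul ((continuous_expθ 1).measurable.add (continuous_expθ _).measurable)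

lemma memLp_potential : MemLp potential ∞ :=
  memLp_top_of_bound measurable_potential.aestronglyMeasurable 2 (ae_of_all _ norm_potential_le)

/-- Multiplication by the potential. -/
def potentialOp : L2 →L[ℂ] L2 := mulOp memLp_potential.toLp

lemma coeFn_potentialOp (f : L2) : potentialOp f =ᵐ[volume] fun p => potential p * f p :=
  coeFn_mulOp_toLp _ f

lemma norm_potentialOp_le : ‖potentialOp‖ ≤ 2 :=
  norm_mulOp_toLp_le _ zero_le_two norm_potential_le

lemma inner_potentialOp_left (f h : L2) :
    inner ℂ (potentialOp f) h = inner ℂ f (potentialOp h) :=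
  inner_mulOp_left _ conj_potential f h

lemma potentialOp_eq (f : L2) :
    potentialOp f = cutoff 1 (shiftMode 1 f) + cutoff 1 (shiftMode (-1) f) := by
  apply Lp.ext
  filter_upwards [coeFn_potentialOp f, coeFn_cutoff 1 (shiftMode 1 f),
    coeFn_cutoff 1 (shiftMode (-1) f), coeFn_mulOp_toLp (memLp_expθ 1) f,
    coeFn_mulOp_toLp (memLp_expθ (-1)) f,
    Lp.coeFn_add (cutoff 1 (shiftMode 1 f)) (cutoff 1 (shiftMode (-1) f))] with p h1 h2 h3 h4 h5 h6
  rw [h1, h6, Pi.add_apply, h2, h3]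
  change _ = _ * mulOp _ f p + _ * mulOp _ f p
  rw [h4, h5, potential_eq]
  ring

lemma cutoff_potentialOp {M : ℝ} (hM : 1 ≤ M) (f : L2) :
    cutoff M (potentialOp f) = potentialOp f := by
  rw [potentialOp_eq, map_add, cutoff_cutoff_of_ge hM, cutoff_cutoff_of_ge hM]

lemma potentialOp_cutoff {M : ℝ} (hM : 1 ≤ M) (f : L2) :
    potentialOp (cutoff M f) = potentialOp f := by
  refine ext_inner_left ℂ fun h => ?_
  rw [← inner_potentialOp_left, ← inner_cutoff_left, cutoff_potentialOp hM, inner_potentialOp_left]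

/-! ### Perturbation of the free resolvent -/

lemma solvesWeakly_potential_iff {w : ℂ} {u f : L2} :
    SolvesWeakly potential w u f ↔ SolvesWeakly 0 w u (f - potentialOp u) := by
  refine forall_congr' fun φ => forall_congr' fun hφ => ?_
  have h1 : ∫ p, (f - potentialOp u : L2) p * φ p =
      (∫ p, f p * φ p) - ∫ p, potentialOp u p * φ p := by
    rw [← inner_conjLp hφ.memLp, inner_sub_right, inner_conjLp, inner_conjLp]
  have h2 : ∫ p, u p * (-laplacian φ p + (potential p - w) * φ p) =
      (∫ p, u p * (-laplacian φ p + ((0 : X → ℂ) p - w) * φ p)) +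
        ∫ p, potentialOp u p * φ p := by
    rw [← integral_add]
    · refine integral_congr_ae ?_
      filter_upwards [coeFn_potentialOp u] with p hp
      rw [hp, Pi.zero_apply]
      ring
    · refine ((Lp.memLp u).integrable_mul (hφ.memLp_symbol w)).congr (ae_of_all _ fun p => ?_)
      simp only [Pi.zero_apply, Pi.mul_apply]
      ring
    · exact (Lp.memLp _).integrable_mul hφ.memLp
  rw [h1, h2, eq_sub_iff_add_eq]

lemma isResolvent_potential_iff {w : ℂ} {R₀ R : L2 →L[ℂ] L2} (h₀ : IsResolvent 0 w R₀) :
    IsResolvent potential w R ↔ ∀ u f, u = R₀ (f - potentialOp u) ↔ u = R f := by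
  refine forall_congr' fun u => forall_congr' fun f => ?_
  rw [solvesWeakly_potential_iff, h₀]

/-- Neumann series: `2` bounds the potential, so `‖R₀V‖ < 1` and `(1 + R₀V)⁻¹R₀` is the resolvent.
This produces the one physical point from which the continuation starts. -/
lemma exists_isResolvent_potential {w : ℂ} {R₀ : L2 →L[ℂ] L2} (h₀ : IsResolvent 0 w R₀)
    (hR : ‖R₀‖ < 1 / 2) : ∃ R, IsResolvent potential w R := by
  have hn : ‖-(R₀ * potentialOp)‖ < 1 := by
    rw [norm_neg]
    have := norm_mul_le R₀ potentialOp
    nlinarith [norm_potentialOp_le, norm_nonneg R₀]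
  have hu := isUnit_one_sub_of_norm_lt_one hn
  rw [sub_neg_eq_add] at hu
  obtain ⟨A, hA⟩ := hu
  refine ⟨(↑A⁻¹ : L2 →L[ℂ] L2) * R₀, (isResolvent_potential_iff h₀).2 fun u f => ?_⟩
  have h1 : u = R₀ (f - potentialOp u) ↔ (A : L2 →L[ℂ] L2) u = R₀ f := by
    rw [hA, map_sub, eq_sub_iff_add_eq]
    rfl
  rw [h1]
  constructor
  · intro h
    rw [mul_apply_eq_comp, ← h, ← mul_apply_eq_comp, Units.inv_mul]
    rfl
  · intro h
    rw [h, mul_apply_eq_comp, ← mul_apply_eq_comp, Units.mul_inv]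
    rfl

/-! ### Truncated convolutions -/

open scoped BoundedContinuousFunction

lemma integrable_indicator_bcf (M : ℝ) (κ : ℝ →ᵇ ℂ) :
    Integrable ((Set.Icc (-(2 * M)) (2 * M)).indicator κ) :=
  κ.continuous.locallyIntegrable.integrableOn_isCompact isCompact_Icc
    |>.integrable_indicator measurableSet_Icc

lemma setIntegral_norm_bcf_le (M : ℝ) {κ : ℝ →ᵇ ℂ} {c : ℝ} (h : ∀ t, |t| ≤ 2 * M → ‖κ t‖ ≤ c) :
    ∫ t in Set.Icc (-(2 * M)) (2 * M), ‖κ t‖ ≤ volume.real (Set.Icc (-(2 * M)) (2 * M)) * c := by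
  refine (le_abs_self _).trans ?_
  rw [← Real.norm_eq_abs]
  have hfin : volume (Set.Icc (-(2 * M)) (2 * M)) < ⊤ := isCompact_Icc.measure_lt_top
  have hb : ∀ t ∈ Set.Icc (-(2 * M)) (2 * M), ‖‖κ t‖‖ ≤ c := fun t ht => by
    rw [norm_norm]
    exact h t (abs_le.2 ht)
  exact (norm_setIntegral_le_of_norm_le_const hfin hb).trans_eq (mul_comm _ _)

/-- Convolution with `κ(x) e^{ijθ} / 2π`, truncated to `|x| ≤ 2M`. -/
def truncConv (M : ℝ) (j : ℤ) : (ℝ →ᵇ ℂ) →L[ℂ] L2 →L[ℂ] L2 :=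
  modeConv j ∘L LinearMap.mkContinuous
    { toFun := fun κ => (integrable_indicator_bcf M κ).toL1
      map_add' := fun κ κ' => by
        rw [← Integrable.toL1_add]
        congr 1
        exact Set.indicator_add _ _ _
      map_smul' := fun c κ => by
        rw [RingHom.id_apply, ← Integrable.toL1_smul']
        congr 1
        exact Set.indicator_const_smul _ c κ } (volume.real (Set.Icc (-(2 * M)) (2 * M))) (fun κ => by
      simp only [LinearMap.coe_mk, AddHom.coe_mk]
      rw [norm_toL1_eq_integral]
      simp only [norm_indicator_eq_indicator_norm]
      rw [integral_indicator measurableSet_Icc]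
      exact setIntegral_norm_bcf_le M fun t _ => κ.norm_coe_le_norm t)

lemma truncConv_apply (M : ℝ) (j : ℤ) (κ : ℝ →ᵇ ℂ) :
    truncConv M j κ = modeConv j (integrable_indicator_bcf M κ).toL1 := rfl

lemma isModeOp_truncConv (M : ℝ) (j : ℤ) (κ : ℝ →ᵇ ℂ) : IsModeOp j (truncConv M j κ) :=
  isModeOp_modeConv j _

lemma norm_truncConv_le (M : ℝ) (j : ℤ) (κ : ℝ →ᵇ ℂ) :
    ‖truncConv M j κ‖ ≤ ∫ t in Set.Icc (-(2 * M)) (2 * M), ‖κ t‖ := by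
  rw [truncConv_apply, ← integral_indicator measurableSet_Icc]
  refine (norm_modeConv_le j _).trans (le_of_eq ?_)
  simp only [norm_indicator_eq_indicator_norm]

lemma norm_truncConv_le_of_bound {M : ℝ} (hM : 0 ≤ M) (j : ℤ) {κ : ℝ →ᵇ ℂ} {c : ℝ}
    (h : ∀ t, |t| ≤ 2 * M → ‖κ t‖ ≤ c) : ‖truncConv M j κ‖ ≤ 4 * M * c := by
  refine (norm_truncConv_le M j κ).trans ((setIntegral_norm_bcf_le M h).trans (le_of_eq ?_))
  rw [Real.volume_real_Icc_of_le (by linarith)]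
  ring

lemma cutoff_truncConv_congr {N M : ℝ} (hNM : N ≤ M) (j : ℤ) {κ κ' : ℝ →ᵇ ℂ}
    (h : ∀ t, |t| ≤ 2 * N → κ t = κ' t) :
    cutoff N ∘L truncConv M j κ ∘L cutoff N = cutoff N ∘L truncConv N j κ' ∘L cutoff N := by
  refine cutoff_modeConv_congr j (integrable_indicator_bcf M κ) (integrable_indicator_bcf N κ')
    fun t ht => ?_
  have h1 : t ∈ Set.Icc (-(2 * N)) (2 * N) := abs_le.1 ht
  have h2 : t ∈ Set.Icc (-(2 * M)) (2 * M) := abs_le.1 (ht.trans (by linarith))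
  rw [Set.indicator_of_mem h1, Set.indicator_of_mem h2, h t ht]

/-- The bounded function `i min(|t|, 2M)`. -/
def truncPhase (M : ℝ) : ℝ →ᵇ ℂ :=
  BoundedContinuousFunction.ofNormedAddCommGroup
    (fun t : ℝ => Complex.I * ((min |t| |2 * M| : ℝ) : ℂ)) (by fun_prop) |2 * M| (fun t => by
      rw [norm_mul, Complex.norm_I, one_mul, Complex.norm_real,
        Real.norm_of_nonneg (by positivity)]
      exact min_le_right _ _)

lemma truncPhase_apply_of_abs_le {M t : ℝ} (ht : |t| ≤ 2 * M) :
    truncPhase M t = Complex.I * |t| := by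
  change Complex.I * ((min |t| |2 * M| : ℝ) : ℂ) = _
  rw [min_eq_left (ht.trans (le_abs_self _))]

/-- The bounded function `e^{iz min(|t|, 2M)}`. -/
def truncExp (M : ℝ) (z : ℂ) : ℝ →ᵇ ℂ := NormedSpace.exp (z • truncPhase M)

/-- The exponential is taken in the Banach algebra of bounded continuous functions. The kernel is
thus entire in the sup norm, and the truncated convolutions inherit holomorphy in operator norm also
where `Im z < 0` and the untruncated kernel grows. -/
lemma differentiable_truncExp (M : ℝ) : Differentiable ℂ (truncExp M) := fun z =>
  (hasDerivAt_exp_smul_const (truncPhase M) z).differentiableAt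

/-- Evaluation at a point, as a continuous linear map. -/
abbrev evalBcf (t : ℝ) : (ℝ →ᵇ ℂ) →L[ℂ] ℂ := BoundedContinuousFunction.evalCLM ℂ t

lemma truncExp_apply (M : ℝ) (z : ℂ) (t : ℝ) :
    truncExp M z t = Complex.exp (z * truncPhase M t) := by
  let e : (ℝ →ᵇ ℂ) →+* ℂ :=
    { toFun := fun κ => κ t
      map_one' := rfl
      map_mul' := fun _ _ => rfl
      map_zero' := rfl
      map_add' := fun _ _ => rfl }
  have h := NormedSpace.map_exp e (evalBcf t).continuous (z • truncPhase M)
  rw [← Complex.exp_eq_exp_ℂ] at h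
  exact h

lemma truncExp_apply_of_abs_le {M t : ℝ} (ht : |t| ≤ 2 * M) (z : ℂ) :
    truncExp M z t = Complex.exp (Complex.I * z * |t|) := by
  rw [truncExp_apply, truncPhase_apply_of_abs_le ht]
  ring_nf

lemma truncExp_zero (M : ℝ) : truncExp M 0 = 1 := by
  rw [truncExp, zero_smul, NormedSpace.exp_zero]

/-! ### The free resolvent in a single mode -/

/-- The truncated free resolvent in the mode `j`. -/
def truncFree (M : ℝ) (j : ℤ) (τ : ℂ) : L2 →L[ℂ] L2 :=
  (Complex.I / (2 * τ)) • truncConv M j (truncExp M τ)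

/-- The truncated free resolvent in the mode `j`, with its singular part at `τ = 0` removed. -/
def truncReg (M : ℝ) (j : ℤ) (z : ℂ) : L2 →L[ℂ] L2 :=
  (Complex.I / 2) • truncConv M j (dslope (truncExp M) 0 z)

lemma isModeOp_truncFree (M : ℝ) (j : ℤ) (τ : ℂ) : IsModeOp j (truncFree M j τ) :=
  (isModeOp_truncConv M j _).smul _

lemma isModeOp_truncReg (M : ℝ) (j : ℤ) (z : ℂ) : IsModeOp j (truncReg M j z) :=
  (isModeOp_truncConv M j _).smul _

/-- Writing `e^{iz|t|} = 1 + z · (e^{iz|t|} - 1)/z` isolates the pole at `z = 0`; the difference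
quotient is entire. -/
lemma truncFree_eq (M : ℝ) (j : ℤ) {z : ℂ} (hz : z ≠ 0) :
    truncFree M j z = (Complex.I / (2 * z)) • truncConv M j 1 + truncReg M j z := by
  have h := sub_smul_dslope (truncExp M) 0 z
  rw [sub_zero, truncExp_zero] at h
  have h2 : truncExp M z = 1 + z • dslope (truncExp M) 0 z := by rw [h]; abel
  rw [truncFree, truncReg, h2, map_add, smul_add, map_smul, smul_smul]
  congr 2
  field_simp

lemma differentiableAt_truncFree (M : ℝ) (j : ℤ) {τ : ℂ} (hτ : τ ≠ 0) :
    DifferentiableAt ℂ (truncFree M j) τ := by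
  have h1 : DifferentiableAt ℂ (fun τ : ℂ => Complex.I / (2 * τ)) τ :=
    (differentiableAt_const _).div (differentiableAt_id.const_mul 2) (by simpa using hτ)
  have h2 : DifferentiableAt ℂ (fun τ => truncConv M j (truncExp M τ)) τ :=
    (truncConv M j).differentiableAt.comp τ (differentiable_truncExp M τ)
  exact h1.smul h2

lemma differentiable_dslope_truncExp (M : ℝ) : Differentiable ℂ (dslope (truncExp M) 0) := by
  rw [← differentiableOn_univ, Complex.differentiableOn_dslope univ_mem]
  exact (differentiable_truncExp M).differentiableOn

lemma differentiable_truncReg (M : ℝ) (j : ℤ) : Differentiable ℂ (truncReg M j) := by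
  intro z
  have h : DifferentiableAt ℂ (fun z => truncConv M j (dslope (truncExp M) 0 z)) z :=
    (truncConv M j).differentiableAt.comp z (differentiable_dslope_truncExp M z)
  exact h.const_smul (Complex.I / 2)

/-- Compactness of the disc bounds the kernel. The mode enters only through the factor `e^{ijθ}/2π`
of `L¹` norm `1`, so the constant does not depend on `j`. -/
lemma exists_norm_truncReg_le (M r : ℝ) : ∃ c : ℝ, 0 ≤ c ∧ ∀ (j : ℤ) (z : ℂ), ‖z‖ ≤ r →
    ‖truncReg M j z‖ ≤ c := by
  obtain ⟨c, hc⟩ := (isCompact_closedBall (0 : ℂ) r).exists_bound_of_continuousOn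
    (differentiable_dslope_truncExp M).continuous.continuousOn
  refine ⟨volume.real (Set.Icc (-(2 * M)) (2 * M)) * |c|, by positivity, fun j z hz => ?_⟩
  have h1 : ‖dslope (truncExp M) 0 z‖ ≤ |c| :=
    (hc z (by simpa using hz)).trans (le_abs_self c)
  have h2 : ‖truncConv M j (dslope (truncExp M) 0 z)‖ ≤
      volume.real (Set.Icc (-(2 * M)) (2 * M)) * |c| :=
    (norm_truncConv_le M j _).trans (setIntegral_norm_bcf_le M fun t _ =>
      (BoundedContinuousFunction.norm_coe_le_norm _ t).trans h1)
  rw [truncReg, norm_smul]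
  have h3 : ‖Complex.I / 2‖ ≤ 1 := by simp; norm_num
  nlinarith [norm_nonneg (truncConv M j (dslope (truncExp M) 0 z))]

lemma cutoff_comp_smul (N : ℝ) (c : ℂ) (B : L2 →L[ℂ] L2) :
    cutoff N ∘L (c • B) ∘L cutoff N = c • (cutoff N ∘L B ∘L cutoff N) := by
  rw [ContinuousLinearMap.smul_comp, ContinuousLinearMap.comp_smul]

lemma cutoff_truncFree {N M : ℝ} (hNM : N ≤ M) (j : ℤ) (τ : ℂ) :
    cutoff N ∘L truncFree M j τ ∘L cutoff N = cutoff N ∘L truncFree N j τ ∘L cutoff N := by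
  rw [truncFree, truncFree, cutoff_comp_smul, cutoff_comp_smul]
  congr 1
  refine cutoff_truncConv_congr hNM j fun t ht => ?_
  rw [truncExp_apply_of_abs_le ht, truncExp_apply_of_abs_le (ht.trans (by linarith))]

lemma cutoff_truncReg {N M : ℝ} (hNM : N ≤ M) (j : ℤ) (z : ℂ) :
    cutoff N ∘L truncReg M j z ∘L cutoff N = cutoff N ∘L truncReg N j z ∘L cutoff N := by
  rw [truncReg, truncReg, cutoff_comp_smul, cutoff_comp_smul]
  congr 1
  refine cutoff_truncConv_congr hNM j fun t ht => ?_
  -- Evaluation at `t` is continuous and linear, hence commutes with the difference quotient.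
  have h1 : ∀ K : ℝ, dslope (truncExp K) 0 z t = dslope (evalBcf t ∘ truncExp K) 0 z := fun K =>
    ((evalBcf t).dslope_comp (truncExp K) 0 z fun _ => differentiable_truncExp K 0).symm
  have h2 : evalBcf t ∘ truncExp M = evalBcf t ∘ truncExp N := by
    ext w
    change truncExp M w t = truncExp N w t
    rw [truncExp_apply_of_abs_le ht, truncExp_apply_of_abs_le (ht.trans (by linarith))]
  rw [h1, h1, h2]

lemma cutoff_modeConv_outKernel (M : ℝ) (j : ℤ) {τ : ℂ} (hτ : 0 < τ.im) :
    cutoff M ∘L modeConv j (integrable_outKernel hτ).toL1 ∘L cutoff M =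
      cutoff M ∘L truncFree M j τ ∘L cutoff M := by
  have : truncFree M j τ = truncConv M j ((Complex.I / (2 * τ)) • truncExp M τ) := by
    rw [truncFree, map_smul]
  rw [this, truncConv_apply]
  refine cutoff_modeConv_congr j _ _ fun t ht => ?_
  have h1 : t ∈ Set.Icc (-(2 * M)) (2 * M) := abs_le.1 ht
  rw [Set.indicator_of_mem h1]
  change _ = (Complex.I / (2 * τ)) • truncExp M τ t
  rw [truncExp_apply_of_abs_le ht]
  rfl

lemma norm_truncFree_le {M : ℝ} (hM : 0 ≤ M) (j : ℤ) {τ : ℂ} (hτ : -1 ≤ τ.im) :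
    ‖truncFree M j τ‖ ≤ 2 * M * Real.exp (2 * M) / ‖τ‖ := by
  have h : ‖truncConv M j (truncExp M τ)‖ ≤ 4 * M * Real.exp (2 * M) := by
    refine norm_truncConv_le_of_bound hM j fun t ht => ?_
    rw [truncExp_apply_of_abs_le ht, Complex.norm_exp]
    refine Real.exp_le_exp.2 ?_
    simp
    nlinarith [abs_nonneg t]
  rw [truncFree, norm_smul, norm_div, Complex.norm_I, norm_mul, Complex.norm_ofNat]
  calc 1 / (2 * ‖τ‖) * ‖truncConv M j (truncExp M τ)‖
      ≤ 1 / (2 * ‖τ‖) * (4 * M * Real.exp (2 * M)) := by gcongr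
    _ = 2 * M * Real.exp (2 * M) / ‖τ‖ := by
      rcases eq_or_ne ‖τ‖ 0 with h0 | h0
      · simp [h0]
      · field_simp; ring

/-- For `Im τ > 0` the full `L¹` norm of the outgoing kernel is available. In the evanescent modes
it decays like `1/j²`, which makes the sum over modes converge; the bound by `1/‖τ‖` alone would not
suffice. -/
lemma norm_truncFree_le_of_im_pos (M : ℝ) (j : ℤ) {τ : ℂ} (hτ : 0 < τ.im) :
    ‖truncFree M j τ‖ ≤ 1 / (‖τ‖ * τ.im) := by
  have : truncFree M j τ = truncConv M j ((Complex.I / (2 * τ)) • truncExp M τ) := by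
    rw [truncFree, map_smul]
  rw [this, ← integral_norm_outKernel hτ]
  refine (norm_truncConv_le M j _).trans ?_
  refine le_trans (le_of_eq ?_) (setIntegral_le_integral (s := Set.Icc (-(2 * M)) (2 * M))
    (integrable_outKernel hτ).norm (ae_of_all _ fun t => norm_nonneg _))
  refine setIntegral_congr_fun measurableSet_Icc fun t ht => ?_
  simp only [BoundedContinuousFunction.coe_smul]
  rw [truncExp_apply_of_abs_le (abs_le.2 ht)]
  rfl

/-! ### Explicit matrix elements -/

/-- Fubini for a cut-off truncated convolution. -/
lemma inner_cutoff_truncConv (M : ℝ) (j : ℤ) (κ : ℝ →ᵇ ℂ) {f : X → ℂ} (hf : MemLp f 2) (h : L2) :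
    inner ℂ h (cutoff M (truncConv M j κ (cutoff M hf.toLp))) =
      ∫ p : X, (starRingEnd ℂ) (h p) * (band M p *
        ∫ q : X, κ (p.1 - q.1) * circleKernel j (p.2 - q.2) * (band M q * f q)) := by
  have hbf : MemLp (fun p => band M p * f p) 2 := by
    refine (Lp.memLp (cutoff M hf.toLp)).ae_eq ?_
    filter_upwards [coeFn_cutoff M hf.toLp, hf.coeFn_toLp] with p h1 h2
    rw [h1, h2]
  have hb : cutoff M hf.toLp = hbf.toLp := by
    apply Lp.ext
    filter_upwards [coeFn_cutoff M hf.toLp, hf.coeFn_toLp, hbf.coeFn_toLp] with p h1 h2 h3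
    rw [h1, h2, h3]
  rw [← inner_cutoff_left, hb, truncConv_apply, inner_modeConv_toLp]
  refine integral_congr_ae ?_
  filter_upwards [coeFn_cutoff M h] with p hp
  rw [hp, map_mul, conj_band, mul_comm (band M p), mul_assoc]
  congr 1
  rcases le_or_gt |p.1| M with hpM | hpM
  · congr 1
    rw [← integral_sub_left_eq_self _ volume p]
    refine integral_congr_ae (ae_of_all _ fun q => ?_)
    simp only [Prod.fst_sub, Prod.snd_sub, sub_sub_cancel]
    rcases le_or_gt |q.1| M with hqM | hqM
    · have : p.1 - q.1 ∈ Set.Icc (-(2 * M)) (2 * M) := by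
        refine abs_le.1 ((abs_sub _ _).trans ?_)
        linarith
      rw [Set.indicator_of_mem this]
    · simp [band_of_lt_abs hqM]
  · rw [band_of_lt_abs hpM, zero_mul, zero_mul]

/-- The normalized function `e^{ijθ} / √(2π)` on the circle, cut off to `|x| ≤ M`. -/
def waveFn (M : ℝ) (j : ℤ) (p : X) : ℂ := band M p * (expθ j p / (Real.sqrt (2 * Real.pi) : ℂ))

lemma sqrt_two_pi_sq : (Real.sqrt (2 * Real.pi) : ℂ) * (Real.sqrt (2 * Real.pi) : ℂ) =
    2 * Real.pi := by
  rw [← Complex.ofReal_mul, Real.mul_self_sqrt Real.two_pi_pos.le]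
  push_cast
  rfl

lemma sqrt_two_pi_ne_zero : (Real.sqrt (2 * Real.pi) : ℂ) ≠ 0 := by
  exact_mod_cast (Real.sqrt_pos.2 Real.two_pi_pos).ne'

/-- Bounded functions supported in `|x| ≤ M` are square integrable. -/
lemma memLp_two_band_mul (M : ℝ) {g : X → ℂ} (hg : Measurable g) {c : ℝ} (hc : ∀ p, ‖g p‖ ≤ c) :
    MemLp (fun p => band M p * g p) 2 := by
  set S : Set X := Set.Icc (-M) M ×ˢ Set.univ
  have hS : MeasurableSet S := measurableSet_Icc.prod .univ
  have hfin : IsFiniteMeasure ((volume : Measure X).restrict S) :=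
    ⟨by simpa using (isCompact_Icc.prod isCompact_univ).measure_lt_top⟩
  have h : (fun p => band M p * g p) = S.indicator g := by
    ext p
    rcases le_or_gt |p.1| M with hp | hp
    · have : p ∈ S := ⟨abs_le.1 hp, trivial⟩
      rw [band_of_abs_le hp, one_mul, Set.indicator_of_mem this]
    · have : p ∉ S := fun hm => hp.not_ge (abs_le.2 hm.1)
      rw [band_of_lt_abs hp, zero_mul, Set.indicator_of_notMem this]
  rw [h, memLp_indicator_iff_restrict hS]
  exact MemLp.of_bound hg.aestronglyMeasurable c (ae_of_all _ hc)

lemma memLp_waveFn (M : ℝ) (j : ℤ) : MemLp (waveFn M j) 2 :=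
  memLp_two_band_mul M ((continuous_expθ j).measurable.div_const _)
    (fun p => by rw [norm_div, norm_expθ])

/-- `waveFn` as an element of `L²(X)`. -/
def wave (M : ℝ) (j : ℤ) : L2 := (memLp_waveFn M j).toLp

lemma coeFn_wave (M : ℝ) (j : ℤ) : wave M j =ᵐ[volume] waveFn M j := (memLp_waveFn M j).coeFn_toLp

lemma cutoff_wave {N M : ℝ} (h : N ≤ M) (j : ℤ) : cutoff N (wave M j) = wave N j := by
  apply Lp.ext
  filter_upwards [coeFn_cutoff N (wave M j), coeFn_wave M j, coeFn_wave N j] with p h1 h2 h3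
  rw [h1, h2, h3, waveFn, waveFn, ← mul_assoc, band_mul_band h]

lemma shiftMode_wave (M : ℝ) (j k : ℤ) : shiftMode k (wave M j) = wave M (j + k) := by
  apply Lp.ext
  filter_upwards [coeFn_mulOp_toLp (memLp_expθ k) (wave M j), coeFn_wave M j,
    coeFn_wave M (j + k)] with p h1 h2 h3
  rw [shiftMode, h1, h2, h3, waveFn, waveFn, expθ, expθ, expθ, fourier_add]
  ring

lemma potentialOp_wave {M : ℝ} (hM : 1 ≤ M) (j : ℤ) :
    potentialOp (wave M j) = wave 1 (j + 1) + wave 1 (j - 1) := by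
  rw [potentialOp_eq, shiftMode_wave, shiftMode_wave, cutoff_wave hM, cutoff_wave hM,
    sub_eq_add_neg]

lemma wave_mem_mode (M : ℝ) (j : ℤ) : wave M j ∈ mode j := by
  intro s
  apply Lp.ext
  filter_upwards [coeFn_trans (0, s) (wave M j), ae_sub_right (coeFn_wave M j) (0, s),
    coeFn_wave M j, Lp.coeFn_smul (fourier (-j) s) (wave M j)] with p h1 h2 h3 h4
  rw [h1, h2, h4, Pi.smul_apply, h3, waveFn, waveFn, expθ_sub, smul_eq_mul]
  have : band M (p - (0, s)) = band M p := by simp [band]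
  rw [this]
  ring

lemma circleKernel_sub_eq (j : ℤ) (p q : X) : circleKernel j (p.2 - q.2) =
    expθ j p / (Real.sqrt (2 * Real.pi) : ℂ) *
      (starRingEnd ℂ) (expθ j q / (Real.sqrt (2 * Real.pi) : ℂ)) := by
  rw [circleKernel_sub, circleKernel, fourier_neg, map_div₀, Complex.conj_ofReal, ← sqrt_two_pi_sq]
  simp only [expθ]
  field_simp

/-- The singular part of the truncated free resolvent has rank one. -/
lemma cutoff_truncConv_one (M : ℝ) (j : ℤ) (f : L2) :
    cutoff M (truncConv M j 1 (cutoff M f)) = (inner ℂ (wave M j) f : ℂ) • wave M j := by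
  refine ext_inner_left ℂ fun h => ?_
  conv_lhs => rw [← Lp.toLp_coeFn f (Lp.memLp f)]
  rw [inner_cutoff_truncConv, inner_smul_right, L2.inner_def, L2.inner_def, ← integral_const_mul]
  refine integral_congr_ae ?_
  filter_upwards [coeFn_wave M j] with p hp
  rw [hp, RCLike.inner_apply, waveFn, mul_comm (starRingEnd ℂ (h p)), ← mul_assoc]
  congr 1
  rw [mul_left_comm]
  congr 1
  rw [← integral_mul_const]
  refine integral_congr_ae ?_
  filter_upwards [coeFn_wave M j] with q hq
  rw [hq, RCLike.inner_apply, circleKernel_sub_eq, waveFn, map_mul, conj_band,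
    BoundedContinuousFunction.coe_one, Pi.one_apply]
  ring

lemma integral_wave_mul {g : ℝ → ℂ} (j : ℤ) :
    ∫ p : X, (starRingEnd ℂ) (waveFn 1 j p) * (g p.1 * waveFn 1 j p) =
      ∫ x in Set.Icc (-1 : ℝ) 1, g x := by
  have h1 : ∀ p : X, (starRingEnd ℂ) (waveFn 1 j p) * (g p.1 * waveFn 1 j p) =
      (Set.Icc (-1 : ℝ) 1).indicator g p.1 * (2 * (Real.pi : ℂ))⁻¹ := by
    intro p
    have h2 : (starRingEnd ℂ) (expθ j p) * expθ j p = 1 := by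
      rw [Complex.conj_mul', norm_expθ]
      simp
    rw [waveFn, map_mul, conj_band, map_div₀, Complex.conj_ofReal, ← sqrt_two_pi_sq]
    rcases le_or_gt |p.1| 1 with hp | hp
    · have : p.1 ∈ Set.Icc (-1 : ℝ) 1 := abs_le.1 hp
      rw [band_of_abs_le hp, Set.indicator_of_mem this]
      have := sqrt_two_pi_ne_zero
      field_simp
      linear_combination g p.1 * h2
    · have : p.1 ∉ Set.Icc (-1 : ℝ) 1 := fun hm => hp.not_ge (abs_le.2 hm)
      rw [band_of_lt_abs hp, Set.indicator_of_notMem this]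
      simp
  simp only [h1]
  rw [Measure.volume_eq_prod, integral_prod_mul (fun x => (Set.Icc (-1 : ℝ) 1).indicator g x)
    (fun _ : AddCircle (2 * Real.pi) => (2 * (Real.pi : ℂ))⁻¹), integral_indicator measurableSet_Icc]
  rw [integral_const, measureReal_def, AddCircle.measure_univ,
    ENNReal.toReal_ofReal Real.two_pi_pos.le, Complex.real_smul]
  push_cast
  rw [mul_inv_cancel₀, mul_one]
  exact mul_ne_zero two_ne_zero (by exact_mod_cast Real.pi_pos.ne')

lemma norm_wave_one_le (j : ℤ) : ‖wave 1 j‖ ≤ 2 := by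
  have h : inner ℂ (wave 1 j) (wave 1 j) = (2 : ℂ) := by
    have h1 := integral_wave_mul (g := fun _ => 1) j
    simp only [one_mul] at h1
    rw [L2.inner_def]
    rw [setIntegral_const, Real.volume_real_Icc_of_le (by norm_num)] at h1
    refine Eq.trans (integral_congr_ae ?_) (h1.trans (by norm_num))
    filter_upwards [coeFn_wave 1 j] with p hp
    rw [hp, RCLike.inner_apply, mul_comm]
  rw [inner_self_eq_norm_sq_to_K] at h
  have h2 : ‖wave 1 j‖ ^ 2 = 2 := by
    refine Complex.ofReal_injective ?_
    push_cast
    exact h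
  nlinarith [norm_nonneg (wave 1 j)]

/-! ### The free resolvent on constant profiles -/

/-- The solution `u` of `-u'' - τ² u = 1` on `[-1, 1]` that is outgoing outside. -/
def profile (τ : ℂ) (x : ℝ) : ℂ :=
  -(1 / τ ^ 2) * (1 - (Complex.exp (Complex.I * τ * (1 + x)) +
    Complex.exp (Complex.I * τ * (1 - x))) / 2)

lemma continuous_profile (τ : ℂ) : Continuous (profile τ) := by
  unfold profile; fun_prop

lemma integral_exp_mul_real {c : ℂ} (hc : c ≠ 0) (a b : ℝ) :
    ∫ t in a..b, Complex.exp (c * t) = (Complex.exp (c * b) - Complex.exp (c * a)) / c :=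
  integral_exp_mul_complex hc

lemma integral_outKernel_Icc {τ : ℂ} (hτ : τ ≠ 0) {x : ℝ} (hx : |x| ≤ 1) :
    ∫ y in Set.Icc (-1 : ℝ) 1, outKernel τ (x - y) = profile τ x := by
  obtain ⟨h1, h2⟩ := abs_le.1 hx
  have hI : Complex.I * τ ≠ 0 := mul_ne_zero Complex.I_ne_zero hτ
  have hcont : Continuous fun y => outKernel τ (x - y) :=
    (continuous_outKernel τ).comp (by fun_prop)
  rw [integral_Icc_eq_integral_Ioc, ← intervalIntegral.integral_of_le (by norm_num),
    ← intervalIntegral.integral_add_adjacent_intervals (b := x) (hcont.intervalIntegrable _ _)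
      (hcont.intervalIntegrable _ _)]
  have hl : ∫ y in (-1 : ℝ)..x, outKernel τ (x - y) =
      ∫ y in (-1 : ℝ)..x, Complex.I / (2 * τ) * Complex.exp (Complex.I * τ * x) *
        Complex.exp (-(Complex.I * τ) * y) := by
    refine intervalIntegral.integral_congr fun y hy => ?_
    rw [Set.uIcc_of_le h1] at hy
    simp only [outKernel]
    rw [abs_of_nonneg (by linarith [hy.2]), mul_assoc (Complex.I / (2 * τ)), ← Complex.exp_add]
    push_cast
    ring_nf
  have hr : ∫ y in x..(1 : ℝ), outKernel τ (x - y) =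
      ∫ y in x..(1 : ℝ), Complex.I / (2 * τ) * Complex.exp (-(Complex.I * τ * x)) *
        Complex.exp (Complex.I * τ * y) := by
    refine intervalIntegral.integral_congr fun y hy => ?_
    rw [Set.uIcc_of_le h2] at hy
    simp only [outKernel]
    rw [abs_of_nonpos (by linarith [hy.1]), mul_assoc (Complex.I / (2 * τ)), ← Complex.exp_add]
    push_cast
    ring_nf
  rw [hl, hr, intervalIntegral.integral_const_mul, intervalIntegral.integral_const_mul,
    integral_exp_mul_real (neg_ne_zero.2 hI), integral_exp_mul_real hI, profile]
  have e1 : Complex.exp (Complex.I * τ * x) * Complex.exp (-(Complex.I * τ) * x) = 1 := by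
    rw [← Complex.exp_add]; ring_nf; simp
  have e2 : Complex.exp (Complex.I * τ * x) * Complex.exp (-(Complex.I * τ) * (-1 : ℝ)) =
      Complex.exp (Complex.I * τ * (1 + x)) := by
    rw [← Complex.exp_add]; push_cast; ring_nf
  have e3 : Complex.exp (-(Complex.I * τ * x)) * Complex.exp (Complex.I * τ * (1 : ℝ)) =
      Complex.exp (Complex.I * τ * (1 - x)) := by
    rw [← Complex.exp_add]; push_cast; ring_nf
  have e4 : Complex.exp (-(Complex.I * τ * x)) * Complex.exp (Complex.I * τ * x) = 1 := by
    rw [← Complex.exp_add]; ring_nf; simp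
  calc _ = Complex.I / (2 * τ) / -(Complex.I * τ) *
        (Complex.exp (Complex.I * τ * x) * Complex.exp (-(Complex.I * τ) * x) -
          Complex.exp (Complex.I * τ * x) * Complex.exp (-(Complex.I * τ) * (-1 : ℝ))) +
      Complex.I / (2 * τ) / (Complex.I * τ) *
        (Complex.exp (-(Complex.I * τ * x)) * Complex.exp (Complex.I * τ * (1 : ℝ)) -
          Complex.exp (-(Complex.I * τ * x)) * Complex.exp (Complex.I * τ * x)) := by ring
    _ = _ := by
      rw [e1, e2, e3, e4]
      field_simp
      ring

lemma integral_profile {τ : ℂ} (hτ : τ ≠ 0) : ∫ x in Set.Icc (-1 : ℝ) 1, profile τ x =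
    -2 / τ ^ 2 + Complex.I * (1 - Complex.exp (2 * Complex.I * τ)) / τ ^ 3 := by
  have hI : Complex.I * τ ≠ 0 := mul_ne_zero Complex.I_ne_zero hτ
  have h : ∀ x : ℝ, HasDerivAt (fun x : ℝ => -(1 / τ ^ 2) * (x -
      (Complex.exp (Complex.I * τ * (1 + x)) - Complex.exp (Complex.I * τ * (1 - x))) /
        (2 * (Complex.I * τ)))) (profile τ x) x := by
    intro x
    have h0 : HasDerivAt (fun x : ℝ => (x : ℂ)) 1 x := (hasDerivAt_id x).ofReal_comp
    have h1 := ((h0.const_add 1).const_mul (Complex.I * τ)).cexp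
    have h2 := ((h0.const_sub 1).const_mul (Complex.I * τ)).cexp
    refine ((h0.sub ((h1.sub h2).div_const (2 * (Complex.I * τ)))).const_mul
      (-(1 / τ ^ 2))).congr_deriv ?_
    rw [profile]
    field_simp
    ring
  rw [integral_Icc_eq_integral_Ioc, ← intervalIntegral.integral_of_le (by norm_num),
    intervalIntegral.integral_eq_sub_of_hasDerivAt (fun x _ => h x)
      ((continuous_profile τ).intervalIntegrable _ _)]
  have e1 : Complex.I * τ * (1 + ((1 : ℝ) : ℂ)) = 2 * Complex.I * τ := by push_cast; ring
  have e2 : Complex.I * τ * (1 - ((-1 : ℝ) : ℂ)) = 2 * Complex.I * τ := by push_cast; ring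
  have e3 : Complex.I * τ * (1 - ((1 : ℝ) : ℂ)) = 0 := by push_cast; ring
  have e4 : Complex.I * τ * (1 + ((-1 : ℝ) : ℂ)) = 0 := by push_cast; ring
  rw [e1, e2, e3, e4, Complex.exp_zero]
  push_cast
  field_simp
  ring_nf
  simp only [Complex.I_sq]
  ring

/-- On a constant the resolvent gains `1/‖τ‖²` instead of the generic `1/‖τ‖`, that is `1/l` instead
of `l^{-1/2}` near the threshold. The constant comes from `0 ≤ 1 ± x ≤ 2` and `Im τ ≥ -1`. -/
lemma norm_profile_le {τ : ℂ} (hτ : -1 ≤ τ.im) {x : ℝ} (hx : |x| ≤ 1) :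
    ‖profile τ x‖ ≤ (1 + Real.exp 2) / ‖τ‖ ^ 2 := by
  obtain ⟨h1, h2⟩ := abs_le.1 hx
  have he : ∀ y : ℝ, 0 ≤ y → y ≤ 2 → ‖Complex.exp (Complex.I * τ * y)‖ ≤ Real.exp 2 := by
    intro y hy hy2
    rw [Complex.norm_exp]
    refine Real.exp_le_exp.2 ?_
    simp
    nlinarith
  have e1 := he (1 + x) (by linarith) (by linarith)
  have e2 := he (1 - x) (by linarith) (by linarith)
  push_cast at e1 e2
  rw [profile, norm_mul, norm_neg, norm_div, norm_one, norm_pow, one_div,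
    div_eq_inv_mul (1 + Real.exp 2)]
  refine mul_le_mul_of_nonneg_left ?_ (by positivity)
  refine (norm_sub_le _ _).trans ?_
  rw [norm_one, norm_div, Complex.norm_ofNat]
  have := norm_add_le (Complex.exp (Complex.I * τ * (1 + x))) (Complex.exp (Complex.I * τ * (1 - x)))
  linarith

lemma memLp_profile_mul_waveFn (τ : ℂ) (j : ℤ) : MemLp (fun p => profile τ p.1 * waveFn 1 j p) 2 := by
  obtain ⟨c, hc⟩ := (isCompact_Icc (a := (-1 : ℝ)) (b := 1)).exists_bound_of_continuousOn
    (continuous_profile τ).continuousOn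
  have h0 : 0 ≤ c := (norm_nonneg _).trans (hc 0 ⟨by norm_num, by norm_num⟩)
  refine MemLp.of_le_mul (c := c) (memLp_waveFn 1 j) ?_ (ae_of_all _ fun p => ?_)
  · exact ((continuous_profile τ).comp continuous_fst).aestronglyMeasurable.mul
      (memLp_waveFn 1 j).aestronglyMeasurable
  · rcases le_or_gt |p.1| 1 with hp | hp
    · rw [norm_mul]
      exact mul_le_mul_of_nonneg_right (hc p.1 (abs_le.1 hp)) (norm_nonneg _)
    · simp [waveFn, band_of_lt_abs hp]

lemma cutoff_truncFree_wave {τ : ℂ} (hτ : τ ≠ 0) (j : ℤ) :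
    cutoff 1 (truncFree 1 j τ (cutoff 1 (wave 1 j))) = (memLp_profile_mul_waveFn τ j).toLp := by
  refine ext_inner_left ℂ fun h => ?_
  rw [truncFree, smul_apply, map_smul, inner_smul_right, wave,
    inner_cutoff_truncConv, L2.inner_def, ← integral_const_mul]
  refine integral_congr_ae ?_
  filter_upwards [(memLp_profile_mul_waveFn τ j).coeFn_toLp] with p hp
  rw [hp, RCLike.inner_apply]
  rcases le_or_gt |p.1| 1 with hpM | hpM
  swap
  · simp [waveFn, band_of_lt_abs hpM]
  have hint : ∫ q : X, truncExp 1 τ (p.1 - q.1) * circleKernel j (p.2 - q.2) *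
      (band 1 q * waveFn 1 j q) = expθ j p / (Real.sqrt (2 * Real.pi) : ℂ) *
        ∫ y in Set.Icc (-1 : ℝ) 1, Complex.exp (Complex.I * τ * |p.1 - y|) := by
    rw [← integral_wave_mul j, ← integral_const_mul]
    refine integral_congr_ae (ae_of_all _ fun q => ?_)
    simp only
    rcases le_or_gt |q.1| 1 with hq | hq
    · have : |p.1 - q.1| ≤ 2 * 1 := (abs_sub _ _).trans (by linarith)
      rw [truncExp_apply_of_abs_le this, circleKernel_sub_eq, waveFn, map_mul, conj_band,
        band_of_abs_le hq]
      ring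
    · simp [waveFn, band_of_lt_abs hq]
  rw [hint, ← integral_outKernel_Icc hτ hpM, waveFn]
  simp only [outKernel]
  rw [integral_const_mul]
  ring

lemma norm_toLp_profile_le {τ : ℂ} (hτ : -1 ≤ τ.im) (j : ℤ) :
    ‖(memLp_profile_mul_waveFn τ j).toLp‖ ≤ 2 * (1 + Real.exp 2) / ‖τ‖ ^ 2 := by
  have h : ‖(memLp_profile_mul_waveFn τ j).toLp‖ ≤ (1 + Real.exp 2) / ‖τ‖ ^ 2 * ‖wave 1 j‖ := by
    refine Lp.norm_le_mul_norm_of_ae_le_mul ?_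
    filter_upwards [(memLp_profile_mul_waveFn τ j).coeFn_toLp, coeFn_wave 1 j] with p h1 h2
    rw [h1, h2, norm_mul]
    rcases le_or_gt |p.1| 1 with hp | hp
    · exact mul_le_mul_of_nonneg_right (norm_profile_le hτ hp) (norm_nonneg _)
    · simp [waveFn, band_of_lt_abs hp]
  refine h.trans ?_
  calc _ ≤ (1 + Real.exp 2) / ‖τ‖ ^ 2 * 2 := by
        exact mul_le_mul_of_nonneg_left (norm_wave_one_le j) (by positivity)
    _ = _ := by ring

lemma inner_wave_truncFree_wave {τ : ℂ} (hτ : τ ≠ 0) (j : ℤ) :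
    inner ℂ (wave 1 j) (cutoff 1 (truncFree 1 j τ (cutoff 1 (wave 1 j)))) =
      -2 / τ ^ 2 + Complex.I * (1 - Complex.exp (2 * Complex.I * τ)) / τ ^ 3 := by
  rw [cutoff_truncFree_wave hτ, ← integral_profile hτ, ← integral_wave_mul j, L2.inner_def]
  refine integral_congr_ae ?_
  filter_upwards [(memLp_profile_mul_waveFn τ j).coeFn_toLp, coeFn_wave 1 j] with p h1 h2
  rw [h1, h2, RCLike.inner_apply, mul_comm]

/-- Passing to the adjoint reflects `τ` in the imaginary axis. Modulus and imaginary part are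
unchanged, so estimates for the operator also serve its adjoint. -/
lemma adjoint_truncFree (M : ℝ) (j : ℤ) (τ : ℂ) :
    cutoff M ∘L ContinuousLinearMap.adjoint (truncFree M j τ) ∘L cutoff M =
      cutoff M ∘L truncFree M j (-(starRingEnd ℂ) τ) ∘L cutoff M := by
  have h1 : truncFree M j τ = modeConv j (integrable_indicator_bcf M
      ((Complex.I / (2 * τ)) • truncExp M τ)).toL1 := by
    rw [truncFree, ← map_smul]; rfl
  have h2 : truncFree M j (-(starRingEnd ℂ) τ) = modeConv j (integrable_indicator_bcf M
      ((Complex.I / (2 * (-(starRingEnd ℂ) τ))) • truncExp M (-(starRingEnd ℂ) τ))).toL1 := by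
    rw [truncFree, ← map_smul]; rfl
  rw [h1, h2, adjoint_modeConv j _ (integrable_conj_neg (integrable_indicator_bcf M _))]
  refine cutoff_modeConv_congr j _ _ fun t ht => ?_
  have ht1 : t ∈ Set.Icc (-(2 * M)) (2 * M) := abs_le.1 ht
  have ht2 : -t ∈ Set.Icc (-(2 * M)) (2 * M) := abs_le.1 (by rwa [abs_neg])
  rw [Set.indicator_of_mem ht1, Set.indicator_of_mem ht2]
  change (starRingEnd ℂ) ((Complex.I / (2 * τ)) * truncExp M τ (-t)) =
    (Complex.I / (2 * (-(starRingEnd ℂ) τ))) * truncExp M (-(starRingEnd ℂ) τ) t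
  rw [truncExp_apply_of_abs_le ht, truncExp_apply_of_abs_le (by rwa [abs_neg]), map_mul, map_div₀,
    map_mul, Complex.conj_I, Complex.conj_ofNat, ← Complex.exp_conj, map_mul, map_mul,
    Complex.conj_I, Complex.conj_ofReal, abs_neg]
  congr 1
  · rw [mul_neg, div_neg, neg_div]
  · ring_nf

/-! ### Branches of the square roots near a threshold -/

/-- The principal square root. -/
def csqrt (w : ℂ) : ℂ := w ^ (((2 : ℕ) : ℂ)⁻¹)

lemma csqrt_sq (w : ℂ) : csqrt w ^ 2 = w := Complex.cpow_nat_inv_pow w two_ne_zero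

lemma csqrt_re_pos {w : ℂ} (hw : 0 < w.re) : 0 < (csqrt w).re := by
  have h0 : w ≠ 0 := fun h => by simp [h] at hw
  have hre : (Complex.log w * ((2 : ℕ) : ℂ)⁻¹).im = w.arg / 2 := by
    have : ((2 : ℕ) : ℂ)⁻¹ = ((2⁻¹ : ℝ) : ℂ) := by push_cast; rfl
    rw [this, Complex.im_mul_ofReal, Complex.log_im]
    ring
  have harg := abs_lt.1 (Complex.abs_arg_lt_pi_div_two_iff.2 (Or.inl hw))
  rw [csqrt, Complex.cpow_def_of_ne_zero h0, Complex.exp_re, hre]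
  refine mul_pos (Real.exp_pos _) (Real.cos_pos_of_mem_Ioo ⟨?_, ?_⟩) <;>
    linarith [harg.1, harg.2, Real.pi_pos]

lemma differentiableAt_csqrt {w : ℂ} (hw : 0 < w.re) : DifferentiableAt ℂ csqrt w :=
  differentiableAt_id.cpow_const (Or.inl hw)

/-- The function `τ_j` in terms of `z = τ_l`, for `z` near `0`. -/
def branch (l j : ℕ) (z : ℂ) : ℂ :=
  if j = l then z else if j < l then csqrt (z ^ 2 + ((l : ℂ) ^ 2 - (j : ℂ) ^ 2))
    else Complex.I * csqrt (-(z ^ 2 + ((l : ℂ) ^ 2 - (j : ℂ) ^ 2)))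

lemma branch_self (l : ℕ) (z : ℂ) : branch l l z = z := by simp [branch]

lemma branch_of_lt {l j : ℕ} (h : j < l) (z : ℂ) :
    branch l j z = csqrt (z ^ 2 + ((l : ℂ) ^ 2 - (j : ℂ) ^ 2)) := by
  rw [branch, if_neg h.ne, if_pos h]

lemma branch_of_gt {l j : ℕ} (h : l < j) (z : ℂ) :
    branch l j z = Complex.I * csqrt (-(z ^ 2 + ((l : ℂ) ^ 2 - (j : ℂ) ^ 2))) := by
  rw [branch, if_neg h.ne', if_neg h.not_gt]

lemma branch_sq (l j : ℕ) (z : ℂ) : branch l j z ^ 2 = z ^ 2 + ((l : ℂ) ^ 2 - (j : ℂ) ^ 2) := by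
  rcases lt_trichotomy j l with h | rfl | h
  · rw [branch_of_lt h, csqrt_sq]
  · rw [branch_self]; ring
  · rw [branch_of_gt h, mul_pow, csqrt_sq, Complex.I_sq]; ring

lemma abs_re_sq_le (z : ℂ) : |(z ^ 2).re| ≤ ‖z‖ ^ 2 := by
  rw [← norm_pow]; exact Complex.abs_re_le_norm _

lemma abs_im_sq_le (z : ℂ) : |(z ^ 2).im| ≤ ‖z‖ ^ 2 := by
  rw [← norm_pow]; exact Complex.abs_im_le_norm _

lemma re_add_sq_sub_sq (w : ℂ) (l j : ℕ) :
    (w + ((l : ℂ) ^ 2 - (j : ℂ) ^ 2)).re = w.re + ((l : ℝ) ^ 2 - (j : ℝ) ^ 2) := by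
  have : ((l : ℂ) ^ 2 - (j : ℂ) ^ 2) = (((l : ℝ) ^ 2 - (j : ℝ) ^ 2 : ℝ) : ℂ) := by push_cast; rfl
  rw [this, Complex.add_re, Complex.ofReal_re]

lemma im_add_sq_sub_sq (w : ℂ) (l j : ℕ) : (w + ((l : ℂ) ^ 2 - (j : ℂ) ^ 2)).im = w.im := by
  have : ((l : ℂ) ^ 2 - (j : ℂ) ^ 2) = (((l : ℝ) ^ 2 - (j : ℝ) ^ 2 : ℝ) : ℂ) := by push_cast; rfl
  rw [this, Complex.add_im, Complex.ofReal_im, add_zero]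

lemma sq_sub_sq_of_lt {l j : ℕ} (h : j < l) : 2 * (l : ℝ) - 1 ≤ (l : ℝ) ^ 2 - (j : ℝ) ^ 2 := by
  have h1 : (j : ℝ) + 1 ≤ l := by exact_mod_cast h
  have h2 : (0 : ℝ) ≤ j := Nat.cast_nonneg j
  nlinarith

lemma sq_sub_sq_of_gt {l j : ℕ} (h : l < j) : 2 * (l : ℝ) - 1 ≤ (j : ℝ) ^ 2 - (l : ℝ) ^ 2 := by
  have h1 : (l : ℝ) + 1 ≤ j := by exact_mod_cast h
  have h2 : (0 : ℝ) ≤ l := Nat.cast_nonneg l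
  nlinarith

/-- Quantitative information on square roots with positive real part. -/
lemma sqrt_bounds {τ w : ℂ} (hτ : τ ^ 2 = w) {n : ℝ} (hn : |w.re - n| ≤ 100) (hi : |w.im| ≤ 100)
    (h : 19999 ≤ n) : n / 2 ≤ ‖τ‖ ^ 2 ∧ ‖τ‖ ^ 2 ≤ 2 * τ.re ^ 2 ∧ |τ.im| * |τ.re| ≤ 50 := by
  have h1 : τ.re ^ 2 - τ.im ^ 2 = w.re := by rw [← hτ, sq τ, Complex.mul_re]; ring
  have h2 : 2 * (τ.re * τ.im) = w.im := by rw [← hτ, sq τ, Complex.mul_im]; ring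
  have h3 : ‖τ‖ ^ 2 = τ.re ^ 2 + τ.im ^ 2 := by rw [Complex.sq_norm, Complex.normSq_apply]; ring
  have h4 := abs_le.1 hn
  refine ⟨by nlinarith [sq_nonneg τ.im], by nlinarith, ?_⟩
  rw [← abs_mul, mul_comm]
  have : |2 * (τ.re * τ.im)| ≤ 100 := by rwa [h2]
  rw [abs_mul, abs_two] at this
  linarith

lemma norm_sq_le_hundred {z : ℂ} (hz : ‖z‖ < 10) : ‖z‖ ^ 2 ≤ 100 := by
  nlinarith [norm_nonneg z]

/-- Here `|z²| ≤ 100`, while the gap `l² - j²` is at least `2l - 1 ≥ 19999`. So `τ²` is close to a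
large positive number: `|Re τ|` exceeds `50`, and `|Re τ||Im τ| ≤ 50` then forces `|Im τ| ≤ 1`. -/
lemma root_bounds_of_lt {l j : ℕ} (hl : 10000 ≤ l) {z τ : ℂ} (hz : ‖z‖ < 10) (h : j < l)
    (hτ : τ ^ 2 = z ^ 2 + ((l : ℂ) ^ 2 - (j : ℂ) ^ 2)) :
    ((l : ℝ) ^ 2 - (j : ℝ) ^ 2) / 2 ≤ ‖τ‖ ^ 2 ∧ 2500 < τ.re ^ 2 ∧ |τ.im| ≤ 1 := by
  have hl' : (10000 : ℝ) ≤ l := by exact_mod_cast hl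
  have hn := sq_sub_sq_of_lt h
  have h2 := norm_sq_le_hundred hz
  obtain ⟨h3, h4, h5⟩ := sqrt_bounds hτ (n := (l : ℝ) ^ 2 - (j : ℝ) ^ 2)
    (by rw [re_add_sq_sub_sq, add_sub_cancel_right]; exact (abs_re_sq_le z).trans h2)
    (by rw [im_add_sq_sub_sq]; exact (abs_im_sq_le z).trans h2) (by linarith)
  have h6 : 2500 < τ.re ^ 2 := by linarith
  refine ⟨h3, h6, ?_⟩
  have h7 : 50 ≤ |τ.re| := by
    rw [← sq_abs] at h6
    nlinarith [abs_nonneg τ.re]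
  nlinarith [abs_nonneg τ.im]

lemma root_bounds_of_gt {l j : ℕ} (hl : 10000 ≤ l) {z τ : ℂ} (hz : ‖z‖ < 10) (h : l < j)
    (hτ : τ ^ 2 = z ^ 2 + ((l : ℂ) ^ 2 - (j : ℂ) ^ 2)) :
    ((j : ℝ) ^ 2 - (l : ℝ) ^ 2) / 2 ≤ ‖τ‖ ^ 2 ∧ 2500 < τ.im ^ 2 ∧ ‖τ‖ ^ 2 ≤ 2 * τ.im ^ 2 ∧
      |τ.re| ≤ 1 := by
  have hl' : (10000 : ℝ) ≤ l := by exact_mod_cast hl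
  have hn := sq_sub_sq_of_gt h
  have h2 := norm_sq_le_hundred hz
  have hre : (Complex.I * τ).re = -τ.im := by simp
  have him : (Complex.I * τ).im = τ.re := by simp
  have hno : ‖Complex.I * τ‖ = ‖τ‖ := by simp
  -- Multiplication by `i` exchanges evanescent and propagating modes, so the same bounds apply with
  -- real and imaginary parts interchanged.
  have hw : (Complex.I * τ) ^ 2 = -(z ^ 2 + ((l : ℂ) ^ 2 - (j : ℂ) ^ 2)) := by
    rw [mul_pow, hτ, Complex.I_sq]; ring
  obtain ⟨h3, h4, h5⟩ := sqrt_bounds hw (n := (j : ℝ) ^ 2 - (l : ℝ) ^ 2)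
    (by
      rw [Complex.neg_re, re_add_sq_sub_sq]
      have : -((z ^ 2).re + ((l : ℝ) ^ 2 - (j : ℝ) ^ 2)) - ((j : ℝ) ^ 2 - (l : ℝ) ^ 2) =
        -(z ^ 2).re := by ring
      rw [this, abs_neg]
      exact (abs_re_sq_le z).trans h2)
    (by rw [Complex.neg_im, abs_neg, im_add_sq_sub_sq]; exact (abs_im_sq_le z).trans h2)
    (by linarith)
  rw [hre, neg_sq, hno] at h4
  rw [hno] at h3
  rw [hre, him, abs_neg] at h5
  have h6 : 2500 < τ.im ^ 2 := by linarith
  refine ⟨h3, h6, h4, ?_⟩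
  have h7 : 50 ≤ |τ.im| := by
    rw [← sq_abs] at h6
    nlinarith [abs_nonneg τ.im]
  nlinarith [abs_nonneg τ.re]

lemma radicand_re_pos {l j : ℕ} (hl : 10000 ≤ l) {z : ℂ} (hz : ‖z‖ < 10) (h : j < l) :
    0 < (z ^ 2 + ((l : ℂ) ^ 2 - (j : ℂ) ^ 2)).re := by
  have hl' : (10000 : ℝ) ≤ l := by exact_mod_cast hl
  rw [re_add_sq_sub_sq]
  linarith [sq_sub_sq_of_lt h, (abs_le.1 (abs_re_sq_le z)).1, norm_sq_le_hundred hz]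

lemma neg_radicand_re_pos {l j : ℕ} (hl : 10000 ≤ l) {z : ℂ} (hz : ‖z‖ < 10) (h : l < j) :
    0 < (-(z ^ 2 + ((l : ℂ) ^ 2 - (j : ℂ) ^ 2))).re := by
  have hl' : (10000 : ℝ) ≤ l := by exact_mod_cast hl
  rw [Complex.neg_re, re_add_sq_sub_sq]
  linarith [sq_sub_sq_of_gt h, (abs_le.1 (abs_re_sq_le z)).2, norm_sq_le_hundred hz]

lemma branch_re_pos {l j : ℕ} (hl : 10000 ≤ l) {z : ℂ} (hz : ‖z‖ < 10) (h : j < l) :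
    0 < (branch l j z).re := by
  rw [branch_of_lt h]
  exact csqrt_re_pos (radicand_re_pos hl hz h)

lemma branch_im_pos {l j : ℕ} (hl : 10000 ≤ l) {z : ℂ} (hz : ‖z‖ < 10) (h : l < j) :
    0 < (branch l j z).im := by
  rw [branch_of_gt h, Complex.I_mul_im]
  exact csqrt_re_pos (neg_radicand_re_pos hl hz h)

lemma branch_ne_zero {l j : ℕ} (hl : 10000 ≤ l) {z : ℂ} (hz : ‖z‖ < 10) (h : j ≠ l) :
    branch l j z ≠ 0 := by
  intro h0
  rcases h.lt_or_gt with h | h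
  · simpa [h0] using branch_re_pos hl hz h
  · simpa [h0] using branch_im_pos hl hz h

lemma differentiableAt_branch {l : ℕ} (hl : 10000 ≤ l) (j : ℕ) {z : ℂ} (hz : ‖z‖ < 10) :
    DifferentiableAt ℂ (branch l j) z := by
  rcases lt_trichotomy j l with h | rfl | h
  · have : branch l j = csqrt ∘ fun z => z ^ 2 + ((l : ℂ) ^ 2 - (j : ℂ) ^ 2) :=
      funext (branch_of_lt h)
    rw [this]
    exact (differentiableAt_csqrt (radicand_re_pos hl hz h)).comp z (by fun_prop)
  · have : branch j j = id := funext (branch_self j)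
    rw [this]
    exact differentiableAt_id
  · have : branch l j = fun z => Complex.I *
        (csqrt ∘ fun z => -(z ^ 2 + ((l : ℂ) ^ 2 - (j : ℂ) ^ 2))) z :=
      funext (branch_of_gt h)
    rw [this]
    exact ((differentiableAt_csqrt (neg_radicand_re_pos hl hz h)).comp z
      (by fun_prop)).const_mul _

/-- From `(a - b)(a + b) = (z - w)(z + w)`, where `|z + w| ≤ 20` and, for `j ≠ l`, `|a + b| ≥ 1`.
The constant must not depend on `j`, because the topology of `Ẑ` is that of uniform convergence in
`j`. -/
lemma branch_dist_le {l : ℕ} (hl : 10000 ≤ l) (j : ℕ) {z w : ℂ} (hz : ‖z‖ < 10) (hw : ‖w‖ < 10) :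
    dist (branch l j z) (branch l j w) ≤ 20 * dist z w := by
  rw [dist_eq_norm, dist_eq_norm]
  have hsum : 1 ≤ ‖branch l j z + branch l j w‖ ∨ j = l := by
    rcases lt_trichotomy j l with h | rfl | h
    · left
      have h1 := (root_bounds_of_lt hl hz h (branch_sq l j z)).2.1
      have h2 := branch_re_pos hl hz h
      have h3 := branch_re_pos hl hw h
      refine le_trans ?_ (Complex.re_le_norm _)
      rw [Complex.add_re]
      nlinarith
    · exact Or.inr rfl
    · left
      have h1 := (root_bounds_of_gt hl hz h (branch_sq l j z)).2.1
      have h2 := branch_im_pos hl hz h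
      have h3 := branch_im_pos hl hw h
      refine le_trans ?_ (Complex.im_le_norm _)
      rw [Complex.add_im]
      nlinarith
  rcases hsum with h | rfl
  · have h1 : (branch l j z - branch l j w) * (branch l j z + branch l j w) = (z - w) * (z + w) := by
      linear_combination branch_sq l j z - branch_sq l j w
    have h2 := congrArg norm h1
    rw [norm_mul, norm_mul] at h2
    have h3 : ‖z + w‖ ≤ 20 := (norm_add_le z w).trans (by linarith)
    nlinarith [norm_nonneg (branch l j z - branch l j w), norm_nonneg (z - w)]
  · rw [branch_self, branch_self]
    linarith [norm_nonneg (z - w)]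

/-! ### The coordinate `τ_l` near a threshold -/

lemma continuous_τ (j : ℕ) : Continuous fun ζ : ZHat => ζ.τ j :=
  (UniformFun.uniformContinuous_eval ℂ j).continuous.comp continuous_induced_dom

lemma tendsto_zHat_iff {ι : Type*} {p : Filter ι} {F : ι → ZHat} {ζ : ZHat} :
    Tendsto F p (𝓝 ζ) ↔ TendstoUniformly (fun i j => (F i).τ j) ζ.τ p := by
  rw [nhds_induced, tendsto_comap_iff, UniformFun.tendsto_iff_tendstoUniformly]
  rfl

lemma eventually_dist_τ_lt (ζ : ZHat) : ∀ᶠ ξ in 𝓝 ζ, ∀ j, dist (ζ.τ j) (ξ.τ j) < 1 :=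
  Metric.tendstoUniformly_iff.1 (tendsto_zHat_iff.1 (tendsto_id (x := 𝓝 ζ))) 1 one_pos

lemma ZHat.ext_τ {ζ ξ : ZHat} (h : ∀ j, ζ.τ j = ξ.τ j) : ζ = ξ := by
  cases ζ; cases ξ
  congr
  exact funext h

lemma ZHat.sq_eq_sq_add (ζ : ZHat) (l j : ℕ) :
    ζ.τ j ^ 2 = ζ.τ l ^ 2 + ((l : ℂ) ^ 2 - (j : ℂ) ^ 2) := by
  rw [ζ.sq_eq j, ζ.sq_eq l]; ring

/-- The point of `Ẑ` with `τ_l = z`, on the sheet adjacent to the physical one. -/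
def chart (l : ℕ) (z : ℂ) : ZHat where
  τ j := branch l j z
  sq_eq j := by rw [branch_sq, branch_sq]; push_cast; ring
  im_pos := by
    have h1 : ∀ᶠ j : ℕ in atTop, ‖z‖ ^ 2 + (l : ℝ) ^ 2 < j :=
      tendsto_natCast_atTop_atTop.eventually_gt_atTop _
    filter_upwards [h1, eventually_gt_atTop l] with j h1 h2
    rw [branch_of_gt h2, Complex.I_mul_im]
    apply csqrt_re_pos
    rw [Complex.neg_re, re_add_sq_sub_sq]
    have h3 : (1 : ℝ) ≤ j := by exact_mod_cast (Nat.zero_le l).trans_lt h2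
    nlinarith [(abs_le.1 (abs_re_sq_le z)).2]

lemma chart_τ (l j : ℕ) (z : ℂ) : (chart l z).τ j = branch l j z := rfl

lemma continuousOn_chart {l : ℕ} (hl : 10000 ≤ l) : ContinuousOn (chart l) (Metric.ball 0 10) := by
  intro z hz
  have hz' : ‖z‖ < 10 := by simpa using hz
  refine tendsto_zHat_iff.2 (Metric.tendstoUniformly_iff.2 fun ε hε => ?_)
  have h1 : ∀ᶠ w in 𝓝[Metric.ball 0 10] z, dist z w < ε / 20 := by
    refine eventually_nhdsWithin_of_eventually_nhds ?_
    filter_upwards [Metric.ball_mem_nhds z (show 0 < ε / 20 by positivity)] with w hw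
    rwa [dist_comm]
  filter_upwards [h1, self_mem_nhdsWithin] with w hw hw' j
  have := branch_dist_le hl j hz' (by simpa using hw' : ‖w‖ < 10)
  rw [chart_τ, chart_τ]
  linarith

/-! ### The sheet next to the physical space and its coordinate -/

/-- The sheet adjacent to the physical one near the threshold `l`. -/
def sheet (l : ℕ) : Set ZHat :=
  {ζ | ‖ζ.τ l‖ < 10 ∧ (∀ j < l, 0 < (ζ.τ j).re) ∧ ∀ j > l, 0 < (ζ.τ j).im}

lemma chart_mem_sheet {l : ℕ} (hl : 10000 ≤ l) {z : ℂ} (hz : ‖z‖ < 10) : chart l z ∈ sheet l :=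
  ⟨by rwa [chart_τ, branch_self], fun _ h => branch_re_pos hl hz h,
    fun _ h => branch_im_pos hl hz h⟩

lemma τ_eq_branch {l : ℕ} (hl : 10000 ≤ l) {ζ : ZHat} (hζ : ζ ∈ sheet l) (j : ℕ) :
    ζ.τ j = branch l j (ζ.τ l) := by
  obtain ⟨hz, h1, h2⟩ := hζ
  have h := (ζ.sq_eq_sq_add l j).trans (branch_sq l j (ζ.τ l)).symm
  rcases sq_eq_sq_iff_eq_or_eq_neg.1 h with h | h
  · exact h
  · rcases lt_trichotomy j l with hj | rfl | hj
    · have h3 := h1 j hj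
      rw [h, Complex.neg_re] at h3
      linarith [branch_re_pos hl hz hj]
    · rw [branch_self]
    · have h3 := h2 j hj
      rw [h, Complex.neg_im] at h3
      linarith [branch_im_pos hl hz hj]

lemma chart_τ_self {l : ℕ} (hl : 10000 ≤ l) {ζ : ZHat} (hζ : ζ ∈ sheet l) :
    chart l (ζ.τ l) = ζ :=
  ZHat.ext_τ fun j => (τ_eq_branch hl hζ j).symm

/-- Nearby points have all their `τ_j` within distance `1` of each other, whereas the real or
imaginary part whose sign defines the sheet exceeds `50` in absolute value. All these signs
therefore persist simultaneously. -/
lemma isOpen_sheet {l : ℕ} (hl : 10000 ≤ l) : IsOpen (sheet l) := by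
  refine isOpen_iff_mem_nhds.2 fun ζ hζ => ?_
  have h0 : ∀ᶠ ξ in 𝓝 ζ, ‖ξ.τ l‖ < 10 :=
    (continuous_τ l).norm.continuousAt.eventually_lt continuousAt_const hζ.1
  filter_upwards [h0, eventually_dist_τ_lt ζ] with ξ h0 h1
  refine ⟨h0, fun j hj => ?_, fun j hj => ?_⟩
  · have h2 := (root_bounds_of_lt hl hζ.1 hj (ζ.sq_eq_sq_add l j)).2.1
    have h3 := hζ.2.1 j hj
    have h4 := (Complex.re_le_norm _).trans_lt ((dist_eq_norm _ _).symm.trans_lt (h1 j))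
    rw [Complex.sub_re] at h4
    nlinarith
  · have h2 := (root_bounds_of_gt hl hζ.1 hj (ζ.sq_eq_sq_add l j)).2.1
    have h3 := hζ.2.2 j hj
    have h4 := (Complex.im_le_norm _).trans_lt ((dist_eq_norm _ _).symm.trans_lt (h1 j))
    rw [Complex.sub_im] at h4
    nlinarith

lemma sheet_isCoordinateAt {l : ℕ} (hl : 10000 ≤ l) {ζ : ZHat} (hζ : ζ ∈ sheet l) :
    IsCoordinateAt l ζ := by
  intro j hj
  by_contra h
  rw [τ_eq_branch hl hζ] at hj
  exact branch_ne_zero hl hζ.1 h hj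

lemma IsPreconnected.pos_of_ne_zero {α : Type*} [TopologicalSpace α] {s : Set α}
    (hs : IsPreconnected s) {f : α → ℝ} (hf : Continuous f) (h0 : ∀ x ∈ s, f x ≠ 0) {x y : α}
    (hx : x ∈ s) (hy : y ∈ s) (hfx : 0 < f x) : 0 < f y := by
  by_contra! h
  obtain ⟨w, hw, hw0⟩ := hs.intermediate_value hy hx hf.continuousOn ⟨h, hfx.le⟩
  exact h0 w hw hw0

/-- Where `|τ_l| < 1`, neither `Re τ_j` for `j < l` nor `Im τ_j` for `j > l` can vanish, so their
signs are constant on the component and may be read off at the physical point `p`. There all `Im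
τ_j` are positive, which settles `j > l`. -/
lemma B_one_subset_sheet {l : ℕ} (hl : 10000 ≤ l) : B l 1 ⊆ sheet l := by
  rintro ζ ⟨hζ, ⟨p, hpC, hp⟩, ⟨q, hqC, hq⟩⟩
  set s := connectedComponentIn {ξ : ZHat | ‖ξ.τ l‖ < 1} ζ
  have hs : IsPreconnected s := isPreconnected_connectedComponentIn
  have hζs : ζ ∈ s := mem_connectedComponentIn hζ
  have hsub : ∀ ξ ∈ s, ‖ξ.τ l‖ < 10 := fun ξ hξ =>
    have h : ξ ∈ {ξ : ZHat | ‖ξ.τ l‖ < 1} := connectedComponentIn_subset _ _ hξ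
    lt_trans (b := 1) h (by norm_num)
  have hne : ∀ j < l, ∀ ξ ∈ s, (ξ.τ j).re ≠ 0 := fun j hj ξ hξ h0 => by
    have := (root_bounds_of_lt hl (hsub ξ hξ) hj (ξ.sq_eq_sq_add l j)).2.1
    rw [h0] at this
    norm_num at this
  have hcre : ∀ j, Continuous fun ξ : ZHat => (ξ.τ j).re := fun j =>
    Complex.continuous_re.comp (continuous_τ j)
  have hcim : ∀ j, Continuous fun ξ : ZHat => (ξ.τ j).im := fun j =>
    Complex.continuous_im.comp (continuous_τ j)
  refine ⟨hsub ζ hζs, fun j hj => ?_, fun j hj => ?_⟩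
  · have h1 : 0 < (p.τ 0).re := IsPreconnected.pos_of_ne_zero hs (hcre 0)
      (hne 0 (by omega)) hqC hpC hq
    -- All `τ_j²` differ by real constants, so `Re τ_j · Im τ_j` is the same for every `j`. Since
    -- `Re τ_0 > 0` at `p`, positivity of the imaginary parts gives `Re τ_j > 0`.
    have h2 : ((p.τ j) ^ 2).im = ((p.τ 0) ^ 2).im := by
      rw [p.sq_eq_sq_add 0 j, im_add_sq_sub_sq]
    rw [sq, sq, Complex.mul_im, Complex.mul_im] at h2
    have h3 : 0 < (p.τ j).re := by
      have := mul_pos h1 (hp 0)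
      by_contra! h
      nlinarith [hp j]
    exact IsPreconnected.pos_of_ne_zero hs (hcre j) (hne j hj) hpC hζs h3
  · refine IsPreconnected.pos_of_ne_zero hs (hcim j) (fun ξ hξ h0 => ?_) hpC hζs (hp j)
    have := (root_bounds_of_gt hl (hsub ξ hξ) hj (ξ.sq_eq_sq_add l j)).2.1
    rw [h0] at this
    norm_num at this

/-- The open annulus of radii `r` and `R`. -/
def annulus (a : ℂ) (r R : ℝ) : Set ℂ := {z | r < ‖z - a‖ ∧ ‖z - a‖ < R}

lemma isOpen_annulus (a : ℂ) (r R : ℝ) : IsOpen (annulus a r R) :=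
  have h : Continuous fun z : ℂ => ‖z - a‖ := by fun_prop
  (isOpen_lt continuous_const h).inter (isOpen_lt h continuous_const)

lemma isPreconnected_annulus (a : ℂ) {r : ℝ} (hr : 0 ≤ r) (R : ℝ) :
    IsPreconnected (annulus a r R) := by
  have h : annulus a r R = (fun p : ℝ × ℝ => a + p.1 * Complex.exp (p.2 * Complex.I)) ''
      (Set.Ioo r R ×ˢ Set.univ) := by
    ext z
    simp only [annulus, Set.mem_ofPred_eq, Set.mem_image, Set.mem_prod, Set.mem_Ioo, Set.mem_univ,
      and_true, Prod.exists]
    constructor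
    · intro h
      exact ⟨‖z - a‖, (z - a).arg, h, by rw [Complex.norm_mul_exp_arg_mul_I]; ring⟩
    · rintro ⟨ρ, φ, h, rfl⟩
      rw [add_sub_cancel_left, norm_mul, Complex.norm_exp_ofReal_mul_I, mul_one,
        Complex.norm_real, Real.norm_of_nonneg (hr.trans h.1.le)]
      exact h
  rw [h]
  exact (isPreconnected_Ioo.prod isPreconnected_univ).image _ (by fun_prop)

lemma isPreconnected_sheet_inter {l : ℕ} (hl : 10000 ≤ l) {D : Set ℂ} (hD : IsPreconnected D)
    (hD10 : D ⊆ Metric.ball 0 10) : IsPreconnected {ζ | ζ ∈ sheet l ∧ ζ.τ l ∈ D} := by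
  have h : {ζ | ζ ∈ sheet l ∧ ζ.τ l ∈ D} = chart l '' D := by
    ext ζ
    constructor
    · rintro ⟨h1, h2⟩
      exact ⟨ζ.τ l, h2, chart_τ_self hl h1⟩
    · rintro ⟨z, hz, rfl⟩
      refine ⟨chart_mem_sheet hl (by simpa using hD10 hz), ?_⟩
      rwa [chart_τ, branch_self]
  rw [h]
  exact hD.image _ ((continuousOn_chart hl).mono hD10)

/-! ### The regularized truncated resolvent -/

/-- Compares the tail bounds `1/(j² - l²)` with `1/j²`. The constant depends on `l`, which is
harmless because it only serves convergence of the sum over modes. -/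
lemma sq_le_mul_sq_sub_sq {l : ℕ} {x : ℝ} (hx : (l : ℝ) + 1 ≤ x) :
    x ^ 2 ≤ ((l : ℝ) + 1) ^ 2 * (x ^ 2 - (l : ℝ) ^ 2) := by
  have h0 : (0 : ℝ) ≤ l := Nat.cast_nonneg l
  have h1 : ((l : ℝ) + 1) ^ 2 ≤ x ^ 2 := by gcongr
  nlinarith [mul_nonneg h0 (sq_nonneg x), mul_nonneg (sq_nonneg (l : ℝ)) (sub_nonneg.2 h1)]

lemma summable_of_norm_le_div {E : Type*} [NormedAddCommGroup E] [CompleteSpace E] {F : ℤ → E}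
    {l : ℕ} (h : ∀ j : ℤ, l < j.natAbs → ‖F j‖ ≤ 3 / ((j.natAbs : ℝ) ^ 2 - (l : ℝ) ^ 2)) :
    Summable F := by
  have hs : Summable fun j : ℤ => 3 * ((l : ℝ) + 1) ^ 2 * (1 / (j : ℝ) ^ 2) :=
    (Real.summable_one_div_int_pow.2 one_lt_two).mul_left _
  refine hs.of_norm_bounded_eventually ?_
  have hfin : {j : ℤ | j.natAbs ≤ l}.Finite := by
    refine (Set.finite_Icc (-(l : ℤ)) l).subset fun j (hj : j.natAbs ≤ l) => ?_
    simp only [Set.mem_Icc]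
    omega
  refine (hfin.subset fun j hj => ?_)
  simp only [Set.mem_compl_iff, Set.mem_ofPred_eq] at hj ⊢
  by_contra! hlt
  refine hj ((h j hlt).trans ?_)
  have h1 : (l : ℝ) + 1 ≤ (j.natAbs : ℝ) := by exact_mod_cast hlt
  have h2 := sq_le_mul_sq_sub_sq h1
  have h3 : ((j.natAbs : ℝ)) ^ 2 = (j : ℝ) ^ 2 := by
    rw [Nat.cast_natAbs, Int.cast_abs, sq_abs]
  have h4 : (0 : ℝ) < (j.natAbs : ℝ) ^ 2 := by
    have : (0 : ℝ) ≤ l := Nat.cast_nonneg l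
    nlinarith
  have h5 : (0 : ℝ) < (j.natAbs : ℝ) ^ 2 - (l : ℝ) ^ 2 := by
    have h0 : (0 : ℝ) ≤ l := Nat.cast_nonneg l
    nlinarith
  rw [← h3, mul_one_div, div_le_div_iff₀ h5 h4]
  nlinarith

/-- The truncated free resolvent in the mode `j`, without its singular part at `τ_l = 0`. -/
def regTerm (M : ℝ) (l : ℕ) (j : ℤ) (z : ℂ) : L2 →L[ℂ] L2 :=
  cutoff M ∘L (if j.natAbs = l then truncReg M j z else truncFree M j (branch l j.natAbs z)) ∘L
    cutoff M

/-- The truncated free resolvent, without its singular part at `τ_l = 0`. -/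
def regRes (M : ℝ) (l : ℕ) (z : ℂ) : L2 →L[ℂ] L2 := ∑' j, regTerm M l j z

lemma regTerm_of_eq (M : ℝ) {l : ℕ} {j : ℤ} (h : j.natAbs = l) (z : ℂ) :
    regTerm M l j z = cutoff M ∘L truncReg M j z ∘L cutoff M := by
  rw [regTerm, if_pos h]

lemma regTerm_of_ne (M : ℝ) {l : ℕ} {j : ℤ} (h : j.natAbs ≠ l) (z : ℂ) :
    regTerm M l j z = cutoff M ∘L truncFree M j (branch l j.natAbs z) ∘L cutoff M := by
  rw [regTerm, if_neg h]

lemma isModeOp_regTerm (M : ℝ) (l : ℕ) (j : ℤ) (z : ℂ) : IsModeOp j (regTerm M l j z) := by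
  by_cases h : j.natAbs = l
  · rw [regTerm_of_eq M h]
    exact (isModeOp_truncReg M j z).cutoff M
  · rw [regTerm_of_ne M h]
    exact (isModeOp_truncFree M j _).cutoff M

lemma one_div_norm_mul_im_le {l j : ℕ} (hl : 10000 ≤ l) {z τ : ℂ} (hz : ‖z‖ < 10) (h : l < j)
    (hτ : τ ^ 2 = z ^ 2 + ((l : ℂ) ^ 2 - (j : ℂ) ^ 2)) (hi : 0 < τ.im) :
    1 / (‖τ‖ * τ.im) ≤ 3 / ((j : ℝ) ^ 2 - (l : ℝ) ^ 2) := by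
  obtain ⟨h1, -, h2, -⟩ := root_bounds_of_gt hl hz h hτ
  have hl' : (10000 : ℝ) ≤ l := by exact_mod_cast hl
  have hn := sq_sub_sq_of_gt h
  have h3 : 0 < ‖τ‖ := hi.trans_le (Complex.im_le_norm τ)
  -- Any constant above `√2` works; `3/2` together with `‖τ‖² ≥ (j² - l²)/2` gives the factor `3`.
  have h4 : ‖τ‖ ≤ 3 / 2 * τ.im := by nlinarith
  rw [div_le_div_iff₀ (by positivity) (by linarith)]
  nlinarith

lemma norm_regTerm_le_of_gt (M : ℝ) {l : ℕ} (hl : 10000 ≤ l) {z : ℂ} (hz : ‖z‖ < 10) {j : ℤ}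
    (h : l < j.natAbs) : ‖regTerm M l j z‖ ≤ 3 / ((j.natAbs : ℝ) ^ 2 - (l : ℝ) ^ 2) := by
  rw [regTerm_of_ne M h.ne']
  exact (norm_cutoff_comp_le M _).trans ((norm_truncFree_le_of_im_pos M j
    (branch_im_pos hl hz h)).trans (one_div_norm_mul_im_le hl hz h (branch_sq l _ z)
      (branch_im_pos hl hz h)))

lemma le_norm_branch_sq {l j : ℕ} (hl : 10000 ≤ l) {z : ℂ} (hz : ‖z‖ < 10) (h : j ≠ l) :
    (l : ℝ) / 2 ≤ ‖branch l j z‖ ^ 2 := by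
  have hl' : (10000 : ℝ) ≤ l := by exact_mod_cast hl
  rcases h.lt_or_gt with h | h
  · linarith [(root_bounds_of_lt hl hz h (branch_sq l j z)).1, sq_sub_sq_of_lt h]
  · linarith [(root_bounds_of_gt hl hz h (branch_sq l j z)).1, sq_sub_sq_of_gt h]

lemma neg_one_le_branch_im {l j : ℕ} (hl : 10000 ≤ l) {z : ℂ} (hz : ‖z‖ < 10) (h : j ≠ l) :
    -1 ≤ (branch l j z).im := by
  rcases h.lt_or_gt with h | h
  · exact (abs_le.1 (root_bounds_of_lt hl hz h (branch_sq l j z)).2.2).1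
  · linarith [branch_im_pos hl hz h]

lemma norm_regTerm_le_of_ne {M : ℝ} (hM : 0 ≤ M) {l : ℕ} (hl : 10000 ≤ l) {z : ℂ} (hz : ‖z‖ < 10)
    {j : ℤ} (h : j.natAbs ≠ l) :
    ‖regTerm M l j z‖ ≤ 4 * M * Real.exp (2 * M) / Real.sqrt l := by
  rw [regTerm_of_ne M h]
  refine (norm_cutoff_comp_le M _).trans ((norm_truncFree_le hM j
    (neg_one_le_branch_im hl hz h)).trans ?_)
  have h1 := le_norm_branch_sq hl hz h
  have hl' : (10000 : ℝ) ≤ l := by exact_mod_cast hl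
  have h2 : 0 < Real.sqrt l := Real.sqrt_pos.2 (by linarith)
  have h3 : Real.sqrt l ≤ 2 * ‖branch l j.natAbs z‖ := by
    refine Real.sqrt_le_iff.2 ⟨by positivity, ?_⟩
    nlinarith
  have h4 : 0 < ‖branch l j.natAbs z‖ := by linarith
  rw [div_le_div_iff₀ h4 h2]
  have h5 : 0 ≤ 2 * M * Real.exp (2 * M) := by positivity
  nlinarith

lemma norm_regTerm_le_of_eq {M c : ℝ} (hc : ∀ (j : ℤ) (z : ℂ), ‖z‖ ≤ 10 → ‖truncReg M j z‖ ≤ c)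
    {l : ℕ} {z : ℂ} (hz : ‖z‖ < 10) {j : ℤ} (h : j.natAbs = l) : ‖regTerm M l j z‖ ≤ c := by
  rw [regTerm_of_eq M h]
  exact (norm_cutoff_comp_le M _).trans (hc j z hz.le)

lemma summable_regTerm (M : ℝ) {l : ℕ} (hl : 10000 ≤ l) {z : ℂ} (hz : ‖z‖ < 10) :
    Summable fun j => regTerm M l j z :=
  summable_of_norm_le_div fun _ h => norm_regTerm_le_of_gt M hl hz h

lemma differentiableAt_regTerm (M : ℝ) {l : ℕ} (hl : 10000 ≤ l) (j : ℤ) {z : ℂ} (hz : ‖z‖ < 10) :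
    DifferentiableAt ℂ (regTerm M l j) z := by
  have key : ∀ G : ℂ → L2 →L[ℂ] L2, DifferentiableAt ℂ G z →
      DifferentiableAt ℂ (fun z => cutoff M ∘L G z ∘L cutoff M) z := fun G hG => by
    have : DifferentiableAt ℂ (fun z => cutoff M * (G z * cutoff M)) z :=
      (hG.mul_const _).const_mul _
    exact this
  by_cases h : j.natAbs = l
  · rw [show regTerm M l j = fun z => _ from funext (regTerm_of_eq M h)]
    exact key _ (differentiable_truncReg M j z)
  · rw [show regTerm M l j = fun z => _ from funext (regTerm_of_ne M h)]
    exact key _ ((differentiableAt_truncFree M j (branch_ne_zero hl hz h)).comp z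
      (differentiableAt_branch hl _ hz))

lemma differentiableOn_regRes {M : ℝ} (hM : 0 ≤ M) {l : ℕ} (hl : 10000 ≤ l) :
    DifferentiableOn ℂ (regRes M l) (Metric.ball 0 10) := by
  obtain ⟨c, hc0, hc⟩ := exists_norm_truncReg_le M 10
  -- Majorant for the Weierstrass test: one crude constant for the finitely many modes `|j| ≤ l`,
  -- the summable evanescent bound beyond.
  set u : ℤ → ℝ := fun j => if j.natAbs ≤ l then c + 4 * M * Real.exp (2 * M) / Real.sqrt l else
    3 / ((j.natAbs : ℝ) ^ 2 - (l : ℝ) ^ 2) with hu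
  have hd0 : 0 ≤ 4 * M * Real.exp (2 * M) / Real.sqrt l := by positivity
  have hsu : Summable u := by
    refine summable_of_norm_le_div (l := l) fun j hj => ?_
    rw [hu]
    simp only [hj.not_ge, if_false]
    rw [Real.norm_of_nonneg]
    have := sq_sub_sq_of_gt hj
    have hl' : (10000 : ℝ) ≤ l := by exact_mod_cast hl
    exact div_nonneg (by norm_num) (by linarith)
  refine Complex.differentiableOn_tsum_of_summable_norm hsu (fun j z hz =>
    (differentiableAt_regTerm M hl j (by simpa using hz)).differentiableWithinAt)
    Metric.isOpen_ball fun j z hz => ?_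
  have hz' : ‖z‖ < 10 := by simpa using hz
  rw [hu]
  by_cases hj : j.natAbs ≤ l
  · simp only [hj, if_true]
    by_cases h : j.natAbs = l
    · linarith [norm_regTerm_le_of_eq hc hz' h]
    · linarith [norm_regTerm_le_of_ne hM hl hz' h]
  · simp only [hj, if_false]
    exact norm_regTerm_le_of_gt M hl hz' (not_le.1 hj)

/-- Conjugation by a cutoff, as an operator. -/
def cutoffL (M : ℝ) : (L2 →L[ℂ] L2) →L[ℂ] L2 →L[ℂ] L2 :=
  (ContinuousLinearMap.compL ℂ L2 L2 L2 (cutoff M)) ∘L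
    (ContinuousLinearMap.compL ℂ L2 L2 L2).flip (cutoff M)

lemma cutoffL_apply (M : ℝ) (B : L2 →L[ℂ] L2) : cutoffL M B = cutoff M ∘L B ∘L cutoff M := rfl

lemma cutoffL_cutoffL {N M : ℝ} (h : N ≤ M) (B : L2 →L[ℂ] L2) :
    cutoffL N (cutoffL M B) = cutoffL N B := by
  ext1 f
  simp only [cutoffL_apply, ContinuousLinearMap.comp_apply, cutoff_cutoff_of_le h,
    cutoff_cutoff_of_ge h]

lemma cutoffL_regTerm {N M : ℝ} (h : N ≤ M) (l : ℕ) (j : ℤ) (z : ℂ) :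
    cutoffL N (regTerm M l j z) = regTerm N l j z := by
  by_cases hj : j.natAbs = l
  · rw [regTerm_of_eq M hj, regTerm_of_eq N hj, ← cutoffL_apply, cutoffL_cutoffL h, cutoffL_apply,
      cutoff_truncReg h]
  · rw [regTerm_of_ne M hj, regTerm_of_ne N hj, ← cutoffL_apply, cutoffL_cutoffL h, cutoffL_apply,
      cutoff_truncFree h]

lemma cutoffL_regRes {N M : ℝ} (h : N ≤ M) {l : ℕ} (hl : 10000 ≤ l) {z : ℂ} (hz : ‖z‖ < 10) :
    cutoffL N (regRes M l z) = regRes N l z := by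
  rw [regRes, (cutoffL N).map_tsum (summable_regTerm M hl hz)]
  exact tsum_congr fun j => cutoffL_regTerm h l j z

/-- The truncated free resolvent and its regular part. -/
lemma cutoffL_freeResolvent (M : ℝ) {l : ℕ} (hl : 10000 ≤ l) {z : ℂ} (hz : ‖z‖ < 10) (hz0 : z ≠ 0)
    {t : ℤ → ℂ} (ht : ∀ j, 0 < (t j).im) (htb : ∀ j, t j = branch l j.natAbs z)
    (hs : Summable fun j => modeConv j (integrable_outKernel (ht j)).toL1) (f : L2) :
    cutoff M (freeResolvent t ht (cutoff M f)) = (Complex.I / (2 * z)) •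
      ((inner ℂ (wave M l) f : ℂ) • wave M l + (inner ℂ (wave M (-l)) f : ℂ) • wave M (-l)) +
        regRes M l z f := by
  have hl0 : (l : ℤ) ≠ -l := by omega
  have hterm : ∀ j : ℤ, cutoffL M (modeConv j (integrable_outKernel (ht j)).toL1) =
      (if j ∈ ({(l : ℤ), -(l : ℤ)} : Finset ℤ) then
        (Complex.I / (2 * z)) • cutoffL M (truncConv M j 1) else 0) + regTerm M l j z := by
    intro j
    rw [cutoffL_apply, cutoff_modeConv_outKernel M j (ht j), htb]
    have hiff : j ∈ ({(l : ℤ), -(l : ℤ)} : Finset ℤ) ↔ j.natAbs = l := by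
      simp only [Finset.mem_insert, Finset.mem_singleton]
      omega
    by_cases hj : j.natAbs = l
    · rw [if_pos (hiff.2 hj), hj, branch_self, truncFree_eq M j hz0, regTerm_of_eq M hj,
        ← cutoffL_apply, map_add, map_smul, cutoffL_apply M (truncReg M j z)]
    · rw [if_neg (fun h => hj (hiff.1 h)), zero_add, regTerm_of_ne M hj]
  have h1 : cutoffL M (freeResolvent t ht) =
      (∑ j ∈ ({(l : ℤ), -(l : ℤ)} : Finset ℤ), (Complex.I / (2 * z)) • cutoffL M (truncConv M j 1))
        + regRes M l z := by
    rw [freeResolvent, (cutoffL M).map_tsum hs, tsum_congr hterm,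
      Summable.tsum_add (summable_of_hasFiniteSupport _) (summable_regTerm M hl hz), regRes,
      tsum_eq_sum (s := ({(l : ℤ), -(l : ℤ)} : Finset ℤ)) (fun j hj => if_neg hj)]
    · congr 1
      exact Finset.sum_congr rfl fun j hj => if_pos hj
    · refine (Finset.finite_toSet ({(l : ℤ), -(l : ℤ)} : Finset ℤ)).subset fun j hj => ?_
      by_contra h
      exact hj (if_neg h)
  have h2 := congrArg (fun B : L2 →L[ℂ] L2 => B f) h1
  simp only [Finset.sum_pair hl0, add_apply, smul_apply, cutoffL_apply,
    ContinuousLinearMap.comp_apply, cutoff_truncConv_one] at h2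
  rw [h2, smul_add]

/-! ### Inversion of `1 + R₁ V` -/

/-- Since `(1 + a)(1 - a) = 1 - a²`, smallness of `a²` is enough; `a` itself need not be small. -/
lemma isUnit_one_add_of_norm_sq_le {E : Type*} [NormedAddCommGroup E] [NormedSpace ℂ E]
    [CompleteSpace E] {a : E →L[ℂ] E} (h : ‖a * a‖ ≤ 1 / 2) :
    IsUnit (1 + a) ∧ ‖Ring.inverse (1 + a)‖ ≤ 2 * (1 + ‖a‖) := by
  have h1 : IsUnit (1 - a * a) := isUnit_one_sub_of_norm_lt_one (by linarith)
  have h2 : (1 + a) * (1 - a) = 1 - a * a := by noncomm_ring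
  have h3 : (1 - a) * (1 + a) = 1 - a * a := by noncomm_ring
  have hc : Commute (1 + a) (1 - a) := h2.trans h3.symm
  have hu : IsUnit (1 + a) := (hc.isUnit_mul_iff.1 (h2 ▸ h1)).1
  refine ⟨hu, ?_⟩
  set b := Ring.inverse (1 - a * a) with hb
  have hone : ‖(1 : E →L[ℂ] E)‖ ≤ 1 := ContinuousLinearMap.norm_id_le
  have hb1 : (1 - a * a) * b = 1 := Ring.mul_inverse_cancel _ h1
  have hbn : ‖b‖ ≤ 2 := by
    have h4 : b = 1 + a * a * b := by
      rw [← hb1]; noncomm_ring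
    have h5 : ‖b‖ ≤ ‖(1 : E →L[ℂ] E)‖ + ‖a * a‖ * ‖b‖ := by
      conv_lhs => rw [h4]
      exact (norm_add_le _ _).trans (add_le_add_right (norm_mul_le _ _) _)
    nlinarith [norm_nonneg b]
  have h6 : Ring.inverse (1 + a) = (1 - a) * b := by
    have h8 : (1 + a) * ((1 - a) * b) = 1 := by rw [← mul_assoc, h2, hb1]
    have h9 := Ring.inverse_mul_cancel_left (1 + a) ((1 - a) * b) hu
    rwa [h8, mul_one] at h9
  rw [h6]
  have h7 : ‖1 - a‖ ≤ 1 + ‖a‖ := (norm_sub_le _ _).trans (by linarith)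
  have := norm_mul_le (1 - a) b
  nlinarith [norm_nonneg b, norm_nonneg (1 - a)]

lemma norm_add_mul_add_le {R : Type*} [NormedRing R] {p q : R} {α β : ℝ} (h : q * q = 0)
    (hp : ‖p‖ ≤ α) (hq : ‖q‖ ≤ β) : ‖(p + q) * (p + q)‖ ≤ α * α + α * β + β * α := by
  have h1 : (p + q) * (p + q) = p * p + p * q + q * p := by
    rw [add_mul, mul_add, mul_add, h, add_zero, add_assoc]
  have hα : 0 ≤ α := (norm_nonneg p).trans hp
  have hβ : 0 ≤ β := (norm_nonneg q).trans hq
  rw [h1]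
  refine norm_add₃_le.trans (add_le_add (add_le_add ?_ ?_) ?_) <;>
    exact (norm_mul_le _ _).trans (by gcongr)

/-- The potential changes a mode by exactly `±1`, while two elements of `{l, -l}` differ by an even
number. -/
lemma regTerm_potentialOp_regTerm (M : ℝ) (l : ℕ) (z : ℂ) {p q : ℤ} (hp : p.natAbs = l)
    (hq : q.natAbs = l) (f : L2) :
    regTerm M l p z (potentialOp (regTerm M l q z f)) = 0 := by
  have hm := (isModeOp_regTerm M l q z).mem f
  rw [potentialOp_eq, map_add,
    (isModeOp_regTerm M l p z).apply_eq_zero (cutoff_mem_mode 1 (shiftMode_mem_mode hm))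
      (by omega),
    (isModeOp_regTerm M l p z).apply_eq_zero (cutoff_mem_mode 1 (shiftMode_mem_mode hm))
      (by omega), add_zero]

/-- The part of the regularized resolvent in the modes `±l`. -/
def regPair (l : ℕ) (z : ℂ) : L2 →L[ℂ] L2 :=
  ∑ j ∈ ({(l : ℤ), -(l : ℤ)} : Finset ℤ), regTerm 1 l j z

lemma mem_pair_iff {l : ℕ} {j : ℤ} : j ∈ ({(l : ℤ), -(l : ℤ)} : Finset ℤ) ↔ j.natAbs = l := by
  simp only [Finset.mem_insert, Finset.mem_singleton]
  omega

lemma regPair_mul_potentialOp_mul_regPair (l : ℕ) (z : ℂ) :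
    regPair l z * potentialOp * regPair l z = 0 := by
  ext1 f
  change regPair l z (potentialOp (regPair l z f)) = 0
  simp only [regPair, sum_apply, map_sum]
  refine Finset.sum_eq_zero fun p hp => Finset.sum_eq_zero fun q hq => ?_
  exact regTerm_potentialOp_regTerm 1 l z (mem_pair_iff.1 hq) (mem_pair_iff.1 hp) f

lemma norm_regPair_le {c : ℝ} (hc0 : 0 ≤ c)
    (hc : ∀ (j : ℤ) (z : ℂ), ‖z‖ ≤ 10 → ‖truncReg 1 j z‖ ≤ c)
    (l : ℕ) {z : ℂ} (hz : ‖z‖ < 10) : ‖regPair l z‖ ≤ c := by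
  classical
  have hP : regPair l z = ∑ j ∈ ({(l : ℤ), -(l : ℤ)} : Finset ℤ),
      if j.natAbs = l then regTerm 1 l j z else 0 :=
    Finset.sum_congr rfl fun j hj => (if_pos (mem_pair_iff.1 hj)).symm
  rw [hP]
  refine norm_sum_modeOp_le (B := fun j => if j.natAbs = l then regTerm 1 l j z else 0)
    (fun j => ?_) hc0 (fun j => ?_) _
  · split_ifs
    · exact isModeOp_regTerm 1 l j z
    · exact ⟨fun _ => zero_mem _, fun f => by rw [map_zero]; exact zero_mem _⟩
  · split_ifs with h
    · exact norm_regTerm_le_of_eq hc hz h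
    · rwa [norm_zero]

lemma norm_regRes_sub_regPair_le {l : ℕ} (hl : 10000 ≤ l) {z : ℂ} (hz : ‖z‖ < 10) :
    ‖regRes 1 l z - regPair l z‖ ≤ 4 * Real.exp 2 / Real.sqrt l := by
  have hs := summable_regTerm 1 hl hz
  have h1 : HasSum (fun j => if j ∈ ({(l : ℤ), -(l : ℤ)} : Finset ℤ) then 0 else regTerm 1 l j z)
      (regRes 1 l z - regPair l z) := by
    have h2 := hs.hasSum.sub (hasSum_sum_of_ne_finset_zero (f := fun j =>
      if j ∈ ({(l : ℤ), -(l : ℤ)} : Finset ℤ) then regTerm 1 l j z else 0)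
      (s := ({(l : ℤ), -(l : ℤ)} : Finset ℤ)) fun j hj => if_neg hj)
    rw [Finset.sum_congr rfl fun j hj => if_pos hj] at h2
    refine HasSum.congr_fun h2 fun j => ?_
    split_ifs <;> simp
  rw [← h1.tsum_eq]
  refine norm_tsum_modeOp_le (fun j => ?_) (by positivity) (fun j => ?_) h1.summable
  · split_ifs
    · exact ⟨fun _ => zero_mem _, fun f => by rw [map_zero]; exact zero_mem _⟩
    · exact isModeOp_regTerm 1 l j z
  · split_ifs with h
    · rw [norm_zero]; positivity
    · have := norm_regTerm_le_of_ne zero_le_one hl hz (fun h' => h (mem_pair_iff.2 h'))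
      simpa using this

/-- For large `l`, the operator `1 + R₁ V` is invertible, with a uniformly bounded inverse. -/
lemma exists_isUnit_one_add_regRes : ∃ (K : ℝ) (L : ℕ), 0 ≤ K ∧ 10000 ≤ L ∧ ∀ l : ℕ, L ≤ l →
    ∀ z : ℂ, ‖z‖ < 10 → IsUnit (1 + regRes 1 l z * potentialOp) ∧
      ‖Ring.inverse (1 + regRes 1 l z * potentialOp)‖ ≤ K := by
  obtain ⟨c, hc0, hc⟩ := exists_norm_truncReg_le 1 10
  -- Chosen so that `√l ≥ D` gives `a = ‖Sa‖ ≤ 1/(8(1 + 2c))`. The square of `R₁V` is then at most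
  -- `4a² + 8ac = 4a(a + 2c) ≤ 1/2`.
  set D : ℝ := 4 * Real.exp 2 * (8 * (1 + 2 * c)) with hD
  obtain ⟨L₀, hL₀⟩ := exists_nat_ge (D ^ 2)
  refine ⟨2 * (1 + 2 * (c + 1)), max L₀ 10000, by positivity, le_max_right _ _,
    fun l hl z hz => ?_⟩
  have hl1 : 10000 ≤ l := (le_max_right _ _).trans hl
  have hl2 : D ^ 2 ≤ l := hL₀.trans (by exact_mod_cast (le_max_left _ _).trans hl)
  have hD0 : 0 < D := by positivity
  have hsq : D ≤ Real.sqrt l := Real.le_sqrt_of_sq_le hl2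
  set Sb := regPair l z with hSb
  set Sa := regRes 1 l z - Sb with hSa
  have hb : ‖Sb‖ ≤ c := norm_regPair_le hc0 hc l hz
  have ha : ‖Sa‖ * (8 * (1 + 2 * c)) ≤ 1 := by
    have h1 := norm_regRes_sub_regPair_le hl1 hz
    have h2 : 4 * Real.exp 2 / Real.sqrt l ≤ 4 * Real.exp 2 / D := by gcongr
    have h3 : 4 * Real.exp 2 / D = 1 / (8 * (1 + 2 * c)) := by
      rw [hD]; field_simp
    rw [h3] at h2
    rw [← le_div_iff₀ (by positivity)]
    exact h1.trans h2
  have hsum : regRes 1 l z = Sa + Sb := by rw [hSa]; abel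
  have hV := norm_potentialOp_le
  have hV0 := norm_nonneg potentialOp
  have ha0 := norm_nonneg Sa
  have hb0 := norm_nonneg Sb
  have hX : ‖regRes 1 l z * potentialOp‖ ≤ 2 * (c + 1) := by
    have h1 := norm_mul_le (regRes 1 l z) potentialOp
    have h2 : ‖regRes 1 l z‖ ≤ c + 1 := by
      rw [hsum]
      refine (norm_add_le _ _).trans ?_
      nlinarith
    nlinarith [norm_nonneg (regRes 1 l z)]
  have hXX : ‖(regRes 1 l z * potentialOp) * (regRes 1 l z * potentialOp)‖ ≤ 1 / 2 := by
    have h0 := regPair_mul_potentialOp_mul_regPair l z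
    have h2 : (Sb * potentialOp) * (Sb * potentialOp) = 0 := by
      rw [← mul_assoc, h0, zero_mul]
    have hSaV : ‖Sa * potentialOp‖ ≤ 2 * ‖Sa‖ := (norm_mul_le _ _).trans (by nlinarith)
    have hSbV : ‖Sb * potentialOp‖ ≤ 2 * c := (norm_mul_le _ _).trans (by nlinarith)
    rw [hsum, add_mul]
    refine (norm_add_mul_add_le h2 hSaV hSbV).trans ?_
    nlinarith [mul_nonneg ha0 hc0]
  obtain ⟨h1, h2⟩ := isUnit_one_add_of_norm_sq_le hXX
  exact ⟨h1, h2.trans (by linarith)⟩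

/-! ### The effective Hamiltonian on the modes `±l` -/

/-- The matrix element `⟨w, (D_x² - τ²)⁻¹ w⟩` for the characteristic function of `[-1, 1]`. -/
def selfEnergy (τ : ℂ) : ℂ := -2 / τ ^ 2 + Complex.I * (1 - Complex.exp (2 * Complex.I * τ)) / τ ^ 3

lemma regRes_wave {l : ℕ} (hl : 10000 ≤ l) {z : ℂ} (hz : ‖z‖ < 10) {n : ℤ} (hn : n.natAbs ≠ l) :
    regRes 1 l z (wave 1 n) = (memLp_profile_mul_waveFn (branch l n.natAbs z) n).toLp := by
  rw [regRes, tsum_modeOp_apply (fun j => isModeOp_regTerm 1 l j z) (summable_regTerm 1 hl hz)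
    (wave_mem_mode 1 n), regTerm_of_ne 1 hn, ← cutoff_truncFree_wave (branch_ne_zero hl hz hn)]
  rfl

lemma div_norm_sq_le {l : ℕ} (hl : 10000 ≤ l) {τ : ℂ} (h : (l : ℝ) / 2 ≤ ‖τ‖ ^ 2) :
    2 * (1 + Real.exp 2) / ‖τ‖ ^ 2 ≤ 4 * (1 + Real.exp 2) / l := by
  have hl' : (10000 : ℝ) ≤ l := by exact_mod_cast hl
  have he := Real.exp_pos 2
  rw [div_le_div_iff₀ (by linarith) (by linarith)]
  nlinarith

lemma norm_regRes_wave_le {l : ℕ} (hl : 10000 ≤ l) {z : ℂ} (hz : ‖z‖ < 10) {n : ℤ}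
    (hn : n.natAbs ≠ l) : ‖regRes 1 l z (wave 1 n)‖ ≤ 4 * (1 + Real.exp 2) / l := by
  rw [regRes_wave hl hz hn]
  exact (norm_toLp_profile_le (neg_one_le_branch_im hl hz hn) n).trans
    (div_norm_sq_le hl (le_norm_branch_sq hl hz hn))

lemma inner_wave_regRes_wave_self {l : ℕ} (hl : 10000 ≤ l) {z : ℂ} (hz : ‖z‖ < 10) {n : ℤ}
    (hn : n.natAbs ≠ l) :
    inner ℂ (wave 1 n) (regRes 1 l z (wave 1 n)) = selfEnergy (branch l n.natAbs z) := by
  have h0 := branch_ne_zero hl hz hn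
  rw [regRes_wave hl hz hn, ← cutoff_truncFree_wave h0, inner_wave_truncFree_wave h0, selfEnergy]

lemma inner_wave_regRes_wave_of_ne {l : ℕ} (hl : 10000 ≤ l) {z : ℂ} (hz : ‖z‖ < 10) {m n : ℤ}
    (hmn : m ≠ n) : inner ℂ (wave 1 m) (regRes 1 l z (wave 1 n)) = 0 := by
  rw [regRes, tsum_modeOp_apply (fun j => isModeOp_regTerm 1 l j z) (summable_regTerm 1 hl hz)
    (wave_mem_mode 1 n)]
  exact inner_eq_zero_of_mem_mode hmn (wave_mem_mode 1 m) ((isModeOp_regTerm 1 l n z).mem _)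

/-- The operator is moved onto the wave by taking the adjoint, so the gain `1/l` on constant
profiles is available on the left side of a matrix element as well. -/
lemma norm_inner_wave_regRes_le {l : ℕ} (hl : 10000 ≤ l) {z : ℂ} (hz : ‖z‖ < 10) {m : ℤ}
    (hm : m.natAbs ≠ l) (g : L2) :
    ‖inner ℂ (wave 1 m) (regRes 1 l z g)‖ ≤ 4 * (1 + Real.exp 2) / l * ‖g‖ := by
  set τ := branch l m.natAbs z with hτ
  have hτ0 : -(starRingEnd ℂ) τ ≠ 0 := by
    simpa using branch_ne_zero hl hz hm
  have hnorm : ‖-(starRingEnd ℂ) τ‖ = ‖τ‖ := by rw [norm_neg, RCLike.norm_conj]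
  rw [regRes, inner_tsum_modeOp (fun j => isModeOp_regTerm 1 l j z) (summable_regTerm 1 hl hz)
    (wave_mem_mode 1 m), regTerm_of_ne 1 hm, ← ContinuousLinearMap.adjoint_inner_left,
    ContinuousLinearMap.adjoint_comp, ContinuousLinearMap.adjoint_comp, adjoint_cutoff,
    ContinuousLinearMap.comp_assoc, adjoint_truncFree]
  refine (norm_inner_le_norm _ _).trans (mul_le_mul_of_nonneg_right ?_ (norm_nonneg g))
  change ‖cutoff 1 (truncFree 1 m (-(starRingEnd ℂ) τ) (cutoff 1 (wave 1 m)))‖ ≤ _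
  rw [cutoff_truncFree_wave hτ0]
  refine (norm_toLp_profile_le ?_ m).trans ?_
  · rw [Complex.neg_im, Complex.conj_im, neg_neg]
    exact neg_one_le_branch_im hl hz hm
  · rw [hnorm]
    exact div_norm_sq_le hl (le_norm_branch_sq hl hz hm)

lemma inner_wave_potentialOp (k : ℤ) (g : L2) : inner ℂ (wave 1 k) (potentialOp g) =
    inner ℂ (wave 1 (k + 1)) g + inner ℂ (wave 1 (k - 1)) g := by
  rw [← inner_potentialOp_left, potentialOp_wave le_rfl, inner_add_left]

/-- The inverse of `1 + R₁ V`. -/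
def invOp (l : ℕ) (z : ℂ) : L2 →L[ℂ] L2 := Ring.inverse (1 + regRes 1 l z * potentialOp)

/-- The expansion `(1 + X)⁻¹ = 1 - X + X(1 + X)⁻¹X` keeps the inverse between two factors `X`, so
that each end of the remainder meets a wave and contributes a factor `1/l`. -/
lemma invOp_apply {l : ℕ} {z : ℂ} (hu : IsUnit (1 + regRes 1 l z * potentialOp)) (f : L2) :
    invOp l z f = f - regRes 1 l z (potentialOp f) +
      regRes 1 l z (potentialOp (invOp l z (regRes 1 l z (potentialOp f)))) := by
  set X := regRes 1 l z * potentialOp with hX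
  have h1 : (1 + X) * invOp l z = 1 := Ring.mul_inverse_cancel _ hu
  have h2 : invOp l z * (1 + X) = 1 := Ring.inverse_mul_cancel _ hu
  have h3 : invOp l z = 1 - X + X * invOp l z * X := by
    have h6 : invOp l z + X * invOp l z = 1 := by rw [← h1]; noncomm_ring
    have h7 : invOp l z + invOp l z * X = 1 := by rw [← h2]; noncomm_ring
    have h8 : X * invOp l z = 1 - invOp l z := eq_sub_of_add_eq' h6
    have h9 : invOp l z * X = 1 - invOp l z := eq_sub_of_add_eq' h7
    rw [h8, sub_mul, one_mul, h9]
    abel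
  conv_lhs => rw [h3]
  rfl

/-- At first order `V` connects no two of the modes `±l`. At second order a path goes from `n` to `n
± 1` and on to `k`; since `l` is large it cannot join `l` to `-l`, and the two returning paths give
the self-energies. The remainder is at most `2d · 4Kd`: two neighbours of `k`, each with gain `d`,
paired with a vector of norm at most `2 · K · 2d`. -/
lemma norm_inner_wave_potentialOp_invOp_le {K : ℝ} {l : ℕ} (hl : 10000 ≤ l) {z : ℂ}
    (hz : ‖z‖ < 10) (hu : IsUnit (1 + regRes 1 l z * potentialOp)) (hK : ‖invOp l z‖ ≤ K)
    {k n : ℤ} (hk : k.natAbs = l) (hn : n.natAbs = l) :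
    ‖inner ℂ (wave 1 k) (potentialOp (invOp l z (wave 1 n))) + (if k = n then
      selfEnergy (branch l (l + 1) z) + selfEnergy (branch l (l - 1) z) else 0)‖ ≤
        8 * K * (4 * (1 + Real.exp 2) / l) ^ 2 := by
  set d := 4 * (1 + Real.exp 2) / l with hd
  have hd0 : 0 ≤ d := by positivity
  have hK0 : 0 ≤ K := (norm_nonneg _).trans hK
  set g := potentialOp (invOp l z (regRes 1 l z (potentialOp (wave 1 n)))) with hg
  have hfirst : inner ℂ (wave 1 k) (potentialOp (wave 1 n)) = 0 := by
    rw [potentialOp_wave le_rfl, inner_add_right,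
      inner_eq_zero_of_mem_mode (by omega) (wave_mem_mode 1 k) (wave_mem_mode 1 (n + 1)),
      inner_eq_zero_of_mem_mode (by omega) (wave_mem_mode 1 k) (wave_mem_mode 1 (n - 1)), add_zero]
  have hsecond : inner ℂ (wave 1 k) (potentialOp (regRes 1 l z (potentialOp (wave 1 n)))) =
      if k = n then selfEnergy (branch l (l + 1) z) + selfEnergy (branch l (l - 1) z) else 0 := by
    rw [inner_wave_potentialOp, potentialOp_wave le_rfl, map_add, inner_add_right, inner_add_right]
    split_ifs with hkn
    · subst hkn
      rw [inner_wave_regRes_wave_of_ne hl hz (show k + 1 ≠ k - 1 by omega),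
        inner_wave_regRes_wave_of_ne hl hz (show k - 1 ≠ k + 1 by omega),
        inner_wave_regRes_wave_self hl hz (show (k + 1).natAbs ≠ l by omega),
        inner_wave_regRes_wave_self hl hz (show (k - 1).natAbs ≠ l by omega), add_zero, zero_add]
      rcases Int.natAbs_eq k with h | h
      · rw [show (k + 1).natAbs = l + 1 by omega, show (k - 1).natAbs = l - 1 by omega]
      · rw [show (k + 1).natAbs = l - 1 by omega, show (k - 1).natAbs = l + 1 by omega, add_comm]
    · rw [inner_wave_regRes_wave_of_ne hl hz (show k + 1 ≠ n + 1 by omega),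
        inner_wave_regRes_wave_of_ne hl hz (show k + 1 ≠ n - 1 by omega),
        inner_wave_regRes_wave_of_ne hl hz (show k - 1 ≠ n + 1 by omega),
        inner_wave_regRes_wave_of_ne hl hz (show k - 1 ≠ n - 1 by omega)]
      simp
  have hgn : ‖g‖ ≤ 4 * K * d := by
    have h1 : ‖regRes 1 l z (potentialOp (wave 1 n))‖ ≤ 2 * d := by
      rw [potentialOp_wave le_rfl, map_add]
      refine (norm_add_le _ _).trans ?_
      linarith [norm_regRes_wave_le hl hz (show (n + 1).natAbs ≠ l by omega),
        norm_regRes_wave_le hl hz (show (n - 1).natAbs ≠ l by omega)]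
    have h2 : ‖invOp l z (regRes 1 l z (potentialOp (wave 1 n)))‖ ≤ K * (2 * d) :=
      (ContinuousLinearMap.le_opNorm _ _).trans (by gcongr)
    have h3 : ‖g‖ ≤ 2 * (K * (2 * d)) :=
      (ContinuousLinearMap.le_opNorm _ _).trans
        (mul_le_mul norm_potentialOp_le h2 (norm_nonneg _) zero_le_two)
    linarith
  rw [invOp_apply hu, map_add, map_sub, inner_add_right, inner_sub_right, hfirst, hsecond, zero_sub,
    neg_add_eq_sub, sub_add_cancel, ← hg, inner_wave_potentialOp]
  refine (norm_add_le _ _).trans ?_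
  have h1 := norm_inner_wave_regRes_le hl hz (show (k + 1).natAbs ≠ l by omega) g
  have h2 := norm_inner_wave_regRes_le hl hz (show (k - 1).natAbs ≠ l by omega) g
  rw [← hd] at h1 h2
  have h3 : d * ‖g‖ ≤ d * (4 * K * d) := by gcongr
  nlinarith

/-! ### The 2×2 effective matrix -/

/-- `(c₁, c₂) ↦ c₁ w_l + c₂ w_{-l}` -/
def synth (M : ℝ) (l : ℕ) : ℂ × ℂ →L[ℂ] L2 :=
  (ContinuousLinearMap.toSpanSingleton ℂ (wave M l)).coprod
    (ContinuousLinearMap.toSpanSingleton ℂ (wave M (-l)))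

/-- `f ↦ (⟨w_l, f⟩, ⟨w_{-l}, f⟩)` -/
def analysis (M : ℝ) (l : ℕ) : L2 →L[ℂ] ℂ × ℂ :=
  (innerSL ℂ (wave M l)).prod (innerSL ℂ (wave M (-l)))

lemma synth_apply (M : ℝ) (l : ℕ) (y : ℂ × ℂ) :
    synth M l y = y.1 • wave M l + y.2 • wave M (-l) := rfl

lemma analysis_apply (M : ℝ) (l : ℕ) (f : L2) :
    analysis M l f = (inner ℂ (wave M l) f, inner ℂ (wave M (-l)) f) := rfl

/-- The effective Hamiltonian, whose inverse carries the poles of the resolvent near `τ_l = 0`. -/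
def effective (l : ℕ) (z : ℂ) : ℂ × ℂ →L[ℂ] ℂ × ℂ :=
  z • 1 + (Complex.I / 2) • (analysis 1 l ∘L potentialOp ∘L invOp l z ∘L synth 1 l)

lemma norm_effective_sub_le {K : ℝ} {l : ℕ} (hl : 10000 ≤ l) {z : ℂ}
    (hz : ‖z‖ < 10) (hu : IsUnit (1 + regRes 1 l z * potentialOp)) (hK : ‖invOp l z‖ ≤ K) :
    ‖effective l z - (z - Complex.I / 2 * (selfEnergy (branch l (l + 1) z) +
      selfEnergy (branch l (l - 1) z))) • 1‖ ≤ 8 * K * (4 * (1 + Real.exp 2) / l) ^ 2 := by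
  set e := selfEnergy (branch l (l + 1) z) + selfEnergy (branch l (l - 1) z) with he
  set δ := 8 * K * (4 * (1 + Real.exp 2) / l) ^ 2 with hδ
  have hK0 : 0 ≤ K := (norm_nonneg _).trans hK
  have hδ0 : 0 ≤ δ := by positivity
  have hll : (l : ℤ) ≠ -(l : ℤ) := by omega
  have h11 := norm_inner_wave_potentialOp_invOp_le hl hz hu hK (k := l) (n := l)
    (by omega) (by omega)
  have h12 := norm_inner_wave_potentialOp_invOp_le hl hz hu hK (k := l) (n := -l)
    (by omega) (by omega)
  have h21 := norm_inner_wave_potentialOp_invOp_le hl hz hu hK (k := -l) (n := l)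
    (by omega) (by omega)
  have h22 := norm_inner_wave_potentialOp_invOp_le hl hz hu hK (k := -l) (n := -l)
    (by omega) (by omega)
  rw [if_pos rfl, ← he, ← hδ] at h11 h22
  rw [if_neg hll, add_zero, ← hδ] at h12
  rw [if_neg hll.symm, add_zero, ← hδ] at h21
  have hIhalf : ‖Complex.I / 2‖ = 1 / 2 := by simp
  -- The norm on `ℂ × ℂ` is the maximum, so the operator norm is controlled by row sums: two entries
  -- of size `δ`, times `|i/2| = 1/2`.
  have key : ∀ (p q c₁ c₂ : ℂ) (y : ℂ × ℂ), ‖p‖ ≤ δ → ‖q‖ ≤ δ → ‖c₁‖ ≤ ‖y‖ → ‖c₂‖ ≤ ‖y‖ →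
      ‖Complex.I / 2 * (c₁ * p + c₂ * q)‖ ≤ δ * ‖y‖ := by
    intro p q c₁ c₂ y hp hq h1 h2
    rw [norm_mul, hIhalf]
    have h3 : ‖c₁ * p + c₂ * q‖ ≤ ‖y‖ * δ + ‖y‖ * δ := by
      refine (norm_add_le _ _).trans ?_
      rw [norm_mul, norm_mul]
      gcongr
    linarith
  refine ContinuousLinearMap.opNorm_le_bound _ hδ0 fun y => ?_
  have hJ : (effective l z - (z - Complex.I / 2 * e) • 1) y =
      (Complex.I / 2 * (y.1 * (inner ℂ (wave 1 l) (potentialOp (invOp l z (wave 1 l))) + e) +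
          y.2 * inner ℂ (wave 1 l) (potentialOp (invOp l z (wave 1 (-l))))),
        Complex.I / 2 * (y.1 * inner ℂ (wave 1 (-l)) (potentialOp (invOp l z (wave 1 l))) +
          y.2 * (inner ℂ (wave 1 (-l)) (potentialOp (invOp l z (wave 1 (-l)))) + e))) := by
    have h1 : (effective l z - (z - Complex.I / 2 * e) • 1) y =
        z • y + (Complex.I / 2) • analysis 1 l (potentialOp (invOp l z (synth 1 l y))) -
          (z - Complex.I / 2 * e) • y := rfl
    rw [h1, synth_apply, analysis_apply]
    simp only [map_add, map_smul, inner_add_right, inner_smul_right]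
    ext
    · simp only [Prod.fst_sub, Prod.fst_add, Prod.smul_fst, smul_eq_mul]
      ring
    · simp only [Prod.snd_sub, Prod.snd_add, Prod.smul_snd, smul_eq_mul]
      ring
  rw [hJ]
  exact max_le (key _ _ _ _ y h11 h12 (norm_fst_le y) (norm_snd_le y))
    (key _ _ _ _ y h21 h22 (norm_fst_le y) (norm_snd_le y))

/-! ### Asymptotics of the self-energy -/

/-- From `(σ - s)(σ + s) = u` and `|σ + s| ≥ s`. The number `101` bounds `|z² - 1|` for `|z| < 10`.
-/
lemma root_near {σ u : ℂ} {s : ℝ} (hs : 400 ≤ s) (hσ : σ ^ 2 = (s : ℂ) ^ 2 + u) (hu : ‖u‖ ≤ 101)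
    (hre : 0 < σ.re) : ‖σ - s‖ ≤ 101 / s ∧ s / 2 ≤ ‖σ‖ ∧ ‖σ‖ ≤ 2 * s ∧ s / 4 ≤ σ.re := by
  have hs0 : 0 < s := by linarith
  have h1 : s ≤ ‖σ + s‖ := by
    refine le_trans ?_ (Complex.re_le_norm _)
    simp [hre.le]
  have h2 : ‖σ - s‖ * ‖σ + s‖ ≤ 101 := by
    rw [← norm_mul]
    have : (σ - s) * (σ + s) = u := by linear_combination hσ
    rwa [this]
  have h3 : ‖σ - s‖ ≤ 101 / s := by
    rw [le_div_iff₀ hs0]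
    nlinarith [norm_nonneg (σ - s)]
  have h4 : 101 / s ≤ 1 := by rw [div_le_one hs0]; linarith
  have h5 : ‖(s : ℂ)‖ = s := by rw [Complex.norm_real, Real.norm_of_nonneg hs0.le]
  have h6 := norm_sub_norm_le (s : ℂ) σ
  have h7 := norm_sub_norm_le σ (s : ℂ)
  have h8 := (abs_le.1 ((Complex.abs_re_le_norm (σ - s)).trans (h3.trans h4))).1
  rw [Complex.sub_re, Complex.ofReal_re] at h8
  rw [norm_sub_rev] at h6
  rw [h5] at h6 h7
  exact ⟨h3, by linarith, by linarith, by linarith⟩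

lemma norm_inv_cube_sub_le {σ : ℂ} {s : ℝ} (hs : 400 ≤ s) (h1 : ‖σ - s‖ ≤ 101 / s)
    (h2 : s / 2 ≤ ‖σ‖) (h3 : ‖σ‖ ≤ 2 * s) :
    ‖(σ ^ 3)⁻¹ - ((s : ℂ) ^ 3)⁻¹‖ ≤ 5656 / s ^ 4 := by
  have hs0 : 0 < s := by linarith
  have hn : ‖(s : ℂ)‖ = s := by rw [Complex.norm_real, Real.norm_of_nonneg hs0.le]
  have hsc : (s : ℂ) ≠ 0 := by exact_mod_cast hs0.ne'
  have hσ : σ ≠ 0 := fun h => by rw [h, norm_zero] at h2; linarith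
  have h4 : (σ ^ 3)⁻¹ - ((s : ℂ) ^ 3)⁻¹ =
      -((σ - s) * (s ^ 2 + s * σ + σ ^ 2)) / (σ ^ 3 * (s : ℂ) ^ 3) := by
    field_simp
    ring
  have h5 : ‖(s : ℂ) ^ 2 + s * σ + σ ^ 2‖ ≤ 7 * s ^ 2 := by
    refine norm_add₃_le.trans ?_
    rw [norm_pow, norm_mul, norm_pow, hn]
    nlinarith [norm_nonneg σ]
  have h6 : s ^ 6 / 8 ≤ ‖σ ^ 3 * (s : ℂ) ^ 3‖ := by
    rw [norm_mul, norm_pow, norm_pow, hn]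
    have : (s / 2) ^ 3 ≤ ‖σ‖ ^ 3 := by gcongr
    calc s ^ 6 / 8 = (s / 2) ^ 3 * s ^ 3 := by ring
      _ ≤ _ := by gcongr
  rw [h4, norm_div, norm_neg, norm_mul]
  calc _ ≤ (101 / s * (7 * s ^ 2)) / (s ^ 6 / 8) := by gcongr
    _ = 5656 / s ^ 5 := by field_simp; norm_num
    _ ≤ 5656 / s ^ 4 := by
      have : s ^ 4 ≤ s ^ 5 := pow_le_pow_right₀ (by linarith) (by norm_num)
      gcongr

lemma norm_exp_sub_exp_le {σ : ℂ} {s : ℝ} (hs : 404 ≤ s) (h1 : ‖σ - s‖ ≤ 101 / s) :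
    ‖Complex.exp (2 * Complex.I * σ) - Complex.exp (2 * Complex.I * s)‖ ≤ 404 / s := by
  have hs0 : 0 < s := by linarith
  have h2 : ‖2 * Complex.I * (σ - s)‖ ≤ 202 / s := by
    rw [norm_mul, norm_mul, Complex.norm_I, Complex.norm_ofNat, mul_one]
    calc 2 * ‖σ - s‖ ≤ 2 * (101 / s) := by gcongr
      _ = 202 / s := by ring
  have h3 : 202 / s ≤ 1 := by rw [div_le_one hs0]; linarith
  have h4 : Complex.exp (2 * Complex.I * σ) - Complex.exp (2 * Complex.I * s) =
      Complex.exp (2 * Complex.I * s) * (Complex.exp (2 * Complex.I * (σ - s)) - 1) := by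
    rw [mul_sub, mul_one, ← Complex.exp_add]
    congr 2
    ring
  have h5 : ‖Complex.exp (2 * Complex.I * s)‖ = 1 := by
    rw [show 2 * Complex.I * (s : ℂ) = ((2 * s : ℝ) : ℂ) * Complex.I by push_cast; ring,
      Complex.norm_exp_ofReal_mul_I]
  rw [h4, norm_mul, h5, one_mul]
  refine (Complex.norm_exp_sub_one_le (h2.trans h3)).trans ?_
  calc 2 * ‖2 * Complex.I * (σ - s)‖ ≤ 2 * (202 / s) := by gcongr
    _ = 404 / s := by ring

lemma selfEnergy_I_mul {σ : ℂ} (hσ : σ ≠ 0) :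
    selfEnergy (Complex.I * σ) = 2 / σ ^ 2 - (1 - Complex.exp (-2 * σ)) * (σ ^ 3)⁻¹ := by
  have h1 : 2 * Complex.I * (Complex.I * σ) = -2 * σ := by
    linear_combination 2 * σ * Complex.I_mul_I
  have h2 : (Complex.I * σ) ^ 2 = -σ ^ 2 := by rw [mul_pow, Complex.I_sq]; ring
  have h3 : (Complex.I * σ) ^ 3 = -Complex.I * σ ^ 3 := by
    rw [mul_pow, Complex.I_pow_three]
  have hI := Complex.I_ne_zero
  rw [selfEnergy, h1, h2, h3]
  field_simp
  ring

/-- The squares `s² ± u` are symmetric about `s²`, and the factor `i` turns one of them into its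
negative. The leading terms thus combine to `2/σ² - 2/τ² = 4u/(σ²τ²) = O(s⁻⁴)`. What survives is of
order `s⁻³`, where `σ` and `τ` may be replaced by `s` at the cost of a further `O(s⁻⁴)`. -/
lemma norm_selfEnergy_add_sub_le {τ σ u : ℂ} {s : ℝ} (hs : 404 ≤ s) (hu : ‖u‖ ≤ 101)
    (hτ : τ ^ 2 = (s : ℂ) ^ 2 + u) (hτre : 0 < τ.re) (hσ : σ ^ 2 = (s : ℂ) ^ 2 - u)
    (hσre : 0 < σ.re) :
    ‖selfEnergy (Complex.I * σ) + selfEnergy τ - (Complex.I * (1 - Complex.exp (2 * Complex.I * s))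
      - 1) * ((s : ℂ) ^ 3)⁻¹‖ ≤ 29508 / s ^ 4 := by
  have hs0 : 0 < s := by linarith
  obtain ⟨t1, t2, t3, -⟩ := root_near (by linarith) hτ hu hτre
  obtain ⟨s1, s2, s3, s4⟩ := root_near (s := s) (u := -u) (by linarith) (by rw [hσ]; ring)
    (by rwa [norm_neg]) hσre
  have hτ0 : τ ≠ 0 := fun h => by simp [h] at hτre
  have hσ0 : σ ≠ 0 := fun h => by simp [h] at hσre
  have ct := norm_inv_cube_sub_le (by linarith) t1 t2 t3
  have cs := norm_inv_cube_sub_le (by linarith) s1 s2 s3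
  have he := norm_exp_sub_exp_le hs t1
  have hn : ‖(s : ℂ)‖ = s := by rw [Complex.norm_real, Real.norm_of_nonneg hs0.le]
  have hes : ‖Complex.exp (2 * Complex.I * s)‖ = 1 := by
    rw [show 2 * Complex.I * (s : ℂ) = ((2 * s : ℝ) : ℂ) * Complex.I by push_cast; ring,
      Complex.norm_exp_ofReal_mul_I]
  have hdecomp : selfEnergy (Complex.I * σ) + selfEnergy τ -
      (Complex.I * (1 - Complex.exp (2 * Complex.I * s)) - 1) * ((s : ℂ) ^ 3)⁻¹ =
      (2 / σ ^ 2 - 2 / τ ^ 2) +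
      Complex.I * ((1 - Complex.exp (2 * Complex.I * τ)) * ((τ ^ 3)⁻¹ - ((s : ℂ) ^ 3)⁻¹)) +
      Complex.I * (-(Complex.exp (2 * Complex.I * τ) - Complex.exp (2 * Complex.I * s)) *
        ((s : ℂ) ^ 3)⁻¹) +
      (-((σ ^ 3)⁻¹ - ((s : ℂ) ^ 3)⁻¹)) + Complex.exp (-2 * σ) * (σ ^ 3)⁻¹ := by
    rw [selfEnergy_I_mul hσ0, selfEnergy]
    ring
  have n1 : ‖2 / σ ^ 2 - 2 / τ ^ 2‖ ≤ 6464 / s ^ 4 := by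
    have h : 2 / σ ^ 2 - 2 / τ ^ 2 = 4 * u / (σ ^ 2 * τ ^ 2) := by
      field_simp
      linear_combination 2 * hτ - 2 * hσ
    have h6 : (s / 2) ^ 2 * (s / 2) ^ 2 ≤ ‖σ ^ 2 * τ ^ 2‖ := by
      rw [norm_mul, norm_pow, norm_pow]; gcongr
    rw [h, norm_div, norm_mul, Complex.norm_ofNat]
    calc 4 * ‖u‖ / ‖σ ^ 2 * τ ^ 2‖ ≤ 4 * 101 / ((s / 2) ^ 2 * (s / 2) ^ 2) := by gcongr
      _ = 6464 / s ^ 4 := by field_simp; norm_num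
  have hse : 404 / s ≤ 1 := by rw [div_le_one hs0]; linarith
  have n2 : ‖Complex.I * ((1 - Complex.exp (2 * Complex.I * τ)) *
      ((τ ^ 3)⁻¹ - ((s : ℂ) ^ 3)⁻¹))‖ ≤ 16968 / s ^ 4 := by
    have h1 : ‖1 - Complex.exp (2 * Complex.I * τ)‖ ≤ 3 := by
      have h2 : (1 : ℂ) - Complex.exp (2 * Complex.I * τ) = 1 - Complex.exp (2 * Complex.I * s) -
        (Complex.exp (2 * Complex.I * τ) - Complex.exp (2 * Complex.I * s)) := by ring
      rw [h2]
      refine (norm_sub_le _ _).trans ?_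
      have h3 := norm_sub_le (1 : ℂ) (Complex.exp (2 * Complex.I * s))
      rw [norm_one, hes] at h3
      linarith
    rw [norm_mul, Complex.norm_I, one_mul, norm_mul]
    calc _ ≤ 3 * (5656 / s ^ 4) := by gcongr
      _ = 16968 / s ^ 4 := by ring
  have n3 : ‖Complex.I * (-(Complex.exp (2 * Complex.I * τ) - Complex.exp (2 * Complex.I * s)) *
        ((s : ℂ) ^ 3)⁻¹)‖ ≤ 404 / s ^ 4 := by
    rw [norm_mul, Complex.norm_I, one_mul, norm_mul, norm_neg, norm_inv, norm_pow, hn]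
    calc _ ≤ 404 / s * (s ^ 3)⁻¹ := by gcongr
      _ = 404 / s ^ 4 := by field_simp
  -- The evanescent exponential is far smaller than needed; `e^x ≥ 1 + x` already supplies the
  -- missing factor `1/s`.
  have n5 : ‖Complex.exp (-2 * σ) * (σ ^ 3)⁻¹‖ ≤ 16 / s ^ 4 := by
    have h1 : ‖Complex.exp (-2 * σ)‖ ≤ 2 / s := by
      rw [Complex.norm_exp]
      have h2 : (-2 * σ).re = -(2 * σ.re) := by simp
      have h3 : s / 2 ≤ Real.exp (2 * σ.re) := by linarith [Real.add_one_le_exp (2 * σ.re)]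
      rw [h2, Real.exp_neg]
      calc (Real.exp (2 * σ.re))⁻¹ ≤ (s / 2)⁻¹ := by gcongr
        _ = 2 / s := by field_simp
    rw [norm_mul, norm_inv, norm_pow]
    calc _ ≤ 2 / s * ((s / 2) ^ 3)⁻¹ := by gcongr
      _ = 16 / s ^ 4 := by field_simp; norm_num
  rw [hdecomp]
  refine (norm_add_le _ _).trans ?_
  have n4 : ‖-((σ ^ 3)⁻¹ - ((s : ℂ) ^ 3)⁻¹)‖ ≤ 5656 / s ^ 4 := by rwa [norm_neg]
  have n12 := norm_add₄_le (a := 2 / σ ^ 2 - 2 / τ ^ 2)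
    (b := Complex.I * ((1 - Complex.exp (2 * Complex.I * τ)) * ((τ ^ 3)⁻¹ - ((s : ℂ) ^ 3)⁻¹)))
    (c := Complex.I * (-(Complex.exp (2 * Complex.I * τ) - Complex.exp (2 * Complex.I * s)) *
        ((s : ℂ) ^ 3)⁻¹)) (d := -((σ ^ 3)⁻¹ - ((s : ℂ) ^ 3)⁻¹))
  have hfin : 6464 / s ^ 4 + 16968 / s ^ 4 + 404 / s ^ 4 + 5656 / s ^ 4 + 16 / s ^ 4 =
    29508 / s ^ 4 := by ring
  linarith

/-- The approximate position of the resonance, in the coordinate `τ_l`. -/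
def approxPole (l : ℕ) : ℂ := 1 / (4 * (l : ℂ) * (Real.sqrt (2 * l) : ℂ)) *
  (-1 - Complex.I + Complex.exp (2 * Complex.I * (Real.sqrt (2 * l) : ℂ)))

lemma norm_selfEnergy_sub_approxPole_le {l : ℕ} (hl : 100000 ≤ l) {z : ℂ} (hz : ‖z‖ < 10) :
    ‖Complex.I / 2 * (selfEnergy (branch l (l + 1) z) + selfEnergy (branch l (l - 1) z)) -
      approxPole l‖ ≤ 4000 / (l : ℝ) ^ 2 := by
  have hl4 : 10000 ≤ l := by omega
  have hl' : (100000 : ℝ) ≤ l := by exact_mod_cast hl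
  set s := Real.sqrt (2 * l) with hs
  have hs2 : s ^ 2 = 2 * l := Real.sq_sqrt (by linarith)
  have hs404 : 404 ≤ s := Real.le_sqrt_of_sq_le (by linarith)
  have hs0 : 0 < s := by linarith
  have hs2c : (s : ℂ) ^ 2 = 2 * l := by exact_mod_cast hs2
  have hu : ‖z ^ 2 - 1‖ ≤ 101 := by
    refine (norm_sub_le _ _).trans ?_
    rw [norm_pow, norm_one]
    linarith [norm_sq_le_hundred hz]
  have hlm : ((l - 1 : ℕ) : ℂ) = (l : ℂ) - 1 := by
    rw [Nat.cast_sub (by omega), Nat.cast_one]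
  have hτ : branch l (l - 1) z ^ 2 = (s : ℂ) ^ 2 + (z ^ 2 - 1) := by
    rw [branch_sq, hlm, hs2c]; ring
  set σ := csqrt (-(z ^ 2 + ((l : ℂ) ^ 2 - ((l + 1 : ℕ) : ℂ) ^ 2))) with hσd
  have hσb : branch l (l + 1) z = Complex.I * σ := branch_of_gt (Nat.lt_succ_self l) z
  have hσ : σ ^ 2 = (s : ℂ) ^ 2 - (z ^ 2 - 1) := by
    rw [hσd, csqrt_sq, hs2c]; push_cast; ring
  have hσre : 0 < σ.re := csqrt_re_pos (neg_radicand_re_pos hl4 hz (Nat.lt_succ_self l))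
  have h := norm_selfEnergy_add_sub_le hs404 hu hτ (branch_re_pos hl4 hz (by omega)) hσ hσre
  rw [← hσb] at h
  have hsc : (s : ℂ) ≠ 0 := by exact_mod_cast hs0.ne'
  have hlc : (l : ℂ) ≠ 0 := by
    have : l ≠ 0 := by omega
    exact_mod_cast this
  -- The leading term is `(-1 - i + e^{2is})/(2s³)`, and `s³ = 2l s`.
  have ha : approxPole l = Complex.I / 2 *
      ((Complex.I * (1 - Complex.exp (2 * Complex.I * s)) - 1) * ((s : ℂ) ^ 3)⁻¹) := by
    rw [approxPole, ← hs, pow_succ, hs2c]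
    generalize Complex.exp (2 * Complex.I * s) = E
    field_simp
    linear_combination -4 * (1 - E) * Complex.I_sq
  rw [ha, ← mul_sub, norm_mul]
  have hI : ‖Complex.I / 2‖ = 1 / 2 := by simp
  have h4 : s ^ 4 = 4 * (l : ℝ) ^ 2 := by rw [show s ^ 4 = (s ^ 2) ^ 2 by ring, hs2]; ring
  rw [h4] at h
  rw [hI]
  have h5 : (29508 : ℝ) / (4 * (l : ℝ) ^ 2) ≤ 8000 / (l : ℝ) ^ 2 := by
    rw [div_le_div_iff₀ (by positivity) (by positivity)]
    nlinarith [sq_nonneg (l : ℝ)]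
  have h6 : (8000 : ℝ) / (l : ℝ) ^ 2 = 2 * (4000 / (l : ℝ) ^ 2) := by ring
  linarith

lemma norm_approxPole_le {l : ℕ} (hl : 100000 ≤ l) : ‖approxPole l‖ ≤ 1 := by
  have hl' : (100000 : ℝ) ≤ l := by exact_mod_cast hl
  have hs : 1 ≤ Real.sqrt (2 * l) := Real.le_sqrt_of_sq_le (by linarith)
  have h1 : ‖-1 - Complex.I + Complex.exp (2 * Complex.I * (Real.sqrt (2 * l) : ℂ))‖ ≤ 3 := by
    have h2 : ‖Complex.exp (2 * Complex.I * (Real.sqrt (2 * l) : ℂ))‖ = 1 := by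
      rw [show 2 * Complex.I * (Real.sqrt (2 * l) : ℂ) =
        ((2 * Real.sqrt (2 * l) : ℝ) : ℂ) * Complex.I by push_cast; ring,
        Complex.norm_exp_ofReal_mul_I]
    refine (norm_add_le _ _).trans ?_
    have h3 := norm_sub_le (-1 : ℂ) Complex.I
    rw [norm_neg, norm_one, Complex.norm_I] at h3
    linarith
  rw [approxPole, norm_mul, norm_div, norm_one, norm_mul, norm_mul, Complex.norm_ofNat,
    Complex.norm_natCast, Complex.norm_real, Real.norm_of_nonneg (by linarith), div_mul_eq_mul_div,
    one_mul, div_le_one (by positivity)]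
  nlinarith

/-! ### The continued resolvent near a threshold -/

/-- The matrix differs from `(z - a)·1`, where `a` is the approximate pole, by less than `|z - a|`.
The two parts of the constant are the error of the self-energies and `8K(4(1 + e²)/l)²`, the error
of the matrix elements. -/
lemma isUnit_effective {K : ℝ} {l : ℕ} (hl : 100000 ≤ l) {z : ℂ} (hz : ‖z‖ < 10)
    (hu : IsUnit (1 + regRes 1 l z * potentialOp)) (hK : ‖invOp l z‖ ≤ K)
    (hza : (4000 + 128 * K * (1 + Real.exp 2) ^ 2) / (l : ℝ) ^ 2 < ‖z - approxPole l‖) :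
    IsUnit (effective l z) := by
  set e := Complex.I / 2 * (selfEnergy (branch l (l + 1) z) + selfEnergy (branch l (l - 1) z))
    with he
  have h1 := norm_effective_sub_le (by omega) hz hu hK
  have h2 := norm_selfEnergy_sub_approxPole_le hl hz
  rw [← he] at h1 h2
  have h3 : ‖(z - approxPole l) • 1 - effective l z‖ < ‖z - approxPole l‖ := by
    refine lt_of_le_of_lt ?_ hza
    have h4 : (z - approxPole l) • 1 - effective l z =
        (e - approxPole l) • (1 : ℂ × ℂ →L[ℂ] ℂ × ℂ) - (effective l z - (z - e) • 1) := by
      refine ContinuousLinearMap.ext fun y => ?_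
      simp only [sub_apply, smul_apply]
      module
    rw [h4]
    refine (norm_sub_le _ _).trans ?_
    rw [norm_smul, norm_one, mul_one]
    refine (add_le_add h2 h1).trans_eq ?_
    ring
  have h5 := spectrum.mem_resolventSet_of_norm_lt h3
  rw [spectrum.mem_resolventSet_iff, Algebra.algebraMap_eq_smul_one, sub_sub_cancel] at h5
  exact h5

/-- The continuation of the truncated resolvent, in the coordinate `z = τ_l`. -/
def contOp (M : ℝ) (l : ℕ) (z : ℂ) : L2 →L[ℂ] L2 :=
  regRes M l z - regRes M l z ∘L potentialOp ∘L invOp l z ∘L cutoff 1 ∘L regRes M l z +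
    (synth M l - regRes M l z ∘L potentialOp ∘L invOp l z ∘L synth 1 l) ∘L
      Ring.inverse (effective l z) ∘L ((Complex.I / 2) •
        (analysis M l - analysis 1 l ∘L potentialOp ∘L invOp l z ∘L cutoff 1 ∘L regRes M l z))

lemma differentiableAt_contOp {M : ℝ} (hM : 0 ≤ M) {l : ℕ} (hl : 10000 ≤ l) {z : ℂ} (hz : ‖z‖ < 10)
    (hu : IsUnit (1 + regRes 1 l z * potentialOp)) (hJ : IsUnit (effective l z)) :
    DifferentiableAt ℂ (contOp M l) z := by
  have hN : ∀ {M : ℝ}, 0 ≤ M → DifferentiableAt ℂ (regRes M l) z := fun hM =>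
    (differentiableOn_regRes hM hl).differentiableAt (Metric.isOpen_ball.mem_nhds (by simpa using hz))
  have hB : DifferentiableAt ℂ (invOp l) z :=
    (((hN zero_le_one).mul_const potentialOp).const_add 1).inverse hu
  have hVB : DifferentiableAt ℂ (fun z => potentialOp ∘L invOp l z) z :=
    (differentiableAt_const _).clm_comp hB
  have hVBs : DifferentiableAt ℂ (fun z => potentialOp ∘L invOp l z ∘L synth 1 l) z :=
    (differentiableAt_const _).clm_comp (hB.clm_comp (differentiableAt_const _))
  have hE : DifferentiableAt ℂ (effective l) z :=
    (differentiableAt_id.smul_const _).add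
      (((differentiableAt_const (analysis 1 l)).clm_comp hVBs).fun_const_smul (Complex.I / 2))
  have hVBN : DifferentiableAt ℂ
      (fun z => potentialOp ∘L invOp l z ∘L cutoff 1 ∘L regRes M l z) z :=
    (differentiableAt_const _).clm_comp (hB.clm_comp
      ((differentiableAt_const _).clm_comp (hN hM)))
  exact ((hN hM).sub ((hN hM).clm_comp hVBN)).add
    (((differentiableAt_const _).sub ((hN hM).clm_comp hVBs)).clm_comp
      ((hE.inverse hJ).clm_comp (((differentiableAt_const (analysis M l)).fun_sub
        ((differentiableAt_const (analysis 1 l)).clm_comp hVBN)).fun_const_smul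
          (Complex.I / 2))))

lemma analysis_potentialOp {M : ℝ} (hM : 1 ≤ M) (l : ℕ) (f : L2) :
    analysis M l (potentialOp f) = analysis 1 l (potentialOp f) := by
  have h : ∀ k : ℤ, inner ℂ (wave M k) (potentialOp f) = inner ℂ (wave 1 k) (potentialOp f) :=
    fun k => by rw [← cutoff_wave hM k, inner_cutoff_left, cutoff_potentialOp le_rfl]
  rw [analysis_apply, analysis_apply, h, h]

lemma cutoff_synth {M : ℝ} (hM : 1 ≤ M) (l : ℕ) (y : ℂ × ℂ) :
    cutoff 1 (synth M l y) = synth 1 l y := by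
  rw [synth_apply, synth_apply, map_add, map_smul, map_smul, cutoff_wave hM, cutoff_wave hM]

/-- On the physical sheet, `contOp` is the truncated resolvent. -/
lemma cutoff_eq_contOp {M : ℝ} (hM : 1 ≤ M) {l : ℕ} (hl : 10000 ≤ l) {z : ℂ} (hz : ‖z‖ < 10)
    (hz0 : z ≠ 0) {t : ℤ → ℂ} (ht : ∀ j, 0 < (t j).im) (htb : ∀ j, t j = branch l j.natAbs z)
    (hs : Summable fun j => modeConv j (integrable_outKernel (ht j)).toL1)
    (hu : IsUnit (1 + regRes 1 l z * potentialOp)) (hJ : IsUnit (effective l z))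
    {u h : L2} (hh : cutoff M h = h) (huh : u = freeResolvent t ht (h - potentialOp u)) :
    cutoff M u = contOp M l z h := by
  set v := cutoff 1 u with hv
  have hVv : potentialOp u = potentialOp v := (potentialOp_cutoff le_rfl u).symm
  -- The amplitudes of the singular part are kept as unknowns. Eliminating `v` by means of `(1 +
  -- R₁V)⁻¹` and multiplying the definition of `y` by `z` leaves a 2×2 system with no singularity at
  -- `z = 0`.
  set y : ℂ × ℂ := (Complex.I / (2 * z)) • analysis M l (h - potentialOp v) with hy
  have h1 : cutoff M u = synth M l y + regRes M l z (h - potentialOp v) := by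
    have h2 : cutoff M (h - potentialOp v) = h - potentialOp v := by
      rw [map_sub, hh, cutoff_potentialOp hM]
    have h3 := cutoffL_freeResolvent M hl hz hz0 ht htb hs (h - potentialOp v)
    rw [h2, ← hVv, ← huh, hVv] at h3
    rw [h3, hy, map_smul]
    rfl
  have h4 : (1 + regRes 1 l z * potentialOp) v = synth 1 l y + cutoff 1 (regRes M l z h) := by
    have h5 : cutoff 1 (regRes M l z (potentialOp v)) = regRes 1 l z (potentialOp v) := by
      rw [← cutoffL_regRes hM hl hz, cutoffL_apply]
      simp only [ContinuousLinearMap.comp_apply]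
      rw [cutoff_potentialOp le_rfl]
    have h6 : v = synth 1 l y + cutoff 1 (regRes M l z h) - regRes 1 l z (potentialOp v) := by
      have h7 := congrArg (cutoff 1) h1
      rw [cutoff_cutoff_of_le hM, map_add, cutoff_synth hM, map_sub, map_sub, h5] at h7
      rw [add_sub_assoc]
      exact h7
    change v + regRes 1 l z (potentialOp v) = _
    exact eq_sub_iff_add_eq.1 h6
  have h8 : v = invOp l z (synth 1 l y) + invOp l z (cutoff 1 (regRes M l z h)) := by
    have h9 : invOp l z ((1 + regRes 1 l z * potentialOp) v) = v :=
      congrArg (fun B : L2 →L[ℂ] L2 => B v) (Ring.inverse_mul_cancel _ hu)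
    rw [← map_add, ← h4, h9]
  have h10 : effective l z y = (Complex.I / 2) • (analysis M l h -
      analysis 1 l (potentialOp (invOp l z (cutoff 1 (regRes M l z h))))) := by
    have h11 : z • y = (Complex.I / 2) • (analysis M l h - analysis 1 l (potentialOp v)) := by
      rw [hy, smul_smul, map_sub, analysis_potentialOp hM]
      congr 1
      field_simp
    change z • y + (Complex.I / 2) • analysis 1 l (potentialOp (invOp l z (synth 1 l y))) = _
    rw [h11, h8, map_add, map_add, ← smul_add]
    congr 1
    abel
  have h12 : y = Ring.inverse (effective l z) ((Complex.I / 2) • (analysis M l h -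
      analysis 1 l (potentialOp (invOp l z (cutoff 1 (regRes M l z h)))))) := by
    rw [← h10]
    exact (congrArg (fun B : ℂ × ℂ →L[ℂ] ℂ × ℂ => B y) (Ring.inverse_mul_cancel _ hJ)).symm
  have h13 : contOp M l z h = regRes M l z h -
      regRes M l z (potentialOp (invOp l z (cutoff 1 (regRes M l z h)))) +
      (synth M l y - regRes M l z (potentialOp (invOp l z (synth 1 l y)))) := by
    rw [h12]
    rfl
  rw [h13, h1, h8, map_add, map_sub, map_add]
  abel

/-! ### The continuation for an arbitrary cutoff and the exclusion of poles -/

lemma exists_cutoff_mulOp {χ : Lp ℂ ∞ (volume : Measure X)} (hχ : IsCompactlySupported χ) :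
    ∃ M : ℝ, 1 ≤ M ∧ ∀ f : L2, cutoff M (mulOp χ f) = mulOp χ f ∧
      mulOp χ (cutoff M f) = mulOp χ f := by
  obtain ⟨K, hK, hχK⟩ := hχ
  obtain ⟨c, hc⟩ := (hK.image continuous_fst).isBounded.exists_norm_le
  have hband : ∀ᵐ p : X, band (max c 1) p * χ p = χ p := by
    filter_upwards [hχK] with p hp
    by_cases hpK : p ∈ K
    · rw [band_of_abs_le ((hc p.1 ⟨p, hpK, rfl⟩).trans (le_max_left _ _)), one_mul]
    · rw [hp hpK, mul_zero]
  refine ⟨max c 1, le_max_right _ _, fun f => ⟨?_, ?_⟩⟩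
  · apply Lp.ext
    filter_upwards [coeFn_cutoff (max c 1) (mulOp χ f), coeFn_mulOp χ f, hband] with p h1 h2 h3
    rw [h1, h2, ← mul_assoc, h3]
  · apply Lp.ext
    filter_upwards [coeFn_mulOp χ (cutoff (max c 1) f), coeFn_cutoff (max c 1) f,
      coeFn_mulOp χ f, hband] with p h1 h2 h3 h4
    rw [h1, h2, h3, ← mul_assoc, mul_comm (χ p), h4]

lemma natAbs_cast_sq (j : ℤ) : ((j.natAbs : ℕ) : ℂ) ^ 2 = (j : ℂ) ^ 2 := by
  have h := congrArg (Int.cast : ℤ → ℂ) (Int.natAbs_sq j)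
  simpa only [Int.cast_pow, Int.cast_natCast] using h

lemma summable_modeConv_outKernel {l : ℕ} (hl : 10000 ≤ l) {z : ℂ} (hz : ‖z‖ < 10)
    {t : ℤ → ℂ} (ht : ∀ j, 0 < (t j).im) (htb : ∀ j, t j = branch l j.natAbs z) :
    Summable fun j => modeConv j (integrable_outKernel (ht j)).toL1 := by
  refine summable_of_norm_le_div (l := l) fun j hj => (norm_modeConv_le j _).trans ?_
  rw [integral_norm_outKernel (ht j)]
  exact one_div_norm_mul_im_le hl hz hj (by rw [htb, branch_sq]) (ht j)

/-- A point of the physical sheet, away from the spectrum. -/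
lemma exists_isResolvent_chart {l : ℕ} (hl : 10000 ≤ l) :
    chart l (3 + 3 * Complex.I) ∈ physicalSpace ∧
      ∃ R, IsResolvent potential ((chart l (3 + 3 * Complex.I)).τ 0 ^ 2) R := by
  set z : ℂ := 3 + 3 * Complex.I with hzd
  have hre : z.re = 3 := by simp [hzd]
  have him : z.im = 3 := by simp [hzd]
  have hz : ‖z‖ < 10 := by
    have := Complex.norm_le_abs_re_add_abs_im z
    rw [hre, him] at this
    norm_num at this
    linarith
  -- The imaginary part of `τ_j²` is independent of `j`. Hence `‖τ_j‖ Im τ_j ≥ 9` in every mode, and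
  -- the free resolvent has norm at most `1/9`.
  have hprod : ∀ j, (branch l j z).re * (branch l j z).im = 9 := fun j => by
    have h := congrArg Complex.im (branch_sq l j z)
    rw [im_add_sq_sub_sq, sq, sq, Complex.mul_im, Complex.mul_im, hre, him] at h
    linarith
  have hpos : ∀ j, 0 < (branch l j z).im := fun j => by
    rcases lt_trichotomy j l with h | rfl | h
    · have h1 := branch_re_pos hl hz h
      have h2 := hprod j
      by_contra! h3
      nlinarith
    · rw [branch_self, him]; norm_num
    · exact branch_im_pos hl hz h
  refine ⟨hpos, ?_⟩
  have ht : ∀ j : ℤ, 0 < (branch l j.natAbs z).im := fun j => hpos _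
  have hs := summable_modeConv_outKernel hl hz ht fun _ => rfl
  have hR := isResolvent_freeResolvent (w := (chart l z).τ 0 ^ 2) ht (fun j => by
    rw [chart_τ, branch_sq, branch_sq, natAbs_cast_sq]; push_cast; ring) hs
  refine exists_isResolvent_potential hR (lt_of_le_of_lt (b := 1 / 9) ?_ (by norm_num))
  refine norm_tsum_modeOp_le (fun j => isModeOp_modeConv j _) (by norm_num) (fun j => ?_) hs
  refine (norm_modeConv_le j _).trans ?_
  rw [integral_norm_outKernel (ht j)]
  have h1 := hprod j.natAbs
  have h2 := Complex.re_le_norm (branch l j.natAbs z)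
  refine one_div_le_one_div_of_le (by norm_num) ?_
  nlinarith [ht j]

/-- An annulus suffices: it is connected and reaches the physical space, and the behaviour inside
the small disc, where the effective matrix may be singular, plays no role. By the definition of a
pole, a single holomorphic continuation near a point excludes it. -/
lemma isContinuation_contOp {l : ℕ} (hl : 100000 ≤ l) {χ : Lp ℂ ∞ (volume : Measure X)} {M : ℝ}
    (hM : 1 ≤ M) (hχ : ∀ f : L2, cutoff M (mulOp χ f) = mulOp χ f ∧
      mulOp χ (cutoff M f) = mulOp χ f) {r : ℝ} (hr0 : 0 ≤ r) (hr1 : r < 2)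
    (hu : ∀ z : ℂ, ‖z‖ < 10 → IsUnit (1 + regRes 1 l z * potentialOp))
    (hJ : ∀ z : ℂ, ‖z‖ < 10 → r < ‖z - approxPole l‖ → IsUnit (effective l z)) :
    IsContinuation potential χ {ζ | ζ ∈ sheet l ∧ ζ.τ l ∈ annulus (approxPole l) r 9}
      (fun ζ => mulOp χ ∘L contOp M l (ζ.τ l) ∘L mulOp χ) ∧
    ∀ ζ ∈ {ζ : ZHat | ζ ∈ sheet l ∧ ζ.τ l ∈ annulus (approxPole l) r 9},
      HolomorphicAtZ (fun ζ => mulOp χ ∘L contOp M l (ζ.τ l) ∘L mulOp χ) ζ := by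
  have hl4 : 10000 ≤ l := by omega
  have ha := norm_approxPole_le hl
  have hD : annulus (approxPole l) r 9 ⊆ Metric.ball 0 10 := fun z hz => by
    have := norm_sub_norm_le z (approxPole l)
    rw [mem_ball_zero_iff]
    linarith [hz.2]
  have han : ∀ z ∈ annulus (approxPole l) r 9,
      AnalyticAt ℂ (fun z => mulOp χ ∘L contOp M l z ∘L mulOp χ) z := by
    intro z hz
    have hdiff : DifferentiableOn ℂ (fun z => mulOp χ ∘L contOp M l z ∘L mulOp χ)
        (annulus (approxPole l) r 9) := fun w hw => by
      have hw10 : ‖w‖ < 10 := by simpa using hD hw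
      exact ((differentiableAt_const _).clm_comp ((differentiableAt_contOp (by linarith) hl4 hw10
        (hu w hw10) (hJ w hw10 hw.1)).clm_comp (differentiableAt_const _))).differentiableWithinAt
    exact hdiff.analyticAt ((isOpen_annulus _ _ _).mem_nhds hz)
  refine ⟨⟨?_, ?_, ?_, ?_, ?_⟩, fun ζ hζ => ?_⟩
  · exact (isOpen_sheet hl4).inter ((isOpen_annulus _ _ _).preimage (continuous_τ l))
  · exact isPreconnected_sheet_inter hl4 (isPreconnected_annulus _ hr0 _) hD
  · obtain ⟨h1, h2⟩ := exists_isResolvent_chart hl4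
    -- The base point lies in the annulus because its modulus is between `3` and `6`, the centre has
    -- modulus at most `1`, and the radii satisfy `r < 2` and `9 > 7`.
    have hn : ‖(3 : ℂ) + 3 * Complex.I‖ ≤ 6 := by
      refine (norm_add_le _ _).trans ?_
      rw [norm_mul, Complex.norm_I, Complex.norm_ofNat]; norm_num
    have hn' : 3 ≤ ‖(3 : ℂ) + 3 * Complex.I‖ := by
      refine le_trans ?_ (Complex.re_le_norm _)
      simp
    refine ⟨_, ⟨⟨chart_mem_sheet hl4 (by linarith), ?_⟩, h1⟩, h2⟩
    rw [chart_τ, branch_self]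
    refine ⟨?_, ?_⟩
    · have := norm_sub_norm_le ((3 : ℂ) + 3 * Complex.I) (approxPole l)
      linarith
    · have := norm_sub_le ((3 : ℂ) + 3 * Complex.I) (approxPole l)
      linarith
  · intro ζ hζ
    exact ⟨l, sheet_isCoordinateAt hl4 hζ.1, _, (han _ hζ.2).meromorphicAt,
      Eventually.of_forall fun _ => rfl⟩
  · rintro ζ ⟨⟨hζs, hζD⟩, hζp⟩ R hR f
    have hz10 : ‖ζ.τ l‖ < 10 := hζs.1
    have hz0 : ζ.τ l ≠ 0 := fun h => by simpa [h] using hζp l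
    have ht : ∀ j : ℤ, 0 < (ζ.τ j.natAbs).im := fun j => hζp _
    have htb : ∀ j : ℤ, ζ.τ j.natAbs = branch l j.natAbs (ζ.τ l) := fun j => τ_eq_branch hl4 hζs _
    have hs := summable_modeConv_outKernel hl4 hz10 ht htb
    have hR₀ := isResolvent_freeResolvent (w := ζ.τ 0 ^ 2) ht
      (fun j => by rw [ζ.sq_eq, natAbs_cast_sq]) hs
    have h1 := ((isResolvent_potential_iff hR₀).1 hR (R (mulOp χ f)) (mulOp χ f)).2 rfl
    have h2 := cutoff_eq_contOp hM hl4 hz10 hz0 ht htb hs (hu _ hz10) (hJ _ hz10 hζD.1)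
      (hχ f).1 h1
    rw [← mulOp_eq_smul, ← mulOp_eq_smul, ← (hχ (R (mulOp χ f))).2, h2]
    rfl
  · exact ⟨l, sheet_isCoordinateAt hl4 hζ.1, _, han _ hζ.2, Eventually.of_forall fun _ => rfl⟩

/-- There are no poles away from the approximate position. -/
theorem exists_norm_sub_approxPole_le : ∃ (C : ℝ) (L : ℕ), ∀ l : ℕ, L ≤ l → ∀ ζ ∈ B l 1,
    IsPole potential ζ → ‖ζ.τ l - approxPole l‖ ≤ C / (l : ℝ) ^ 2 := by
  obtain ⟨K, L, hK0, -, hK⟩ := exists_isUnit_one_add_regRes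
  set C : ℝ := 4000 + 128 * K * (1 + Real.exp 2) ^ 2 with hC
  have hC0 : 0 ≤ C := by positivity
  obtain ⟨L', hL'⟩ := exists_nat_ge C
  refine ⟨C, max (max L L') 100000, fun l hl ζ hζ hpole => ?_⟩
  have hl1 : L ≤ l := ((le_max_left _ _).trans (le_max_left _ _)).trans hl
  have hl2 : C ≤ l := hL'.trans
    (by exact_mod_cast ((le_max_right _ _).trans (le_max_left _ _)).trans hl)
  have hl3 : 100000 ≤ l := (le_max_right _ _).trans hl
  have hl3' : (100000 : ℝ) ≤ l := by exact_mod_cast hl3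
  by_contra! hlt
  obtain ⟨χ, hχ, hno⟩ := hpole
  obtain ⟨M, hM, hχM⟩ := exists_cutoff_mulOp hχ
  -- The excluded disc must leave the base point `3 + 3i` outside; `C ≤ l` makes its radius at most
  -- `1/l`.
  have hr : C / (l : ℝ) ^ 2 < 2 := by
    rw [div_lt_iff₀ (by positivity)]
    nlinarith
  obtain ⟨h1, h2⟩ := isContinuation_contOp hl3 hM hχM (by positivity) hr
    (fun z hz => (hK l hl1 z hz).1)
    (fun z hz hza => isUnit_effective hl3 hz (hK l hl1 z hz).1 (hK l hl1 z hz).2 hza)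
  have hζU : ζ ∈ {ζ : ZHat | ζ ∈ sheet l ∧ ζ.τ l ∈ annulus (approxPole l) (C / (l : ℝ) ^ 2) 9} := by
    refine ⟨B_one_subset_sheet (by omega) hζ, hlt, ?_⟩
    have h3 := norm_sub_le (ζ.τ l) (approxPole l)
    linarith [hζ.1, norm_approxPole_le hl3]
  exact hno _ _ h1 hζU (h2 ζ hζU)

end CylinderResonance

end

theorem mainTheorem11 :
    ∃ (C : ℝ) (L : ℕ), ∀ l : ℕ, L ≤ l →
      ∀ ζ ∈ CylinderResonance.B l 1, CylinderResonance.IsPole CylinderResonance.potential ζ →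
        ‖ζ.τ l - 1 / (4 * (l : ℂ) * (Real.sqrt (2 * l) : ℂ)) *
            (-1 - Complex.I + Complex.exp (2 * Complex.I * (Real.sqrt (2 * l) : ℂ)))‖
          ≤ C / (l : ℝ) ^ 2 := by
  exact CylinderResonance.exists_norm_sub_approxPole_le
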